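/- **Setting.** Let $d\ge 0$, $q\ge 1$, let $\Theta\subseteq\mathbb R^d$ be measurable, and consider $\min_{\theta\in\Theta} f(\theta)$, $f(\theta)=\mathbb E[F(\theta,X)]$, where the $q$-dimensional random vector $X$ has law $P_\theta$ (possibly depending on $\theta$) carried by a set $\mathcal X_\theta\subseteq\mathbb R^q$. Assume: $f$ is differentiable on $\Theta$, bounded below there, with Lipschitz gradient on $\Theta$; $F(\theta,\cdot)$ is $C^1$ (on the convex hull of $\mathcal X_\theta$) and $\operatorname{Var}F(\theta,X)$ is bounded over $\theta\in\Theta$; for each $\theta\in\Theta$ there is a continuous bijection $\mu=\mu_\theta$ from $\mathcal X_\theta$ onto the unit cube (containing $(0,1)^q$ and contained in $[0,1]^q$) such that $\mu,\mu^{-1}$ are almost everywhere continuously differentiable and $\mu(X)$ is uniformly distributed; $F$ and $(\theta,u)\mapsto\mu_\theta^{-1}(u)$ are jointly measurable. **Algorithm (SASTRO-DF).** Fix $\theta_0\in\mathbb R^d$, $\Delta_0,\Delta_{\max}>0$, $\eta\in(0,1)$, $\tilde\eta>0$, $0<\underline\gamma<1<\overline\gamma$, $\sigma_{\min}^2>0$,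 $\kappa_{as}>0$, an integer $\bar n\ge2$, positive numbers $\lambda_k$ and $\gamma>0$. For a point $\theta$ and an integer $m\ge1$ split $(0,1]^q$ into $\ell=m^q$ congruent subcubes (strata), draw $\bar n$ independent uniform points $u$ in each stratum, and evaluate $F(\theta,\mu_\theta^{-1}(u))$; let $\tilde f(\theta,n)$, $n=\bar n m^q$, be the average of all values, and let $\widehat{\mathrm{Var}}_0=\frac1n\max(\sigma_{\min}^2,\text{average over the strata of the unbiased sample variances})$. In iteration $k$ with $(\theta_k,\Delta_k)$, the sample size at a point is the least $n\in\{\bar n m^q:m\ge1\}$ with $n\ge\lambda_k$ and $\sqrt{\widehat{\mathrm{Var}}_0}\le\kappa_{as}\Delta_k^{\gamma}/\sqrt{\lambda_k}$. All uniform draws (for different iterations, points, and candidate sample sizes) are independent. Estimate $f$ in this way at $\theta_k$ and $\theta_k\pm\Delta_ke_j$ $(1\le j\le d)$, with sample sizes $N_k^{(0)},\dots,N_k^{(2d)}$; let $M_k$ be the quadratic polynomial with diagonal Hessian that interpolates the $2d+1$ estimates; let $\theta_k^s$ be a (measurably selected) minimizer of $M_k$ over $\{\|\theta-\theta_k\|\le\Delta_k\}$,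 where $f$ is estimated likewise with sample size $N_k^s$; let $\rho_k=\frac{\tilde f(\theta_k)-\tilde f(\theta_k^s)}{M_k(\theta_k)-M_k(\theta_k^s)}$. If $\rho_k\ge\eta$ and $\Delta_k\le\tilde\eta\|\nabla M_k(\theta_k)\|$, set $\theta_{k+1}=\theta_k^s$, $\Delta_{k+1}=\min(\overline\gamma\Delta_k,\Delta_{\max})$; otherwise $\theta_{k+1}=\theta_k$, $\Delta_{k+1}=\underline\gamma\Delta_k$. Put $$T_\epsilon=\inf\{k:\|\nabla f(\theta_k)\|\le\epsilon\},\qquad W_\epsilon=\sum_{k=0}^{T_\epsilon}\Big(\sum_{i=0}^{2d}N_k^{(i)}+N_k^s\Big).$$ **Growth and tail conditions** (constants uniform in $\theta\in\Theta$ unless said otherwise). $(\mathrm{SE}_{\kappa})$: $\mathbb P(|X_i|\ge y)=O(e^{-\kappa_i y})$, $y\ge0$, with $\kappa_i>0$, for all $i$. $(\mathrm{SG}_\xi)$: $\mathbb P(|X_i|\ge y)=O(e^{-(y/\xi_i)^2})$, $y\ge 0$, with $\xi_i>0$, for all $i$. $(\mathrm{PO}_a)$, $a\in\mathbb N^q$: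 $F(\theta,x)$ and $\nabla_xF(\theta,x)$ are $O(1+\sum_j|x_j|^{a_j})$. $(\mathrm{EX}_b)$, $b\in\mathbb R^q$: $F(\theta,x)$ and $\nabla_xF(\theta,x)$ are $O(e^{\sum_jb_j|x_j|})$. In (PO) and (EX), $x$ ranges over the convex hull of $\mathcal X_\theta$, and the constant for $F$ itself (not for its gradient) may depend on $\theta$. Independent margins: the $X_i$ are pairwise independent and $\mu=(\mu_1,\dots,\mu_q)$ with $\mu_i$ the distribution function of $X_i$. **Theorem.** Let $\delta,\varrho>0$. In each of the following cases let $\lambda_0=1$, $\lambda_k=k^{s}$ for $k\ge1$. Then, almost surely on the event that all trust regions $\{\|\theta-\theta_k\|\le\Delta_k\}$ lie in $\Theta$ (the sure event if $\Theta=\mathbb R^d$), there are (random) $C,\epsilon_0>0$ with $W_\epsilon\le C\epsilon^{-e}$ (in particular $T_\epsilon<\infty$) for all $0<\epsilon\le\epsilon_0$, where 1. $s=\frac{(1+\delta)q}{q+2}$, $\gamma=\frac{2q}{q+2}$, $e=\frac{8q+4+2q\delta}{q+2}$, if $\mu_\theta^{-1}$ is differentiable on the open cube with gradient bounded (uniformly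 in $\theta\in\Theta$), and $\nabla_xF$ is bounded on $\{(\theta,x):\theta\in\Theta,x\in\mathcal X_\theta\}$; 2. $s=\frac{(1+\delta)q}{q+1}$, $\gamma=\frac{(4+\varrho)q}{2(q+1)}$, $e=\frac{8q+2+(2\delta+\varrho)q}{q+1}$, if the margins are independent and $(\mathrm{SE}_\kappa)$, $(\mathrm{PO}_a)$ hold; 3. $s=\frac{(1+\delta)q\kappa_{\min}}{(q+1)\kappa_{\min}-2b_{\max}}$, $\gamma=\frac{2q\kappa_{\min}}{(q+1)\kappa_{\min}-2b_{\max}}$, $e=\frac{(8q+2\delta q+2)\kappa_{\min}-4b_{\max}}{(q+1)\kappa_{\min}-2b_{\max}}$, if the margins are independent, $(\mathrm{SE}_\kappa)$, $(\mathrm{EX}_b)$ hold, and $\kappa_{\min}=\min_i\kappa_i>2b_{\max}$, $b_{\max}=\max_ib_i\ge0$; 4. $s,\gamma,e$ as in 2, if the margins are independent and $(\mathrm{SG}_\xi)$, $(\mathrm{PO}_a)$ hold; 5. $s,\gamma,e$ as in 2, if the margins are independent and $(\mathrm{SG}_\xi)$, $(\mathrm{EX}_b)$ hold. Moreover $e<8+2\delta$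 (the exponent $8+2\delta$ being the one obtained without stratification) in cases 1 and 3, and also in cases 2, 4, 5 provided $\varrho q<6+2\delta$. -/

import Mathlib

open MeasureTheory ProbabilityTheory Set
open scoped ENNReal NNReal

noncomputable section

namespace Sastro

/-! ### Diagonal quadratic interpolation models -/

/-- The decision space `ℝ^d` with its Euclidean norm. -/
abbrev Dec (d : ℕ) := EuclideanSpace ℝ (Fin d)

/-- Indices `0, 1, …, 2d` of the interpolation points, and of the basis polynomials:
one centre (constant), `d` forward points (linear terms), `d` backward points (squares). -/
abbrev DesignIdx (d : ℕ) := Unit ⊕ (Fin d ⊕ Fin d)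

/-- The points evaluated in one iteration: `some i` are the interpolation points,
`none` is the candidate. -/
abbrev PointIdx (d : ℕ) := Option (DesignIdx d)

/-- The design points `θ`, `θ + Δ e_j`, `θ - Δ e_j`. -/
def designPoint {d : ℕ} (θ : Dec d) (Δ : ℝ) : DesignIdx d → Dec d
  | Sum.inl _ => θ
  | Sum.inr (Sum.inl j) => θ + Δ • EuclideanSpace.single j (1 : ℝ)
  | Sum.inr (Sum.inr j) => θ - Δ • EuclideanSpace.single j (1 : ℝ)

/-- The basis polynomials `1`, `x_j - θ_j`, `(x_j - θ_j)² / 2`. -/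
def dqBasis {d : ℕ} (θ : Dec d) : DesignIdx d → Dec d → ℝ
  | Sum.inl _, _ => 1
  | Sum.inr (Sum.inl j), x => x j - θ j
  | Sum.inr (Sum.inr j), x => (x j - θ j) ^ 2 / 2

/-- The interpolation matrix: rows are design points, columns are basis polynomials. -/
def dqMatrix {d : ℕ} (θ : Dec d) (Δ : ℝ) : Matrix (DesignIdx d) (DesignIdx d) ℝ :=
  Matrix.of fun i r => dqBasis θ r (designPoint θ Δ i)

/-- The coefficients `β` solving `dqMatrix θ Δ *ᵥ β = y`
(the matrix is invertible for `Δ ≠ 0`, see `dqMatrix_mulVec_eq_iff`). -/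
def dqCoeff {d : ℕ} (θ : Dec d) (Δ : ℝ) (y : DesignIdx d → ℝ) : DesignIdx d → ℝ :=
  Matrix.mulVec (dqMatrix θ Δ)⁻¹ y

/-- The model `M(x) = ∑ β_i φ_i(x)` around the centre `θ`. -/
def dqModel {d : ℕ} (θ : Dec d) (β : DesignIdx d → ℝ) (x : Dec d) : ℝ :=
  ∑ i, β i * dqBasis θ i x

theorem dqMatrix_mulVec {d : ℕ} (θ : Dec d) (Δ : ℝ) (β : DesignIdx d → ℝ) :
    Matrix.mulVec (dqMatrix θ Δ) β = fun i => match i with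
      | Sum.inl _ => β (Sum.inl ())
      | Sum.inr (Sum.inl j) =>
          β (Sum.inl ()) + Δ * β (Sum.inr (Sum.inl j)) + Δ ^ 2 / 2 * β (Sum.inr (Sum.inr j))
      | Sum.inr (Sum.inr j) =>
          β (Sum.inl ()) - Δ * β (Sum.inr (Sum.inl j)) + Δ ^ 2 / 2 * β (Sum.inr (Sum.inr j)) := by
  funext i
  rcases i with i | j | j
  · simp [Matrix.mulVec, dotProduct, dqMatrix, dqBasis, designPoint]
  · simp [Matrix.mulVec, dotProduct, dqMatrix, dqBasis, designPoint, ite_pow, ite_div]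
    ring
  · simp [Matrix.mulVec, dotProduct, dqMatrix, dqBasis, designPoint, ite_pow, ite_div]
    ring

theorem dqMatrix_isUnit {d : ℕ} (θ : Dec d) {Δ : ℝ} (hΔ : Δ ≠ 0) :
    IsUnit (dqMatrix θ Δ) := by
  rw [← Matrix.mulVec_injective_iff_isUnit]
  intro β β' h
  simp only [dqMatrix_mulVec] at h
  have h0 : β (Sum.inl ()) = β' (Sum.inl ()) := congrFun h (Sum.inl ())
  have hp := fun j => congrFun h (Sum.inr (Sum.inl j))
  have hm := fun j => congrFun h (Sum.inr (Sum.inr j))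
  simp only [h0] at hp hm
  have hΔ2 : Δ ^ 2 ≠ 0 := pow_ne_zero 2 hΔ
  funext i
  rcases i with i | j | j
  · exact h0
  · refine mul_left_cancel₀ hΔ ?_
    linarith [hp j, hm j]
  · refine mul_left_cancel₀ hΔ2 ?_
    linarith [hp j, hm j]

/-- For `Δ ≠ 0` the interpolation system has exactly one solution, namely `dqCoeff`. -/
theorem dqMatrix_mulVec_eq_iff {d : ℕ} (θ : Dec d) {Δ : ℝ} (hΔ : Δ ≠ 0)
    (y β : DesignIdx d → ℝ) :
    Matrix.mulVec (dqMatrix θ Δ) β = y ↔ β = dqCoeff θ Δ y := by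
  have hu : IsUnit (dqMatrix θ Δ).det :=
    (Matrix.isUnit_iff_isUnit_det _).1 (dqMatrix_isUnit θ hΔ)
  constructor
  · rintro rfl
    simp [dqCoeff, Matrix.mulVec_mulVec, Matrix.nonsing_inv_mul _ hu]
  · rintro rfl
    simp [dqCoeff, Matrix.mulVec_mulVec, Matrix.mul_nonsing_inv _ hu]

/-! ### The stochastic optimization problem -/

/-- The uniform distribution on the unit cube `(0,1]^q`. -/
def cubeUniform (q : ℕ) : Measure (Fin q → ℝ) :=
  volume.restrict (Set.univ.pi fun _ => Set.Ioc (0 : ℝ) 1)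

/-- The data of `min_{θ ∈ Θ} f(θ)`, `f(θ) = E[F(θ, X)]`. The law of `X`, its support and the
map `μ` onto the unit cube (with inverse `muInv`) may depend on `θ`. The set `cube θ` is the unit
cube, closed or open along the different parts of its boundary. -/
structure Problem (d q : ℕ) where
  Θ : Set (Dec d)
  F : Dec d → (Fin q → ℝ) → ℝ
  law : Dec d → Measure (Fin q → ℝ)
  supp : Dec d → Set (Fin q → ℝ)
  cube : Dec d → Set (Fin q → ℝ)
  mu : Dec d → (Fin q → ℝ) → (Fin q → ℝ)
  muInv : Dec d → (Fin q → ℝ) → (Fin q → ℝ)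

/-- `mu` is a continuous bijection from `S` onto the unit cube `U`, with inverse `muInv`; both are
continuously differentiable almost everywhere, `P` is carried by `S`, and `mu` transforms `P` into
the uniform distribution. -/
structure IsUniformizing {q : ℕ} (P : Measure (Fin q → ℝ)) (S U : Set (Fin q → ℝ))
    (mu muInv : (Fin q → ℝ) → (Fin q → ℝ)) : Prop where
  mem_supp : ∀ᵐ x ∂P, x ∈ S
  open_cube_subset : (Set.univ.pi fun _ => Set.Ioo (0 : ℝ) 1) ⊆ U
  subset_closed_cube : U ⊆ (Set.univ.pi fun _ => Set.Icc (0 : ℝ) 1)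
  measurable_mu : Measurable mu
  continuousOn_mu : ContinuousOn mu S
  bijOn : Set.BijOn mu S U
  invOn : Set.InvOn muInv mu S U
  map_eq : P.map mu = cubeUniform q
  contDiff_mu : ∀ᵐ x ∂P, ContDiffWithinAt ℝ 1 mu S x
  contDiff_muInv : ∀ᵐ u ∂(cubeUniform q), ContDiffWithinAt ℝ 1 muInv U u

namespace Problem

variable {d q : ℕ}

/-- The objective function `f(θ) = E[F(θ, X)]`. -/
def f (P : Problem d q) (θ : Dec d) : ℝ := ∫ x, P.F θ x ∂(P.law θ)

/-- Standing assumptions: `f` is bounded below with Lipschitz gradient on `Θ`; `F` is `C¹` in `x`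
with bounded variance over `Θ`; `X` is transformed into a uniform vector by `μ`. -/
structure Standing (P : Problem d q) : Prop where
  measurableSet_Θ : MeasurableSet P.Θ
  measurable_F : Measurable (Function.uncurry P.F)
  measurable_muInv : Measurable (Function.uncurry P.muInv)
  f_bddBelow : BddBelow (P.f '' P.Θ)
  f_differentiable : ∀ θ ∈ P.Θ, DifferentiableAt ℝ P.f θ
  f_gradient_lipschitz : ∃ L : ℝ≥0, LipschitzOnWith L (gradient P.f) P.Θ
  F_contDiff : ∀ θ ∈ P.Θ, ∀ x ∈ convexHull ℝ (P.supp θ), ContDiffAt ℝ 1 (P.F θ) x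
  F_variance : ∃ C : ℝ, ∀ θ ∈ P.Θ,
    MemLp (P.F θ) 2 (P.law θ) ∧ variance (P.F θ) (P.law θ) ≤ C
  uniformizing : ∀ θ ∈ P.Θ,
    IsUniformizing (P.law θ) (P.supp θ) (P.cube θ) (P.mu θ) (P.muInv θ)

/-- `∇μ⁻¹` is bounded on the unit cube (and so is `∇ₓF` on the support of `X`),
uniformly over `Θ`. -/
def BoundedGradient (P : Problem d q) : Prop :=
  (∃ C : ℝ, ∀ θ ∈ P.Θ, ∀ u ∈ (Set.univ.pi fun _ : Fin q => Set.Ioo (0 : ℝ) 1),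
    DifferentiableAt ℝ (P.muInv θ) u ∧ ‖fderiv ℝ (P.muInv θ) u‖ ≤ C) ∧
  (∃ C : ℝ, ∀ θ ∈ P.Θ, ∀ x ∈ P.supp θ, ‖fderiv ℝ (P.F θ) x‖ ≤ C)

/-- The components of `X` are independent, and `μ = (μ_1, …, μ_q)` consists of their
cumulative distribution functions (the Rosenblatt transformation in the independent case). -/
def IndepMargins (P : Problem d q) : Prop :=
  ∀ θ ∈ P.Θ,
    (∀ i j : Fin q, i ≠ j →
      IndepFun (fun x : Fin q → ℝ => x i) (fun x : Fin q → ℝ => x j) (P.law θ)) ∧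
    ∀ x ∈ P.supp θ, ∀ i, P.mu θ x i = cdf ((P.law θ).map fun y => y i) (x i)

/-- The `i`-th component is sub-exponential with parameter `κ i`, for every `i`. -/
def SubExponential (P : Problem d q) (κ : Fin q → ℝ) : Prop :=
  ∀ i, ∃ C : ℝ, ∀ θ ∈ P.Θ, ∀ y : ℝ, 0 ≤ y →
    (P.law θ).real {x | y ≤ |x i|} ≤ C * Real.exp (-(κ i * y))

/-- The `i`-th component is sub-Gaussian with parameter `ξ i`, for every `i`. -/
def SubGaussian (P : Problem d q) (ξ : Fin q → ℝ) : Prop :=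
  ∀ i, ∃ C : ℝ, ∀ θ ∈ P.Θ, ∀ y : ℝ, 0 ≤ y →
    (P.law θ).real {x | y ≤ |x i|} ≤ C * Real.exp (-(y / ξ i) ^ 2)

/-- `F(θ, ·)` and its gradient have growth of order `g`; the constant for the gradient does not
depend on `θ`. -/
def HasGrowth (P : Problem d q) (g : (Fin q → ℝ) → ℝ) : Prop :=
  (∀ θ ∈ P.Θ, ∃ C : ℝ, ∀ x ∈ convexHull ℝ (P.supp θ), |P.F θ x| ≤ C * g x) ∧
  (∃ C : ℝ, ∀ θ ∈ P.Θ, ∀ x ∈ convexHull ℝ (P.supp θ), ‖fderiv ℝ (P.F θ) x‖ ≤ C * g x)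

/-- `F` is polynomial in `X` with parameter `a`. -/
def PolynomialGrowth (P : Problem d q) (a : Fin q → ℕ) : Prop :=
  P.HasGrowth fun x => 1 + ∑ j, |x j| ^ a j

/-- `F` is exponential in `X` with parameter `b`. -/
def ExponentialGrowth (P : Problem d q) (b : Fin q → ℝ) : Prop :=
  P.HasGrowth fun x => Real.exp (∑ j, b j * |x j|)

end Problem

/-! ### The algorithm -/

/-- The inputs of the algorithm. The map `solver` returns, for a centre, a radius and model
coefficients, a minimizer of the model over the trust region. -/
structure Params (d : ℕ) where
  θ₀ : Dec d
  Δ₀ : ℝ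
  Δmax : ℝ
  η : ℝ
  ηt : ℝ
  γup : ℝ
  γlow : ℝ
  σminSq : ℝ
  κas : ℝ
  nbar : ℕ
  solver : Dec d → ℝ → (DesignIdx d → ℝ) → Dec d

/-- Admissible inputs. -/
structure Params.Admissible {d : ℕ} (A : Params d) : Prop where
  Δ₀_pos : 0 < A.Δ₀
  Δmax_pos : 0 < A.Δmax
  η_pos : 0 < A.η
  η_lt_one : A.η < 1
  ηt_pos : 0 < A.ηt
  γlow_pos : 0 < A.γlow
  γlow_lt_one : A.γlow < 1
  one_lt_γup : 1 < A.γup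
  σminSq_pos : 0 < A.σminSq
  κas_pos : 0 < A.κas
  two_le_nbar : 2 ≤ A.nbar
  solver_measurable :
    Measurable fun p : Dec d × ℝ × (DesignIdx d → ℝ) => A.solver p.1 p.2.1 p.2.2
  solver_mem : ∀ θ Δ β, 0 < Δ → A.solver θ Δ β ∈ Metric.closedBall θ Δ
  solver_isMinOn : ∀ θ Δ β, 0 < Δ →
    IsMinOn (dqModel θ β) (Metric.closedBall θ Δ) (A.solver θ Δ β)

/-- The uniform draws of one call of the sampling routine: stratum and replication number. -/
abbrev Draws (q : ℕ) := (Fin q → ℕ) → ℕ → (Fin q → ℝ)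

/-- Labels of all uniform draws: iteration, evaluated point, number of strata per axis,
stratum, replication. -/
abbrev SampleIdx (d q : ℕ) := ℕ × PointIdx d × ℕ × (Fin q → ℕ) × ℕ

section Sampling

variable {d q : ℕ} (P : Problem d q) (A : Params d)

/-- The `r`-th oracle value `F(θ, μ⁻¹(u + v/m))` in the stratum with left endpoint `u = s/m`,
where `m` is the number of strata per axis. -/
def oracleValue (θ : Dec d) (m : ℕ) (v : Draws q) (s : Fin q → Fin m) (r : Fin A.nbar) : ℝ :=
  P.F θ (P.muInv θ fun j => (s j : ℝ) / m + v (fun i => s i) r j / m)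

/-- The sample average in a stratum. -/
def stratumMean (θ : Dec d) (m : ℕ) (v : Draws q) (s : Fin q → Fin m) : ℝ :=
  (1 / (A.nbar : ℝ)) * ∑ r, oracleValue P A θ m v s r

/-- The sample variance in a stratum. -/
def stratumVar (θ : Dec d) (m : ℕ) (v : Draws q) (s : Fin q → Fin m) : ℝ :=
  (1 / ((A.nbar : ℝ) - 1)) *
    ∑ r, (oracleValue P A θ m v s r - stratumMean P A θ m v s) ^ 2

/-- The stratified sampling estimator with `ℓ = m^q` strata. -/
def stratifiedEstimate (θ : Dec d) (m : ℕ) (v : Draws q) : ℝ :=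
  (1 / (m : ℝ) ^ q) * ∑ s, stratumMean P A θ m v s

/-- The estimated variance of the stratified estimator for the sample size `n = nbar * m^q`,
with the variance floor `σminSq`. -/
def varEstimate (θ : Dec d) (m : ℕ) (v : Draws q) : ℝ :=
  (1 / ((A.nbar : ℝ) * (m : ℝ) ^ q)) *
    max A.σminSq ((1 / (m : ℝ) ^ q) * ∑ s, stratumVar P A θ m v s)

variable (lam : ℕ → ℝ) (gam : ℝ)

/-- The sample size `nbar * m^q` passes the adaptive sampling rule in iteration `k`. -/
def Passes (k : ℕ) (θ : Dec d) (Δ : ℝ) (w : ℕ → Draws q) (m : ℕ) : Prop :=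
  1 ≤ m ∧ lam k ≤ (A.nbar : ℝ) * (m : ℝ) ^ q ∧
    Real.sqrt (varEstimate P A θ m (w m)) ≤ A.κas * Δ ^ gam / Real.sqrt (lam k)

/-- The number of strata per axis at which sampling stops: the least one that passes the rule
(`⊤` if there is none). -/
def strataPerAxis (k : ℕ) (θ : Dec d) (Δ : ℝ) (w : ℕ → Draws q) : ℕ∞ :=
  ⨅ (m : ℕ) (_ : Passes P A lam gam k θ Δ w m), (m : ℕ∞)

/-- The adaptive sample size `N`. -/
def sampleSize (k : ℕ) (θ : Dec d) (Δ : ℝ) (w : ℕ → Draws q) : ℕ∞ :=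
  (A.nbar : ℕ∞) * strataPerAxis P A lam gam k θ Δ w ^ q

/-- The estimate of `f(θ)` with the adaptive sample size. -/
def adaptiveEstimate (k : ℕ) (θ : Dec d) (Δ : ℝ) (w : ℕ → Draws q) : ℝ :=
  stratifiedEstimate P A θ (strataPerAxis P A lam gam k θ Δ w).toNat
    (w (strataPerAxis P A lam gam k θ Δ w).toNat)

/-- The model coefficients in iteration `k`. -/
def modelCoeff (k : ℕ) (θ : Dec d) (Δ : ℝ) (w : PointIdx d → ℕ → Draws q) : DesignIdx d → ℝ :=
  dqCoeff θ Δ fun i =>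
    adaptiveEstimate P A lam gam k (designPoint θ Δ i) Δ (w (some i))

/-- The points evaluated in iteration `k`: the interpolation points and the candidate. -/
def evalPoint (k : ℕ) (θ : Dec d) (Δ : ℝ) (w : PointIdx d → ℕ → Draws q) : PointIdx d → Dec d
  | some i => designPoint θ Δ i
  | none => A.solver θ Δ (modelCoeff P A lam gam k θ Δ w)

/-- The acceptance ratio `ρ_k`. -/
def acceptanceRatio (k : ℕ) (θ : Dec d) (Δ : ℝ) (w : PointIdx d → ℕ → Draws q) : ℝ :=
  (adaptiveEstimate P A lam gam k θ Δ (w (some (Sum.inl ()))) -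
    adaptiveEstimate P A lam gam k (evalPoint P A lam gam k θ Δ w none) Δ (w none)) /
  (dqModel θ (modelCoeff P A lam gam k θ Δ w) θ -
    dqModel θ (modelCoeff P A lam gam k θ Δ w) (evalPoint P A lam gam k θ Δ w none))

open Classical in
/-- One iteration: from `(θ_k, Δ_k)` to `(θ_{k+1}, Δ_{k+1})`. -/
def iterate (k : ℕ) (z : Dec d × ℝ) (w : PointIdx d → ℕ → Draws q) : Dec d × ℝ :=
  if A.η ≤ acceptanceRatio P A lam gam k z.1 z.2 w ∧
      z.2 ≤ A.ηt * ‖gradient (dqModel z.1 (modelCoeff P A lam gam k z.1 z.2 w)) z.1‖ then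
    (evalPoint P A lam gam k z.1 z.2 w none, min (A.γup * z.2) A.Δmax)
  else (z.1, A.γlow * z.2)

/-- The draws available to iteration `k` among all draws `v`. -/
def drawsAt (v : SampleIdx d q → (Fin q → ℝ)) (k : ℕ) : PointIdx d → ℕ → Draws q :=
  fun i m s r => v (k, i, m, s, r)

/-- The sequence `(θ_k, Δ_k)` generated by the algorithm from the draws `v`. -/
def run (v : SampleIdx d q → (Fin q → ℝ)) : ℕ → Dec d × ℝ
  | 0 => (A.θ₀, A.Δ₀)
  | k + 1 => iterate P A lam gam k (run v k) (drawsAt v k)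

/-- The sample size `N_k^{(i)}` of the `i`-th point in iteration `k`. -/
def runSampleSize (v : SampleIdx d q → (Fin q → ℝ)) (k : ℕ) (i : PointIdx d) : ℕ∞ :=
  sampleSize P A lam gam k
    (evalPoint P A lam gam k (run P A lam gam v k).1 (run P A lam gam v k).2 (drawsAt v k) i)
    (run P A lam gam v k).2 (drawsAt v k i)

/-- `T_ε`, the first `k` with `‖∇f(θ_k)‖ ≤ ε` (`⊤` if there is none). -/
def hittingTime (v : SampleIdx d q → (Fin q → ℝ)) (ε : ℝ) : ℕ∞ :=
  ⨅ (k : ℕ) (_ : ‖gradient P.f (run P A lam gam v k).1‖ ≤ ε), (k : ℕ∞)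

open Classical in
/-- `W_ε`, the total number of oracle calls in the iterations `0, …, T_ε`. -/
def oracleCalls (v : SampleIdx d q → (Fin q → ℝ)) (ε : ℝ) : ℝ≥0∞ :=
  ∑' k : ℕ, if (k : ℕ∞) ≤ hittingTime P A lam gam v ε then
    ∑ i : PointIdx d, (runSampleSize P A lam gam v k i : ℝ≥0∞) else 0

/-- Almost surely, `W_ε = O(ε^{-e})` for small `ε`, on the event that the trust regions stay
in `Θ` (which is everything when `Θ = ℝ^d`). -/
def SampleComplexity {Ω : Type*} [MeasurableSpace Ω] (Pr : Measure Ω)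
    (V : SampleIdx d q → Ω → (Fin q → ℝ)) (e : ℝ) : Prop :=
  ∀ᵐ ω ∂Pr,
    (∀ k, Metric.closedBall (run P A lam gam (fun a => V a ω) k).1
      (run P A lam gam (fun a => V a ω) k).2 ⊆ P.Θ) →
    ∃ C > 0, ∃ ε₀ > 0, ∀ ε : ℝ, 0 < ε → ε ≤ ε₀ →
      oracleCalls P A lam gam (fun a => V a ω) ε ≤ ENNReal.ofReal (C * ε ^ (-e))

end Sampling

/-- The sequence `λ_k = k^s`, with `λ_0 = 1`. -/
def powSeq (s : ℝ) (k : ℕ) : ℝ := (max 1 (k : ℝ)) ^ s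

end Sastro

end

/-!
The adaptive sampling rule buys accuracy, and stratification makes this accuracy cheap.

If the variance of the oracle within the `m ^ q` strata is on average `O(m ^ (-p))`, then the
stratified estimator with `n` draws has variance `O(n ^ (-(q + p) / q))` rather than `O(n ^ (-1))`.
For a bounded gradient the mean value inequality gives `p = 2`
(`Problem.BoundedGradient.varianceDecay`). For independent margins the oracle is unbounded near the
boundary of the cube; integrating its oscillation against the tails of the margins gives every
`p < 1 - 2 b / κ` for an oracle of exponential growth `b` and sub-exponential tails `κ`
(`Problem.IndepMargins.varianceDecay`). A polynomial oracle has every positive growth rate and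
sub-Gaussian tails have every rate `κ`, so that in these cases every `p < 1` is possible.

Because of the variance floor, a call of the sampling routine needs about
`R = k ^ s max (1, Δ ^ (-2 γ))` draws at least (`floorSize`). The sample variances of the strata
tend to zero, and different stratifications use independent draws. So the rule stops within
boundedly many refinements of this minimum, except with a probability that is summable in `k`. By
Chebyshev's inequality the estimates in this window have error at most `Δ ^ (2 - τ)`, and at most
`c₀ Δ ^ 2` if `Δ ≥ 1 / k ^ 2`, again up to summable probabilities, provided `s (q + p) > q` and
`γ (q + p) ≥ 2 q` up to a small slack (`measure_not_goodCall_le`). The point at which a call takes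
place is random but independent of the draws of the call, so that it can be frozen
(`measure_subst_le`), and by the Borel-Cantelli lemma almost surely all but finitely many iterations
succeed (`ae_eventually_goodCall`).

The rest is deterministic. The diagonal quadratic model inherits the accuracy of the estimates
(`model_accuracy`). Therefore, if `Δ ≥ 1 / k ^ 2`, an accepted step decreases the objective by a
multiple of `Δ ^ 2`, and a rejected step implies `‖∇f‖ = O(Δ)`. For smaller `Δ` an accepted step
increases the objective by a summable amount at most, and a rejected step implies
`‖∇f‖ = O(Δ ^ (1 - τ))` (`exists_stepOK`). As the objective is bounded below, the squared radii are
summable. Before `‖∇f‖` falls below `ε` the radii are at least of order `ε`, apart from `O(1 / ε)`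
early iterations, so that there are `O(ε ^ (-2))` iterations of `O(k ^ s ε ^ (-2 γ))` draws, which
add up to `O(ε ^ (-(2 s + 2 + 2 γ)))` draws (`exists_sum_evaluations_le`). With `s` slightly above
the bound required by the three ranges of `p`, and `γ` at its bound or slightly above, these are the
exponents of the theorem (`sampleComplexity_of_varianceDecay`).
-/

noncomputable section

namespace Sastro

/-! ### The uniform distribution on the cube and its strata -/

/-- The uniform distribution on `(0,1]`. -/
def unifI : Measure ℝ := volume.restrict (Ioc (0 : ℝ) 1)

instance : IsProbabilityMeasure unifI := ⟨by simp [unifI]⟩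

theorem cubeUniform_eq_pi (q : ℕ) : cubeUniform q = Measure.pi fun _ : Fin q => unifI := by
  unfold cubeUniform unifI
  rw [volume_pi, Measure.restrict_pi_pi]

instance (q : ℕ) : IsProbabilityMeasure (cubeUniform q) := by
  rw [cubeUniform_eq_pi]; infer_instance

/-- The affine map of the unit interval onto the `l`-th of `m` intervals of length `1 / m`. -/
def cellPoint (m : ℕ) (l : Fin m) (t : ℝ) : ℝ := (l : ℝ) / m + t / m

/-- The affine map of the unit cube onto the stratum with left endpoint `s / m`. -/
def stratumPoint {q : ℕ} (m : ℕ) (s : Fin q → Fin m) (v : Fin q → ℝ) : Fin q → ℝ :=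
  fun j => cellPoint m (s j) (v j)

@[fun_prop]
theorem measurable_cellPoint (m : ℕ) (l : Fin m) : Measurable (cellPoint m l) := by
  unfold cellPoint; fun_prop

@[fun_prop]
theorem measurable_stratumPoint {q : ℕ} (m : ℕ) (s : Fin q → Fin m) :
    Measurable (stratumPoint m s) := by
  unfold stratumPoint; fun_prop

theorem cellPoint_mem_Ioo {m : ℕ} (l : Fin m) {t : ℝ} (ht : t ∈ Ioo (0 : ℝ) 1) :
    cellPoint m l t ∈ Ioo (0 : ℝ) 1 := by
  have hm : (0 : ℝ) < m := by exact_mod_cast l.pos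
  have hl : (l : ℝ) + 1 ≤ m := by exact_mod_cast l.2
  have hl0 : (0 : ℝ) ≤ (l : ℝ) := by positivity
  unfold cellPoint
  rw [← add_div]
  constructor
  · exact div_pos (by linarith [ht.1]) hm
  · rw [div_lt_one hm]; linarith [ht.2]

theorem sum_map_cellPoint {m : ℕ} (hm : 1 ≤ m) :
    ∑ l : Fin m, unifI.map (cellPoint m l) = (m : ℝ≥0∞) • unifI := by
  have hm0 : (0 : ℝ) < m := by exact_mod_cast hm
  ext B hB
  simp only [Measure.coe_finsetSum, Finset.sum_apply, Measure.smul_apply, smul_eq_mul]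
  have hcell : ∀ l : Fin m, unifI.map (cellPoint m l) B =
      m * volume (B ∩ Ioc ((l : ℝ) / m) (((l : ℕ) + 1 : ℕ) / m)) := by
    intro l
    rw [Measure.map_apply (measurable_cellPoint m l) hB, unifI,
      Measure.restrict_apply (measurable_cellPoint m l hB)]
    have hset : cellPoint m l ⁻¹' B ∩ Ioc 0 1 =
        (fun t : ℝ => t * (m : ℝ)⁻¹) ⁻¹' ((fun x : ℝ => (l : ℝ) / m + x) ⁻¹'
          (B ∩ Ioc ((l : ℝ) / m) (((l : ℕ) + 1 : ℕ) / m))) := by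
      ext t
      simp only [cellPoint, mem_inter_iff, mem_preimage, mem_Ioc, ← div_eq_mul_inv]
      refine and_congr Iff.rfl ?_
      push_cast
      rw [← add_div, div_lt_div_iff_of_pos_right hm0, div_le_div_iff_of_pos_right hm0]
      constructor <;> rintro ⟨h1, h2⟩ <;> constructor <;> linarith
    rw [hset, Real.volume_preimage_mul_right (by positivity), measure_preimage_add]
    congr 1
    rw [inv_inv, abs_of_pos hm0, ENNReal.ofReal_natCast]
  simp_rw [hcell]
  rw [← Finset.mul_sum]
  congr 1
  have hmono : Monotone fun l : ℕ => (l : ℝ) / m := fun a b hab => by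
    show (a : ℝ) / m ≤ (b : ℝ) / m
    gcongr
  have hun := hmono.biUnion_Ico_Ioc_map_succ 0 m
  have hdis := hmono.pairwise_disjoint_on_Ioc_succ
  simp only [Nat.succ_eq_succ, Nat.cast_zero, zero_div, div_self hm0.ne'] at hun hdis
  rw [unifI, Measure.restrict_apply hB, ← hun, inter_iUnion₂,
    ← Finset.sum_range fun l : ℕ => volume (B ∩ Ioc ((l : ℝ) / m) ((l + 1 : ℕ) / m))]
  rw [show (⋃ i ∈ Ico 0 m, B ∩ Ioc ((i : ℝ) / m) ((Nat.succ i : ℕ) / m)) =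
    ⋃ i ∈ Finset.range m, B ∩ Ioc ((i : ℝ) / m) ((i + 1 : ℕ) / m) by simp]
  rw [measure_biUnion_finset]
  · intro i _ j _ hij
    exact (hdis hij).mono inter_subset_right inter_subset_right
  · intro i _
    exact hB.inter measurableSet_Ioc

/-- The uniform distribution is the equal mixture of the uniform distributions on the strata. -/
theorem sum_map_stratumPoint (q : ℕ) {m : ℕ} (hm : 1 ≤ m) :
    ∑ s : Fin q → Fin m, (cubeUniform q).map (stratumPoint m s) =
      ((m : ℝ≥0∞) ^ q) • cubeUniform q := by
  have hm0 : (m : ℝ≥0∞) ≠ 0 := by exact_mod_cast (by omega : m ≠ 0)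
  have hmt : (m : ℝ≥0∞) ≠ ∞ := ENNReal.natCast_ne_top m
  have key : ((m : ℝ≥0∞) ^ q)⁻¹ • ∑ s : Fin q → Fin m, (cubeUniform q).map (stratumPoint m s) =
      cubeUniform q := by
    rw [cubeUniform_eq_pi]
    symm
    refine Measure.pi_eq fun B hB => ?_
    have hmap : ∀ s : Fin q → Fin m,
        (Measure.pi fun _ : Fin q => unifI).map (stratumPoint m s) =
          Measure.pi fun j => unifI.map (cellPoint m (s j)) := by
      intro s
      have : ∀ j, IsProbabilityMeasure (unifI.map (cellPoint m (s j))) := fun j =>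
        Measure.isProbabilityMeasure_map (measurable_cellPoint m (s j)).aemeasurable
      exact Measure.pi_map_pi (fun j => (measurable_cellPoint m (s j)).aemeasurable)
    simp only [Measure.smul_apply, Measure.coe_finsetSum, Finset.sum_apply, smul_eq_mul, hmap]
    have : ∀ s : Fin q → Fin m, (Measure.pi fun j => unifI.map (cellPoint m (s j))) (univ.pi B) =
        ∏ j, unifI.map (cellPoint m (s j)) (B j) := by
      intro s
      have : ∀ j, IsProbabilityMeasure (unifI.map (cellPoint m (s j))) := fun j =>
        Measure.isProbabilityMeasure_map (measurable_cellPoint m (s j)).aemeasurable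
      exact Measure.pi_pi _ _
    simp only [this]
    have h1 := (Fintype.prod_sum fun (j : Fin q) (l : Fin m) => unifI.map (cellPoint m l) (B j))
    rw [← h1]
    have h2 : ∀ j, ∑ l, unifI.map (cellPoint m l) (B j) = m * unifI (B j) := by
      intro j
      have := congrArg (fun μ : Measure ℝ => μ (B j)) (sum_map_cellPoint hm)
      simpa using this
    simp only [h2, Finset.prod_mul_distrib, Finset.prod_const, Finset.card_univ, Fintype.card_fin]
    rw [← mul_assoc, ENNReal.inv_mul_cancel (pow_ne_zero _ hm0) (ENNReal.pow_ne_top hmt), one_mul]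
  conv_rhs => rw [← key]
  rw [smul_smul, ENNReal.mul_inv_cancel (pow_ne_zero _ hm0) (ENNReal.pow_ne_top hmt), one_smul]

theorem sum_lintegral_cellPoint {m : ℕ} (hm : 1 ≤ m) {g : ℝ → ℝ≥0∞} (hg : Measurable g) :
    ∑ l : Fin m, ∫⁻ t, g (cellPoint m l t) ∂unifI = m * ∫⁻ t, g t ∂unifI := by
  have := congrArg (fun μ : Measure ℝ => ∫⁻ t, g t ∂μ) (sum_map_cellPoint hm)
  simp only [lintegral_smul_measure, lintegral_finsetSum_measure, smul_eq_mul] at this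
  rw [← this]
  exact Finset.sum_congr rfl fun l _ => (lintegral_map hg (measurable_cellPoint m l)).symm

theorem map_stratumPoint_le {q m : ℕ} (hm : 1 ≤ m) (s : Fin q → Fin m) :
    (cubeUniform q).map (stratumPoint m s) ≤ ((m : ℝ≥0∞) ^ q) • cubeUniform q := by
  rw [← sum_map_stratumPoint q hm]
  intro B
  simp only [Measure.coe_finsetSum, Finset.sum_apply]
  exact Finset.single_le_sum (f := fun s : Fin q → Fin m =>
    (cubeUniform q).map (stratumPoint m s) B) (fun _ _ => zero_le) (Finset.mem_univ s)

theorem memLp_comp_stratumPoint {q m : ℕ} (hm : 1 ≤ m) (s : Fin q → Fin m)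
    {G : (Fin q → ℝ) → ℝ} {p : ℝ≥0∞} (hG : MemLp G p (cubeUniform q)) :
    MemLp (fun v => G (stratumPoint m s v)) p (cubeUniform q) := by
  have h : MemLp G p ((cubeUniform q).map (stratumPoint m s)) :=
    hG.of_measure_le_smul (ENNReal.pow_ne_top (ENNReal.natCast_ne_top m)) (map_stratumPoint_le hm s)
  exact h.comp_of_map (measurable_stratumPoint m s).aemeasurable

theorem ae_stratumPoint {q m : ℕ} (hm : 1 ≤ m) (s : Fin q → Fin m) {p : (Fin q → ℝ) → Prop}
    (h : ∀ᵐ u ∂cubeUniform q, p u) : ∀ᵐ v ∂cubeUniform q, p (stratumPoint m s v) := by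
  have hac : (cubeUniform q).map (stratumPoint m s) ≪ cubeUniform q :=
    (Measure.absolutelyContinuous_of_le (map_stratumPoint_le hm s)).trans
      (Measure.smul_absolutelyContinuous)
  exact ae_of_ae_map (measurable_stratumPoint m s).aemeasurable (hac.ae_le h)

theorem sum_integral_stratumPoint {q m : ℕ} (hm : 1 ≤ m)
    {G : (Fin q → ℝ) → ℝ} (hG : Integrable G (cubeUniform q)) :
    ∑ s : Fin q → Fin m, ∫ v, G (stratumPoint m s v) ∂cubeUniform q =
      (m : ℝ) ^ q * ∫ u, G u ∂cubeUniform q := by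
  have := congrArg (fun μ : Measure (Fin q → ℝ) => ∫ t, G t ∂μ) (sum_map_stratumPoint q hm)
  have hi : ∀ s : Fin q → Fin m, Integrable G ((cubeUniform q).map (stratumPoint m s)) := fun s =>
    hG.of_measure_le_smul (ENNReal.pow_ne_top (ENNReal.natCast_ne_top m)) (map_stratumPoint_le hm s)
  simp only [integral_smul_measure] at this
  rw [integral_finsetSum_measure fun s _ => hi s] at this
  simp only [ENNReal.toReal_pow, ENNReal.toReal_natCast, smul_eq_mul] at this
  rw [← this]
  exact Finset.sum_congr rfl fun s _ =>
    (integral_map (measurable_stratumPoint m s).aemeasurable (hi s).aestronglyMeasurable).symm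

theorem ae_mem_Ioo_unifI : ∀ᵐ t ∂unifI, t ∈ Ioo (0 : ℝ) 1 := by
  unfold unifI
  rw [← Measure.restrict_congr_set Ioo_ae_eq_Ioc]
  exact ae_restrict_mem measurableSet_Ioo

theorem ae_eval_cubeUniform {q : ℕ} (j : Fin q) {p : ℝ → Prop} (h : ∀ᵐ t ∂unifI, p t) :
    ∀ᵐ u ∂cubeUniform q, p (u j) := by
  rw [cubeUniform_eq_pi]
  exact (measurePreserving_eval (fun _ : Fin q => unifI) j).quasiMeasurePreserving.ae h

theorem ae_mem_openCube (q : ℕ) :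
    ∀ᵐ u ∂cubeUniform q, u ∈ (univ.pi fun _ : Fin q => Ioo (0 : ℝ) 1) := by
  have : ∀ᵐ u ∂cubeUniform q, ∀ j, u j ∈ Ioo (0 : ℝ) 1 :=
    ae_all_iff.2 fun j => ae_eval_cubeUniform j ae_mem_Ioo_unifI
  filter_upwards [this] with u hu j _ using hu j

/-! ### The variance within the strata -/

/-- The average over the `m ^ q` strata of the variance of `G` within a stratum. -/
def stratVar {q : ℕ} (G : (Fin q → ℝ) → ℝ) (m : ℕ) : ℝ :=
  (1 / (m : ℝ) ^ q) *
    ∑ s : Fin q → Fin m, variance (fun v => G (stratumPoint m s v)) (cubeUniform q)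

namespace Problem

variable {d q : ℕ}

/-- The oracle as a function of the uniform draw. -/
def oracle (P : Problem d q) (θ : Dec d) (u : Fin q → ℝ) : ℝ := P.F θ (P.muInv θ u)

/-- The average variance within the strata is `O(m ^ (-p))`, uniformly over `Θ`. -/
def VarianceDecay (P : Problem d q) (p : ℝ) : Prop :=
  ∃ C : ℝ, ∀ θ ∈ P.Θ, ∀ m : ℕ, 1 ≤ m → stratVar (P.oracle θ) m ≤ C * (m : ℝ) ^ (-p)

variable {P : Problem d q}

theorem VarianceDecay.mono {p p' : ℝ} (h : P.VarianceDecay p') (hp : p ≤ p') :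
    P.VarianceDecay p := by
  obtain ⟨C, hC⟩ := h
  refine ⟨max C 0, fun θ hθ m hm => (hC θ hθ m hm).trans ?_⟩
  gcongr
  · exact le_max_left _ _
  · exact_mod_cast hm

theorem Standing.measurable_oracle (hP : P.Standing) :
    Measurable (Function.uncurry P.oracle) :=
  hP.measurable_F.comp (measurable_fst.prodMk hP.measurable_muInv)

theorem Standing.measurable_oracle_right (hP : P.Standing) (θ : Dec d) :
    Measurable (P.oracle θ) :=
  hP.measurable_oracle.comp (measurable_const.prodMk measurable_id)

theorem Standing.measurable_muInv_right (hP : P.Standing) (θ : Dec d) :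
    Measurable (P.muInv θ) :=
  hP.measurable_muInv.comp (measurable_const.prodMk measurable_id)

theorem Standing.isProbabilityMeasure_law (hP : P.Standing) {θ : Dec d} (hθ : θ ∈ P.Θ) :
    IsProbabilityMeasure (P.law θ) := by
  have h := (hP.uniformizing θ hθ).map_eq
  constructor
  have h1 : (P.law θ).map (P.mu θ) univ = 1 := by rw [h]; exact measure_univ
  rwa [Measure.map_apply (hP.uniformizing θ hθ).measurable_mu MeasurableSet.univ,
    preimage_univ] at h1

theorem Standing.map_muInv (hP : P.Standing) {θ : Dec d} (hθ : θ ∈ P.Θ) :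
    (cubeUniform q).map (P.muInv θ) = P.law θ := by
  have hu := hP.uniformizing θ hθ
  rw [← hu.map_eq, Measure.map_map (hP.measurable_muInv_right θ) hu.measurable_mu]
  conv_rhs => rw [← Measure.map_id (μ := P.law θ)]
  refine Measure.map_congr ?_
  filter_upwards [hu.mem_supp] with x hx
  exact hu.invOn.1 hx

theorem Standing.memLp_oracle (hP : P.Standing) {θ : Dec d} (hθ : θ ∈ P.Θ) :
    MemLp (P.oracle θ) 2 (cubeUniform q) := by
  obtain ⟨C, hC⟩ := hP.F_variance
  have h := (hC θ hθ).1
  rw [← hP.map_muInv hθ] at h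
  exact h.comp_of_map (hP.measurable_muInv_right θ).aemeasurable

theorem Standing.integral_oracle (hP : P.Standing) {θ : Dec d} (hθ : θ ∈ P.Θ) :
    ∫ u, P.oracle θ u ∂cubeUniform q = P.f θ := by
  obtain ⟨C, hC⟩ := hP.F_variance
  have h := (hC θ hθ).1.aestronglyMeasurable
  unfold Problem.f
  rw [← hP.map_muInv hθ] at h ⊢
  exact (integral_map (hP.measurable_muInv_right θ).aemeasurable h).symm

end Problem

/-- The variance is at most the mean squared distance of two independent copies. -/
theorem ofReal_variance_le_lintegral {α : Type*} [MeasurableSpace α] {μ : Measure α}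
    [IsProbabilityMeasure μ] {Y : α → ℝ} (hY : MemLp Y 2 μ) :
    ENNReal.ofReal (variance Y μ) ≤ ∫⁻ v', ∫⁻ v, ENNReal.ofReal ((Y v - Y v') ^ 2) ∂μ ∂μ := by
  have h : ∀ c : ℝ, ENNReal.ofReal (variance Y μ) ≤ ∫⁻ v, ENNReal.ofReal ((Y v - c) ^ 2) ∂μ := by
    intro c
    have hYc : MemLp (fun v => Y v - c) 2 μ := hY.sub (memLp_const c)
    have h1 : variance Y μ ≤ ∫ v, (Y v - c) ^ 2 ∂μ := by
      rw [← variance_sub_const hY.aestronglyMeasurable c]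
      exact variance_le_expectation_sq hYc.aestronglyMeasurable
    rw [← ofReal_integral_eq_lintegral_ofReal hYc.integrable_sq
      (Filter.Eventually.of_forall fun v => sq_nonneg _)]
    exact ENNReal.ofReal_le_ofReal h1
  calc ENNReal.ofReal (variance Y μ) = ∫⁻ _, ENNReal.ofReal (variance Y μ) ∂μ := by simp
    _ ≤ _ := lintegral_mono fun v' => h (Y v')

theorem stratVar_le_of_ae {q : ℕ} {G : (Fin q → ℝ) → ℝ} (hG : MemLp G 2 (cubeUniform q)) {m : ℕ}
    (hm : 1 ≤ m) {B : ℝ}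
    (h : ∀ s : Fin q → Fin m, ∀ᵐ v' ∂cubeUniform q, ∀ᵐ v ∂cubeUniform q,
      (G (stratumPoint m s v) - G (stratumPoint m s v')) ^ 2 ≤ B) :
    stratVar G m ≤ B := by
  have hm0 : (0 : ℝ) < m := by exact_mod_cast hm
  have hs : ∀ s : Fin q → Fin m,
      variance (fun v => G (stratumPoint m s v)) (cubeUniform q) ≤ B := by
    intro s
    have hB : 0 ≤ B := by
      obtain ⟨v', hv'⟩ := (h s).exists
      obtain ⟨v, hv⟩ := hv'.exists
      exact (sq_nonneg _).trans hv
    rw [← ENNReal.ofReal_le_ofReal_iff hB]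
    refine (ofReal_variance_le_lintegral (memLp_comp_stratumPoint hm s hG)).trans ?_
    calc _ ≤ ∫⁻ _ : Fin q → ℝ, ∫⁻ _ : Fin q → ℝ, ENNReal.ofReal B
          ∂cubeUniform q ∂cubeUniform q := by
          refine lintegral_mono_ae ?_
          filter_upwards [h s] with v' hv'
          refine lintegral_mono_ae ?_
          filter_upwards [hv'] with v hv
          exact ENNReal.ofReal_le_ofReal hv
      _ = _ := by simp
  unfold stratVar
  calc _ ≤ (1 / (m : ℝ) ^ q) * ∑ s : Fin q → Fin m, B := by
        gcongr with s; exact hs s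
    _ = B := by
        simp only [Finset.sum_const, Finset.card_univ, Fintype.card_fun, Fintype.card_fin,
          nsmul_eq_mul, Nat.cast_pow]
        field_simp

namespace Problem

variable {d q : ℕ} {P : Problem d q}

/-- With bounded gradients the oracle is Lipschitz in the uniform draw, and so oscillates by
`O(1 / m)` in each stratum. -/
theorem BoundedGradient.varianceDecay (h : P.BoundedGradient) (hP : P.Standing) :
    P.VarianceDecay 2 := by
  obtain ⟨⟨C₁, hC₁⟩, ⟨C₂, hC₂⟩⟩ := h
  refine ⟨(C₂ * C₁) ^ 2, fun θ hθ m hm => ?_⟩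
  have hm0 : (0 : ℝ) < m := by exact_mod_cast hm
  have hu := hP.uniformizing θ hθ
  have hderiv : ∀ u ∈ (univ.pi fun _ : Fin q => Ioo (0 : ℝ) 1),
      DifferentiableAt ℝ (P.oracle θ) u ∧ ‖fderiv ℝ (P.oracle θ) u‖ ≤ C₂ * C₁ := by
    intro u hu'
    obtain ⟨hd, hb⟩ := hC₁ θ hθ u hu'
    have hx : P.muInv θ u ∈ P.supp θ := by
      obtain ⟨x, hx, hxu⟩ := hu.bijOn.surjOn (hu.open_cube_subset hu')
      rw [← hxu, hu.invOn.1 hx]; exact hx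
    have hF : DifferentiableAt ℝ (P.F θ) (P.muInv θ u) :=
      (hP.F_contDiff θ hθ _ (subset_convexHull ℝ _ hx)).differentiableAt one_ne_zero
    refine ⟨hF.comp u hd, ?_⟩
    have : fderiv ℝ (P.oracle θ) u =
        (fderiv ℝ (P.F θ) (P.muInv θ u)).comp (fderiv ℝ (P.muInv θ) u) := fderiv_comp u hF hd
    rw [this]
    refine (ContinuousLinearMap.opNorm_comp_le _ _).trans ?_
    have h2 := hC₂ θ hθ _ hx
    gcongr
    exact (norm_nonneg _).trans h2
  have hconv : Convex ℝ (univ.pi fun _ : Fin q => Ioo (0 : ℝ) 1) :=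
    convex_pi fun _ _ => convex_Ioo 0 1
  have hmem : ∀ (s : Fin q → Fin m) (v : Fin q → ℝ), v ∈ (univ.pi fun _ : Fin q => Ioo (0 : ℝ) 1) →
      stratumPoint m s v ∈ (univ.pi fun _ : Fin q => Ioo (0 : ℝ) 1) :=
    fun s v hv j hj => cellPoint_mem_Ioo _ (hv j hj)
  refine (stratVar_le_of_ae (hP.memLp_oracle hθ) hm (B := (C₂ * C₁ * (1 / m)) ^ 2)
    fun s => ?_).trans_eq ?_
  · filter_upwards [ae_mem_openCube q] with v' hv'
    filter_upwards [ae_mem_openCube q] with v hv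
    have hlip := hconv.norm_image_sub_le_of_norm_fderiv_le (𝕜 := ℝ)
      (fun u hu => (hderiv u hu).1) (fun u hu => (hderiv u hu).2) (hmem s v' hv') (hmem s v hv)
    have hnorm : ‖stratumPoint m s v - stratumPoint m s v'‖ ≤ 1 / m := by
      rw [pi_norm_le_iff_of_nonneg (by positivity)]
      intro j
      have h1 := hv j trivial
      have h2 := hv' j trivial
      simp only [Pi.sub_apply, stratumPoint, cellPoint, Real.norm_eq_abs]
      rw [add_sub_add_left_eq_sub, ← sub_div, abs_div, abs_of_pos hm0]
      gcongr
      rw [abs_le]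
      constructor <;> linarith [h1.1, h1.2, h2.1, h2.2]
    have hC0 : 0 ≤ C₂ * C₁ := (norm_nonneg _).trans (hderiv _ (hmem s v hv)).2
    rw [← sq_abs]
    have := hlip.trans (mul_le_mul_of_nonneg_left hnorm hC0)
    rw [Real.norm_eq_abs] at this
    gcongr
  · rw [mul_pow, Real.rpow_neg hm0.le, div_pow, one_pow]
    norm_cast
    rw [one_div]

end Problem

/-! ### Oscillation of a monotone function with exponential tails -/

/-- `H`, under the uniform distribution on `(0,1]`, has tails `C * exp (-κ y)`. -/
def ExpTail (H : ℝ → ℝ) (C κ : ℝ) : Prop :=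
  ∀ y : ℝ, 0 ≤ y → unifI {t | y ≤ |H t|} ≤ ENNReal.ofReal (C * Real.exp (-(κ * y)))

theorem exists_lintegral_exp_le {C κ κ' : ℝ} (hκ' : 0 ≤ κ') (hκ : κ' < κ) :
    ∃ E : ℝ, 0 ≤ E ∧ ∀ H : ℝ → ℝ, Measurable H → ExpTail H C κ →
      ∫⁻ t, ENNReal.ofReal (Real.exp (κ' * |H t|)) ∂unifI ≤ ENNReal.ofReal E := by
  set a : ℕ → ℝ := fun n => |C| * Real.exp κ' * Real.exp (κ' - κ) ^ n with ha
  have ha0 : ∀ n, 0 ≤ a n := fun n => by positivity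
  have hsum : Summable a :=
    (summable_geometric_of_lt_one (Real.exp_pos _).le
      (Real.exp_lt_one_iff.2 (by linarith))).mul_left _
  refine ⟨∑' n, a n, tsum_nonneg ha0, fun H hH hT => ?_⟩
  have hmeas : ∀ n : ℕ, MeasurableSet {t | (n : ℝ) ≤ |H t|} := fun n =>
    measurableSet_le measurable_const (continuous_abs.measurable.comp hH)
  calc ∫⁻ t, ENNReal.ofReal (Real.exp (κ' * |H t|)) ∂unifI
      ≤ ∫⁻ t, ∑' n : ℕ, {t | (n : ℝ) ≤ |H t|}.indicator
          (fun _ => ENNReal.ofReal (Real.exp (κ' * (n + 1)))) t ∂unifI := by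
        refine lintegral_mono fun t => ?_
        refine le_trans ?_ (ENNReal.le_tsum ⌊|H t|⌋₊)
        have hmem : t ∈ {t' | ((⌊|H t|⌋₊ : ℕ) : ℝ) ≤ |H t'|} :=
          Nat.floor_le (abs_nonneg (H t))
        rw [indicator_of_mem hmem]
        gcongr
        exact (Nat.lt_floor_add_one _).le
    _ = ∑' n : ℕ, ENNReal.ofReal (Real.exp (κ' * (n + 1))) * unifI {t | (n : ℝ) ≤ |H t|} := by
        rw [lintegral_tsum fun n => (measurable_const.indicator (hmeas n)).aemeasurable]
        simp_rw [lintegral_indicator_const (hmeas _)]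
    _ ≤ ∑' n : ℕ, ENNReal.ofReal (a n) := by
        refine ENNReal.tsum_le_tsum fun n => ?_
        refine (mul_le_mul_right (hT n (Nat.cast_nonneg n)) _).trans ?_
        rw [← ENNReal.ofReal_mul (Real.exp_pos _).le]
        refine ENNReal.ofReal_le_ofReal ?_
        have h1 : a n = |C| * (Real.exp (κ' * (n + 1)) * Real.exp (-(κ * n))) := by
          simp only [ha]
          rw [← Real.exp_nat_mul, mul_assoc, ← Real.exp_add, ← Real.exp_add]
          congr 2; ring
        rw [h1, mul_left_comm]
        gcongr
        exact le_abs_self C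
    _ = ENNReal.ofReal (∑' n, a n) := (ENNReal.ofReal_tsum_of_nonneg ha0 hsum).symm

/-- Truncation of a number to `[-R, R]`. -/
def clamp (R x : ℝ) : ℝ := max (-R) (min x R)

theorem clamp_mono (R : ℝ) : Monotone (clamp R) := fun _ _ h => by
  unfold clamp; gcongr

theorem clamp_le {R : ℝ} (hR : 0 ≤ R) (x : ℝ) : clamp R x ≤ R := by
  unfold clamp; exact max_le (by linarith) (min_le_right _ _)

theorem neg_le_clamp (R x : ℝ) : -R ≤ clamp R x := le_max_left _ _

theorem clamp_eq {R x : ℝ} (h : |x| ≤ R) : clamp R x = x := by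
  unfold clamp; rw [min_eq_left (abs_le.1 h).2, max_eq_right (abs_le.1 h).1]

/-- Up to the level `R` the weighted squared distance is controlled by the distance of the
truncations; beyond that level it is dominated by an exponential moment. -/
theorem sq_mul_exp_le {b b' κ' R x y : ℝ} (hb : 0 ≤ b) (hb' : b < b') (hκ' : 2 * b' ≤ κ')
    (hR : 0 ≤ R) :
    (x - y) ^ 2 * Real.exp (2 * b * max |x| |y|) ≤
      2 * R * Real.exp (2 * b * R) * |clamp R x - clamp R y| +
        8 / (2 * (b' - b)) ^ 2 * Real.exp (-((κ' - 2 * b') * R)) *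
          (Real.exp (κ' * |x|) + Real.exp (κ' * |y|)) := by
  set M := max |x| |y| with hM
  have hM0 : 0 ≤ M := (abs_nonneg x).trans (le_max_left _ _)
  have hxy : |x - y| ≤ 2 * M := by
    have := abs_sub x y
    linarith [le_max_left |x| |y|, le_max_right |x| |y|]
  by_cases hMR : M ≤ R
  · rw [clamp_eq ((le_max_left _ _).trans hMR), clamp_eq ((le_max_right _ _).trans hMR)]
    have h1 : (x - y) ^ 2 ≤ 2 * R * |x - y| := by
      rw [← sq_abs, sq]
      gcongr
      linarith
    have h2 : Real.exp (2 * b * M) ≤ Real.exp (2 * b * R) := by gcongr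
    have h3 : (x - y) ^ 2 * Real.exp (2 * b * M) ≤ 2 * R * |x - y| * Real.exp (2 * b * R) :=
      mul_le_mul h1 h2 (Real.exp_pos _).le (by positivity)
    have h4 : 0 ≤ 8 / (2 * (b' - b)) ^ 2 * Real.exp (-((κ' - 2 * b') * R)) *
          (Real.exp (κ' * |x|) + Real.exp (κ' * |y|)) := by positivity
    nlinarith
  · push Not at hMR
    set η := 2 * (b' - b) with hη
    have hη0 : 0 < η := by rw [hη]; linarith
    have h1 : (x - y) ^ 2 ≤ 8 / η ^ 2 * Real.exp (η * M) := by
      have h := Real.quadratic_le_exp_of_nonneg (x := η * M) (by positivity)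
      have h' : (η * M) ^ 2 / 2 ≤ Real.exp (η * M) := by nlinarith [mul_nonneg hη0.le hM0]
      have : (x - y) ^ 2 ≤ (2 * M) ^ 2 := by rw [← sq_abs]; gcongr
      refine this.trans ?_
      have h5 : (2 * M) ^ 2 = 8 / η ^ 2 * ((η * M) ^ 2 / 2) := by field_simp; ring
      rw [h5]
      gcongr
    have h2 : Real.exp (η * M) * Real.exp (2 * b * M) ≤
        Real.exp (-((κ' - 2 * b') * R)) * Real.exp (κ' * M) := by
      rw [← Real.exp_add, ← Real.exp_add]
      refine Real.exp_le_exp.2 ?_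
      rw [hη]
      nlinarith [mul_le_mul_of_nonneg_left hMR.le (by linarith : 0 ≤ κ' - 2 * b')]
    have h3 : Real.exp (κ' * M) ≤ Real.exp (κ' * |x|) + Real.exp (κ' * |y|) := by
      rcases max_choice |x| |y| with h | h
      · rw [hM, h]; linarith [Real.exp_pos (κ' * |y|)]
      · rw [hM, h]; linarith [Real.exp_pos (κ' * |x|)]
    have h0 : 0 ≤ 2 * R * Real.exp (2 * b * R) * |clamp R x - clamp R y| := by positivity
    calc (x - y) ^ 2 * Real.exp (2 * b * M)
        ≤ 8 / η ^ 2 * Real.exp (η * M) * Real.exp (2 * b * M) := by gcongr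
      _ = 8 / η ^ 2 * (Real.exp (η * M) * Real.exp (2 * b * M)) := by ring
      _ ≤ 8 / η ^ 2 * (Real.exp (-((κ' - 2 * b') * R)) *
          (Real.exp (κ' * |x|) + Real.exp (κ' * |y|))) := by
          have : 0 < 8 / η ^ 2 := by positivity
          refine mul_le_mul_of_nonneg_left (h2.trans ?_) this.le
          gcongr
      _ ≤ _ := by linarith

/-- The oscillations of a bounded monotone function over the cells add up to at most its range. -/
theorem sum_lintegral_clamp_le {H : ℝ → ℝ} (hmono : MonotoneOn H (Ioo 0 1)) {R : ℝ}
    (hR : 0 ≤ R) {m : ℕ} (hm : 1 ≤ m) :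
    ∑ l : Fin m, ∫⁻ t', ∫⁻ t, ENNReal.ofReal
      |clamp R (H (cellPoint m l t)) - clamp R (H (cellPoint m l t'))| ∂unifI ∂unifI ≤
      ENNReal.ofReal (2 * R) := by
  have hm0 : (0 : ℝ) < m := by exact_mod_cast hm
  -- The point `-R` keeps the suprema over empty sets from taking a junk value.
  set S : ℕ → Set ℝ := fun l =>
    insert (-R) ((fun u => clamp R (H u)) '' {u | u ∈ Ioo (0 : ℝ) 1 ∧ u < (l : ℝ) / m}) with hS
  have hSle : ∀ l, ∀ x ∈ S l, x ≤ R := by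
    rintro l x (rfl | ⟨u, -, rfl⟩)
    · linarith
    · exact clamp_le hR _
  have hSbdd : ∀ l, BddAbove (S l) := fun l => ⟨R, hSle l⟩
  set a : ℕ → ℝ := fun l => sSup (S l) with ha
  have ha1 : ∀ l, a l ≤ R := fun l => csSup_le (insert_nonempty _ _) (hSle l)
  have ha0 : ∀ l, -R ≤ a l := fun l => le_csSup (hSbdd l) (mem_insert _ _)
  have hamono : Monotone a := by
    refine monotone_nat_of_le_succ fun l => csSup_le_csSup (hSbdd _) (insert_nonempty _ _) ?_
    refine insert_subset_insert (image_mono ?_)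
    rintro u ⟨hu, hu'⟩
    refine ⟨hu, hu'.trans_le ?_⟩
    gcongr
    exact_mod_cast Nat.le_succ l
  have hup : ∀ (l : Fin m) t, t ∈ Ioo (0 : ℝ) 1 → clamp R (H (cellPoint m l t)) ≤ a (l + 1) := by
    intro l t ht
    refine le_csSup (hSbdd _) (mem_insert_of_mem _ ⟨_, ⟨cellPoint_mem_Ioo l ht, ?_⟩, rfl⟩)
    unfold cellPoint
    rw [← add_div]
    push_cast
    gcongr
    exact ht.2
  have hlo : ∀ (l : Fin m) t, t ∈ Ioo (0 : ℝ) 1 → a l ≤ clamp R (H (cellPoint m l t)) := by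
    intro l t ht
    refine csSup_le (insert_nonempty _ _) ?_
    rintro x (rfl | ⟨u, ⟨hu, hu'⟩, rfl⟩)
    · exact neg_le_clamp _ _
    · refine clamp_mono R (hmono hu (cellPoint_mem_Ioo l ht) (hu'.le.trans ?_))
      unfold cellPoint
      have : 0 < t / m := div_pos ht.1 hm0
      linarith
  calc _ ≤ ∑ l : Fin m, ENNReal.ofReal (a (l + 1) - a l) := by
        refine Finset.sum_le_sum fun l _ => ?_
        calc _ ≤ ∫⁻ _, ∫⁻ _, ENNReal.ofReal (a (l + 1) - a l) ∂unifI ∂unifI := by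
              refine lintegral_mono_ae ?_
              filter_upwards [ae_mem_Ioo_unifI] with t' ht'
              refine lintegral_mono_ae ?_
              filter_upwards [ae_mem_Ioo_unifI] with t ht
              refine ENNReal.ofReal_le_ofReal (abs_sub_le_iff.2 ⟨?_, ?_⟩)
              · linarith [hup l t ht, hlo l t' ht']
              · linarith [hup l t' ht', hlo l t ht]
          _ = _ := by simp
    _ = ENNReal.ofReal (∑ l ∈ Finset.range m, (a (l + 1) - a l)) := by
        rw [ENNReal.ofReal_sum_of_nonneg fun l _ => sub_nonneg.2 (hamono (Nat.le_succ l)),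
          Finset.sum_range fun l => ENNReal.ofReal (a (l + 1) - a l)]
    _ ≤ ENNReal.ofReal (2 * R) := by
        rw [Finset.sum_range_sub]
        exact ENNReal.ofReal_le_ofReal (by linarith [ha1 m, ha0 0])

/-- The mean over the cells of the weighted squared oscillation of a monotone function with
exponential tails of rate `κ` is `O(m ^ (-p))` for every `p < 1 - 2 b / κ`. -/
theorem exists_sum_lintegral_cell_le {b κ C p : ℝ} (hb : 0 ≤ b) (hκ : 0 < κ) (hp0 : 0 < p)
    (hp : p < 1 - 2 * b / κ) :
    ∃ K : ℝ, 0 ≤ K ∧ ∀ H : ℝ → ℝ, Measurable H → MonotoneOn H (Ioo 0 1) → ExpTail H C κ →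
      ∀ m : ℕ, 1 ≤ m →
        ∑ l : Fin m, ∫⁻ t', ∫⁻ t, ENNReal.ofReal
          ((H (cellPoint m l t) - H (cellPoint m l t')) ^ 2 *
            Real.exp (2 * b * max |H (cellPoint m l t)| |H (cellPoint m l t')|)) ∂unifI ∂unifI ≤
          m * ENNReal.ofReal (K * (m : ℝ) ^ (-p)) := by
  have hp1 : p < 1 := by
    have : 0 ≤ 2 * b / κ := by positivity
    linarith
  have hbκ : 2 * b / (1 - p) < κ := by
    rw [div_lt_iff₀ (by linarith)]
    have : 2 * b / κ < 1 - p := by linarith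
    rw [div_lt_iff₀ hκ] at this
    linarith
  obtain ⟨κ', hκ'1, hκ'2⟩ := exists_between hbκ
  have hκ'0 : 0 < κ' := lt_of_le_of_lt (div_nonneg (by linarith) (by linarith)) hκ'1
  set b' := (1 - p) * κ' / 2 with hb'
  have hbb' : b < b' := by
    rw [div_lt_iff₀ (by linarith)] at hκ'1
    rw [hb']; linarith
  have hbκ' : 2 * b' ≤ κ' := by rw [hb']; nlinarith
  obtain ⟨E, hE0, hE⟩ := exists_lintegral_exp_le (C := C) hκ'0.le hκ'2
  set K₁ := 8 / (2 * (b' - b)) ^ 2 with hK₁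
  have hη : 0 < 2 * (b' - b) := by linarith
  have hK₁0 : 0 < K₁ := by rw [hK₁]; positivity
  refine ⟨K₁ + 2 * K₁ * E, by positivity, fun H hH hmono hT m hm => ?_⟩
  have hm0 : (0 : ℝ) < m := by exact_mod_cast hm
  have hm1 : (1 : ℝ) ≤ m := by exact_mod_cast hm
  -- The truncation level at which the two error terms balance.
  set R := Real.log m / κ' with hRdef
  have hR : 0 ≤ R := div_nonneg (Real.log_nonneg hm1) hκ'0.le
  have hexp : ∀ x : ℝ, Real.exp (x * R) = (m : ℝ) ^ (x / κ') := by
    intro x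
    rw [Real.rpow_def_of_pos hm0, hRdef]
    congr 1; ring
  set c₁ := 2 * R * Real.exp (2 * b * R) with hc₁
  set c₂ := K₁ * Real.exp (-((κ' - 2 * b') * R)) with hc₂
  have hc₁0 : 0 ≤ c₁ := by positivity
  have hc₂0 : 0 ≤ c₂ := by positivity
  have hcl : Measurable (clamp R) := by unfold clamp; fun_prop
  have hcell : ∀ l : Fin m, Measurable fun t => H (cellPoint m l t) := fun l =>
    hH.comp (measurable_cellPoint m l)
  set e : ℝ → ℝ≥0∞ := fun t => ENNReal.ofReal (Real.exp (κ' * |H t|)) with he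
  have hem : Measurable e := by
    refine ENNReal.measurable_ofReal.comp (Real.measurable_exp.comp ?_)
    exact (continuous_abs.measurable.comp hH).const_mul _
  have hec : ∀ l : Fin m, Measurable fun t => e (cellPoint m l t) := fun l =>
    hem.comp (measurable_cellPoint m l)
  have hbound : ∀ l : Fin m, ∫⁻ t', ∫⁻ t, ENNReal.ofReal
      ((H (cellPoint m l t) - H (cellPoint m l t')) ^ 2 *
        Real.exp (2 * b * max |H (cellPoint m l t)| |H (cellPoint m l t')|)) ∂unifI ∂unifI ≤
      ENNReal.ofReal c₁ * (∫⁻ t', ∫⁻ t, ENNReal.ofReal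
        |clamp R (H (cellPoint m l t)) - clamp R (H (cellPoint m l t'))| ∂unifI ∂unifI) +
      ENNReal.ofReal c₂ * (2 * ∫⁻ t, e (cellPoint m l t) ∂unifI) := by
    intro l
    have hm1 : ∀ t', Measurable fun t => ENNReal.ofReal
        |clamp R (H (cellPoint m l t)) - clamp R (H (cellPoint m l t'))| := fun t' =>
      ENNReal.measurable_ofReal.comp (continuous_abs.measurable.comp
        ((hcl.comp (hcell l)).sub measurable_const))
    have hm2 : Measurable fun t' => ∫⁻ t, ENNReal.ofReal
        |clamp R (H (cellPoint m l t)) - clamp R (H (cellPoint m l t'))| ∂unifI := by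
      refine Measurable.lintegral_prod_right' (f := fun z : ℝ × ℝ => ENNReal.ofReal
        |clamp R (H (cellPoint m l z.2)) - clamp R (H (cellPoint m l z.1))|) ?_
      exact ENNReal.measurable_ofReal.comp (continuous_abs.measurable.comp
        (((hcl.comp (hcell l)).comp measurable_snd).sub
          ((hcl.comp (hcell l)).comp measurable_fst)))
    calc _ ≤ ∫⁻ t', ∫⁻ t, (ENNReal.ofReal c₁ * ENNReal.ofReal
          |clamp R (H (cellPoint m l t)) - clamp R (H (cellPoint m l t'))| +
          ENNReal.ofReal c₂ * (e (cellPoint m l t) + e (cellPoint m l t'))) ∂unifI ∂unifI := by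
          refine lintegral_mono fun t' => lintegral_mono fun t => ?_
          simp only [he]
          rw [← ENNReal.ofReal_add (Real.exp_pos _).le (Real.exp_pos _).le,
            ← ENNReal.ofReal_mul hc₁0, ← ENNReal.ofReal_mul hc₂0,
            ← ENNReal.ofReal_add (by positivity) (by positivity)]
          exact ENNReal.ofReal_le_ofReal (sq_mul_exp_le hb hbb' hbκ' hR)
      _ = ∫⁻ t', (ENNReal.ofReal c₁ * (∫⁻ t, ENNReal.ofReal
          |clamp R (H (cellPoint m l t)) - clamp R (H (cellPoint m l t'))| ∂unifI) +
          ENNReal.ofReal c₂ * ((∫⁻ t, e (cellPoint m l t) ∂unifI) + e (cellPoint m l t')))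
            ∂unifI := by
          refine lintegral_congr fun t' => ?_
          rw [lintegral_add_left ((hm1 t').const_mul _), lintegral_const_mul _ (hm1 t'),
            lintegral_const_mul _ (show Measurable fun t => e (cellPoint m l t) +
              e (cellPoint m l t') from (hec l).add measurable_const),
            lintegral_add_left (hec l)]
          simp
      _ = _ := by
          rw [lintegral_add_left (hm2.const_mul _), lintegral_const_mul _ hm2,
            lintegral_const_mul _ (show Measurable fun t' => (∫⁻ t, e (cellPoint m l t) ∂unifI) +
              e (cellPoint m l t') from measurable_const.add (hec l)),
            lintegral_add_left measurable_const]
          simp [two_mul]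
  refine (Finset.sum_le_sum fun l _ => hbound l).trans ?_
  rw [Finset.sum_add_distrib, ← Finset.mul_sum, ← Finset.mul_sum, ← Finset.mul_sum,
    sum_lintegral_cellPoint hm hem]
  have h1 : ENNReal.ofReal c₁ * ENNReal.ofReal (2 * R) ≤
      ENNReal.ofReal (m * (K₁ * (m : ℝ) ^ (-p))) := by
    rw [← ENNReal.ofReal_mul hc₁0]
    refine ENNReal.ofReal_le_ofReal ?_
    have h2 : c₁ * (2 * R) = 4 * R ^ 2 * Real.exp (2 * b * R) := by rw [hc₁]; ring
    have h3 : 4 * R ^ 2 ≤ K₁ * Real.exp (2 * (b' - b) * R) := by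
      have h := Real.quadratic_le_exp_of_nonneg (x := 2 * (b' - b) * R) (by positivity)
      have h' : (2 * (b' - b) * R) ^ 2 / 2 ≤ Real.exp (2 * (b' - b) * R) := by
        nlinarith [mul_nonneg hη.le hR]
      have h5 : 4 * R ^ 2 = K₁ * ((2 * (b' - b) * R) ^ 2 / 2) := by
        have hne : b' - b ≠ 0 := by linarith
        rw [hK₁]; field_simp; ring
      rw [h5]; gcongr
    have h4 : Real.exp (2 * (b' - b) * R) * Real.exp (2 * b * R) = m * (m : ℝ) ^ (-p) := by
      rw [← Real.exp_add, ← add_mul, hexp]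
      conv_rhs => rw [← Real.rpow_one (m : ℝ), ← Real.rpow_mul hm0.le, ← Real.rpow_add hm0]
      congr 1
      rw [hb']; field_simp; ring
    rw [h2]
    calc 4 * R ^ 2 * Real.exp (2 * b * R)
        ≤ K₁ * Real.exp (2 * (b' - b) * R) * Real.exp (2 * b * R) := by gcongr
      _ = m * (K₁ * (m : ℝ) ^ (-p)) := by rw [mul_assoc, h4]; ring
  have h2 : ENNReal.ofReal c₂ * (2 * (m * ∫⁻ t, e t ∂unifI)) ≤
      ENNReal.ofReal (m * (2 * K₁ * E * (m : ℝ) ^ (-p))) := by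
    have h3 : c₂ = K₁ * (m : ℝ) ^ (-p) := by
      rw [hc₂, ← neg_mul, hexp]
      congr 2
      rw [hb']; field_simp; ring
    calc _ ≤ ENNReal.ofReal c₂ * (ENNReal.ofReal 2 * (ENNReal.ofReal m * ENNReal.ofReal E)) := by
          rw [ENNReal.ofReal_natCast, ENNReal.ofReal_ofNat]
          gcongr
          exact hE H hH hT
      _ = _ := by
          rw [← ENNReal.ofReal_mul hm0.le, ← ENNReal.ofReal_mul (by norm_num),
            ← ENNReal.ofReal_mul hc₂0, h3]
          congr 1; ring
  calc _ ≤ ENNReal.ofReal (m * (K₁ * (m : ℝ) ^ (-p))) +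
        ENNReal.ofReal (m * (2 * K₁ * E * (m : ℝ) ^ (-p))) := by
        refine add_le_add (le_trans ?_ h1) h2
        gcongr
        exact sum_lintegral_clamp_le hmono hR hm
    _ = _ := by
        rw [← ENNReal.ofReal_add (by positivity) (by positivity), ← ENNReal.ofReal_natCast m,
          ← ENNReal.ofReal_mul hm0.le]
        congr 1; ring

/-! ### Variance decay for independent margins -/

theorem lintegral_cubeUniform_prod {q : ℕ} {f : Fin q → ℝ → ℝ≥0∞} (hf : ∀ j, Measurable (f j)) :
    ∫⁻ v, ∏ j, f j (v j) ∂cubeUniform q = ∏ j, ∫⁻ t, f j t ∂unifI := by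
  rw [cubeUniform_eq_pi]
  have h := lintegral_prod_eq_prod_lintegral_of_indepFun (μ := Measure.pi fun _ : Fin q => unifI)
    Finset.univ (fun j v => f j (v j)) (iIndepFun_pi fun j => (hf j).aemeasurable)
    (fun j => (hf j).comp (measurable_pi_apply j))
  rw [h]
  refine Finset.prod_congr rfl fun j _ => ?_
  exact (measurePreserving_eval (fun _ : Fin q => unifI) j).lintegral_comp (hf j)

theorem lintegral_lintegral_cubeUniform_prod {q : ℕ} {g : Fin q → ℝ × ℝ → ℝ≥0∞}
    (hg : ∀ j, Measurable (g j)) :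
    ∫⁻ v', ∫⁻ v, ∏ j, g j (v j, v' j) ∂cubeUniform q ∂cubeUniform q =
      ∏ j, ∫⁻ t', ∫⁻ t, g j (t, t') ∂unifI ∂unifI := by
  have h : ∀ v' : Fin q → ℝ, ∫⁻ v, ∏ j, g j (v j, v' j) ∂cubeUniform q =
      ∏ j, ∫⁻ t, g j (t, v' j) ∂unifI := fun v' =>
    lintegral_cubeUniform_prod (f := fun j t => g j (t, v' j)) fun j =>
      (hg j).comp (measurable_id.prodMk measurable_const)
  simp only [h]
  exact lintegral_cubeUniform_prod (f := fun j t' => ∫⁻ t, g j (t, t') ∂unifI) fun j =>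
    Measurable.lintegral_prod_left' (hg j)

theorem lintegral_lintegral_sum_prod {q : ℕ} (c : ℝ≥0∞) {g : Fin q → Fin q → ℝ × ℝ → ℝ≥0∞}
    (hg : ∀ i j, Measurable (g i j)) :
    ∫⁻ v', ∫⁻ v, c * ∑ i, ∏ j, g i j (v j, v' j) ∂cubeUniform q ∂cubeUniform q =
      c * ∑ i, ∏ j, ∫⁻ t', ∫⁻ t, g i j (t, t') ∂unifI ∂unifI := by
  have hm1 : ∀ i, Measurable fun z : (Fin q → ℝ) × (Fin q → ℝ) => ∏ j, g i j (z.1 j, z.2 j) :=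
    fun i => Finset.measurable_prod _ fun j _ => (hg i j).comp
      (((measurable_pi_apply j).comp measurable_fst).prodMk
        ((measurable_pi_apply j).comp measurable_snd))
  have hm2 : ∀ i (v' : Fin q → ℝ), Measurable fun v : Fin q → ℝ => ∏ j, g i j (v j, v' j) :=
    fun i v' => (hm1 i).comp (measurable_id.prodMk measurable_const)
  have hm3 : ∀ i, Measurable fun v' : Fin q → ℝ =>
      ∫⁻ v, ∏ j, g i j (v j, v' j) ∂cubeUniform q := fun i => (hm1 i).lintegral_prod_left'
  have h : ∀ v' : Fin q → ℝ, ∫⁻ v, c * ∑ i, ∏ j, g i j (v j, v' j) ∂cubeUniform q =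
      c * ∑ i, ∫⁻ v, ∏ j, g i j (v j, v' j) ∂cubeUniform q := by
    intro v'
    rw [lintegral_const_mul _ (Finset.measurable_sum _ fun i _ => hm2 i v'),
      lintegral_finsetSum _ fun i _ => hm2 i v']
  simp only [h]
  rw [lintegral_const_mul _ (Finset.measurable_sum _ fun i _ => hm3 i),
    lintegral_finsetSum _ fun i _ => hm3 i]
  simp only [lintegral_lintegral_cubeUniform_prod (hg _)]

namespace Problem

variable {d q : ℕ} {P : Problem d q}

/-- The quantile function of the `j`-th margin, read off from the inverse of the uniformizing map
along the diagonal of the cube. -/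
def quantile (P : Problem d q) (θ : Dec d) (j : Fin q) (t : ℝ) : ℝ := P.muInv θ (fun _ => t) j

theorem Standing.measurable_quantile (hP : P.Standing) (θ : Dec d) (j : Fin q) :
    Measurable (P.quantile θ j) :=
  (measurable_pi_apply j).comp
    ((hP.measurable_muInv_right θ).comp (measurable_pi_lambda _ fun _ => measurable_id))

theorem Standing.muInv_mem_supp (hP : P.Standing) {θ : Dec d} (hθ : θ ∈ P.Θ) {u : Fin q → ℝ}
    (hu : u ∈ (univ.pi fun _ : Fin q => Ioo (0 : ℝ) 1)) : P.muInv θ u ∈ P.supp θ := by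
  have h := hP.uniformizing θ hθ
  obtain ⟨x, hx, hxu⟩ := h.bijOn.surjOn (h.open_cube_subset hu)
  rw [← hxu, h.invOn.1 hx]; exact hx

theorem IndepMargins.cdf_muInv (hI : P.IndepMargins) (hP : P.Standing) {θ : Dec d} (hθ : θ ∈ P.Θ)
    {u : Fin q → ℝ} (hu : u ∈ (univ.pi fun _ : Fin q => Ioo (0 : ℝ) 1)) (j : Fin q) :
    cdf ((P.law θ).map fun y => y j) (P.muInv θ u j) = u j := by
  have h := hP.uniformizing θ hθ
  rw [← (hI θ hθ).2 _ (hP.muInv_mem_supp hθ hu) j, h.invOn.2 (h.open_cube_subset hu)]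

theorem IndepMargins.monotoneOn_quantile (hI : P.IndepMargins) (hP : P.Standing) {θ : Dec d}
    (hθ : θ ∈ P.Θ) (j : Fin q) : MonotoneOn (P.quantile θ j) (Ioo 0 1) := by
  intro t ht t' ht' htt'
  rcases htt'.eq_or_lt with rfl | hlt
  · exact le_rfl
  · by_contra! hcon
    have h := monotone_cdf ((P.law θ).map fun y => y j) hcon.le
    unfold quantile at h
    rw [hI.cdf_muInv hP hθ (fun _ _ => ht) j, hI.cdf_muInv hP hθ (fun _ _ => ht') j] at h
    exact absurd hlt (not_lt.2 h)

/-- Almost everywhere the inverse of the uniformizing map acts coordinatewise: it can fail to do so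
only at the countably many levels at which the distribution function of a margin is flat. -/
theorem IndepMargins.muInv_ae_eq (hI : P.IndepMargins) (hP : P.Standing) {θ : Dec d}
    (hθ : θ ∈ P.Θ) : ∀ᵐ u ∂cubeUniform q, ∀ j, P.muInv θ u j = P.quantile θ j (u j) := by
  refine ae_all_iff.2 fun j => ?_
  set D : Set ℝ := {c | ∃ x y, x < y ∧ cdf ((P.law θ).map fun y => y j) x = c ∧
    cdf ((P.law θ).map fun y => y j) y = c} with hD
  have hDc : D.Countable := (monotone_cdf _).countable_setOfPred_two_preimages
  have hDae : ∀ᵐ t ∂unifI, t ∉ D := by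
    have : unifI D = 0 := by
      unfold unifI
      exact Measure.absolutelyContinuous_of_le Measure.restrict_le_self (hDc.measure_zero volume)
    exact measure_eq_zero_iff_ae_notMem.1 this
  filter_upwards [ae_eval_cubeUniform j hDae, ae_mem_openCube q] with u hu hcube
  have h1 := hI.cdf_muInv hP hθ hcube j
  have h2 := hI.cdf_muInv hP hθ (u := fun _ => u j) (fun _ _ => hcube j trivial) j
  by_contra hne
  rcases lt_or_gt_of_ne hne with h | h
  · exact hu ⟨_, _, h, h1, h2⟩
  · exact hu ⟨_, _, h, h2, h1⟩

theorem IndepMargins.expTail_quantile (hI : P.IndepMargins) (hP : P.Standing) {θ : Dec d}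
    (hθ : θ ∈ P.Θ) (j : Fin q) {C κ : ℝ}
    (h : ∀ y : ℝ, 0 ≤ y → (P.law θ).real {x | y ≤ |x j|} ≤ C * Real.exp (-(κ * y))) :
    ExpTail (P.quantile θ j) C κ := by
  intro y hy
  have := hP.isProbabilityMeasure_law hθ
  have hmeas : MeasurableSet {t | y ≤ |P.quantile θ j t|} :=
    measurableSet_le measurable_const
      (continuous_abs.measurable.comp (hP.measurable_quantile θ j))
  have hmeas' : MeasurableSet {x : Fin q → ℝ | y ≤ |x j|} :=
    measurableSet_le measurable_const (continuous_abs.measurable.comp (measurable_pi_apply j))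
  have h1 : unifI {t | y ≤ |P.quantile θ j t|} = (P.law θ) {x | y ≤ |x j|} := by
    rw [← hP.map_muInv hθ, Measure.map_apply (hP.measurable_muInv_right θ) hmeas']
    have h2 : unifI {t | y ≤ |P.quantile θ j t|} =
        cubeUniform q ((fun u => u j) ⁻¹' {t | y ≤ |P.quantile θ j t|}) := by
      rw [cubeUniform_eq_pi]
      exact ((measurePreserving_eval (fun _ : Fin q => unifI) j).measure_preimage
        hmeas.nullMeasurableSet).symm
    rw [h2]
    refine measure_congr ?_
    filter_upwards [hI.muInv_ae_eq hP hθ] with u hu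
    refine propext ?_
    show y ≤ |P.quantile θ j (u j)| ↔ y ≤ |P.muInv θ u j|
    rw [hu j]
  rw [h1, ← ofReal_measureReal]
  exact ENNReal.ofReal_le_ofReal (h y hy)

/-- The mean value inequality along a segment of the convex hull of the support. -/
theorem Standing.sq_oracle_sub_le (hP : P.Standing) {θ : Dec d} (hθ : θ ∈ P.Θ) {b C : ℝ}
    (hb : 0 ≤ b)
    (hF : ∀ x ∈ convexHull ℝ (P.supp θ), ‖fderiv ℝ (P.F θ) x‖ ≤ C * Real.exp (b * ∑ j, |x j|))
    {u u' : Fin q → ℝ} (hu : u ∈ (univ.pi fun _ : Fin q => Ioo (0 : ℝ) 1))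
    (hu' : u' ∈ (univ.pi fun _ : Fin q => Ioo (0 : ℝ) 1)) :
    (P.oracle θ u - P.oracle θ u') ^ 2 ≤ C ^ 2 * ∑ i, ∏ j,
      ((if j = i then (P.muInv θ u j - P.muInv θ u' j) ^ 2 else 1) *
        Real.exp (2 * b * max |P.muInv θ u j| |P.muInv θ u' j|)) := by
  set x := P.muInv θ u with hx
  set x' := P.muInv θ u' with hx'
  have hxm : x ∈ convexHull ℝ (P.supp θ) := subset_convexHull ℝ _ (hP.muInv_mem_supp hθ hu)
  have hxm' : x' ∈ convexHull ℝ (P.supp θ) := subset_convexHull ℝ _ (hP.muInv_mem_supp hθ hu')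
  have hC : 0 ≤ C := by
    have := (norm_nonneg _).trans (hF x hxm)
    exact nonneg_of_mul_nonneg_left this (Real.exp_pos _)
  set W := ∑ j, max |x j| |x' j| with hW
  have hseg : segment ℝ x' x ⊆ convexHull ℝ (P.supp θ) :=
    (convex_convexHull ℝ _).segment_subset hxm' hxm
  have hbound : ∀ z ∈ segment ℝ x' x, ‖fderiv ℝ (P.F θ) z‖ ≤ C * Real.exp (b * W) := by
    intro z hz
    refine (hF z (hseg hz)).trans ?_
    have hz' : ∀ j, |z j| ≤ max |x j| |x' j| := by
      obtain ⟨α, β, hα, hβ, hαβ, rfl⟩ := hz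
      intro j
      simp only [Pi.add_apply, Pi.smul_apply, smul_eq_mul]
      calc |α * x' j + β * x j| ≤ α * |x' j| + β * |x j| := by
            refine (abs_add_le _ _).trans ?_
            rw [abs_mul, abs_mul, abs_of_nonneg hα, abs_of_nonneg hβ]
        _ ≤ α * max |x j| |x' j| + β * max |x j| |x' j| := by
            gcongr
            · exact le_max_right _ _
            · exact le_max_left _ _
        _ = max |x j| |x' j| := by rw [← add_mul, hαβ, one_mul]
    have hsum : ∑ j, |z j| ≤ W := Finset.sum_le_sum fun j _ => hz' j
    gcongr
  have hmv := (convex_segment x' x).norm_image_sub_le_of_norm_fderiv_le (𝕜 := ℝ)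
    (fun z hz => (hP.F_contDiff θ hθ z (hseg hz)).differentiableAt one_ne_zero) hbound
    (left_mem_segment ℝ x' x) (right_mem_segment ℝ x' x)
  have hnorm : ‖x - x'‖ ^ 2 ≤ ∑ i, (x i - x' i) ^ 2 := by
    have hle : ‖x - x'‖ ≤ Real.sqrt (∑ i, (x i - x' i) ^ 2) :=
      (pi_norm_le_iff_of_nonneg (Real.sqrt_nonneg _)).2 fun i => Real.abs_le_sqrt
        (Finset.single_le_sum (f := fun i => (x i - x' i) ^ 2) (fun _ _ => sq_nonneg _)
          (Finset.mem_univ i))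
    calc ‖x - x'‖ ^ 2 ≤ Real.sqrt (∑ i, (x i - x' i) ^ 2) ^ 2 := by gcongr
      _ = _ := Real.sq_sqrt (Finset.sum_nonneg fun _ _ => sq_nonneg _)
  have hprod : ∀ i, ∏ j, ((if j = i then (x j - x' j) ^ 2 else 1) *
      Real.exp (2 * b * max |x j| |x' j|)) = (x i - x' i) ^ 2 * Real.exp (b * W) ^ 2 := by
    intro i
    rw [Finset.prod_mul_distrib, Finset.prod_ite_eq' , ← Real.exp_sum, ← Finset.mul_sum, ← hW,
      ← Real.exp_nat_mul]
    simp only [Finset.mem_univ, if_true]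
    congr 2
    push_cast; ring
  simp only [hprod]
  rw [← Finset.sum_mul]
  calc (P.oracle θ u - P.oracle θ u') ^ 2 = ‖P.F θ x - P.F θ x'‖ ^ 2 := by
        rw [Real.norm_eq_abs, sq_abs]; rfl
    _ ≤ (C * Real.exp (b * W) * ‖x - x'‖) ^ 2 := by gcongr
    _ = C ^ 2 * (‖x - x'‖ ^ 2 * Real.exp (b * W) ^ 2) := by ring
    _ ≤ _ := by gcongr

/-- Independent margins with exponential tails of rate `κ` and a gradient of growth
`exp (b ∑ |x_j|)` give variance decay of every order below `1 - 2 b / κ`: by the mean value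
inequality and the product structure the variance factors into one-dimensional oscillations. -/
theorem IndepMargins.varianceDecay (hI : P.IndepMargins) (hP : P.Standing) {κ b C₁ C₂ p : ℝ}
    (hb : 0 ≤ b) (hκ : 0 < κ)
    (hT : ∀ θ ∈ P.Θ, ∀ j, ∀ y : ℝ, 0 ≤ y →
      (P.law θ).real {x | y ≤ |x j|} ≤ C₁ * Real.exp (-(κ * y)))
    (hF : ∀ θ ∈ P.Θ, ∀ x ∈ convexHull ℝ (P.supp θ),
      ‖fderiv ℝ (P.F θ) x‖ ≤ C₂ * Real.exp (b * ∑ j, |x j|))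
    (hp0 : 0 < p) (hp : p < 1 - 2 * b / κ) : P.VarianceDecay p := by
  obtain ⟨K, hK0, hK⟩ := exists_sum_lintegral_cell_le (C := C₁) hb hκ hp0 hp
  have hbκ : 2 * b < κ := by
    have : 2 * b / κ < 1 := by linarith
    rwa [div_lt_one hκ] at this
  obtain ⟨E, hE0, hE⟩ := exists_lintegral_exp_le (C := C₁) (by linarith : 0 ≤ 2 * b) hbκ
  refine ⟨C₂ ^ 2 * ∑ _i : Fin q, K * (2 * E) ^ (q - 1), fun θ hθ m hm => ?_⟩
  have hm0 : (0 : ℝ) < m := by exact_mod_cast hm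
  set H : Fin q → ℝ → ℝ := P.quantile θ with hH
  have hHm : ∀ j, Measurable (H j) := hP.measurable_quantile θ
  have hHt : ∀ j, ExpTail (H j) C₁ κ := fun j => hI.expTail_quantile hP hθ j (hT θ hθ j)
  set w : Fin q → Fin q → ℝ → ℝ → ℝ := fun i j t t' =>
    (if j = i then (H j t - H j t') ^ 2 else 1) * Real.exp (2 * b * max |H j t| |H j t'|) with hw
  have hw0 : ∀ i j t t', 0 ≤ w i j t t' := by
    intro i j t t'
    simp only [hw]
    split_ifs <;> positivity
  set g : Fin q → (Fin q → Fin m) → Fin q → ℝ × ℝ → ℝ≥0∞ := fun i s j z =>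
    ENNReal.ofReal (w i j (cellPoint m (s j) z.1) (cellPoint m (s j) z.2)) with hg
  have hgm : ∀ i s j, Measurable (g i s j) := by
    intro i s j
    have h1 : Measurable fun z : ℝ × ℝ => H j (cellPoint m (s j) z.1) :=
      (hHm j).comp ((measurable_cellPoint _ _).comp measurable_fst)
    have h2 : Measurable fun z : ℝ × ℝ => H j (cellPoint m (s j) z.2) :=
      (hHm j).comp ((measurable_cellPoint _ _).comp measurable_snd)
    refine ENNReal.measurable_ofReal.comp (Measurable.mul ?_ ?_)
    · split_ifs
      · exact (h1.sub h2).pow_const 2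
      · exact measurable_const
    · exact Real.measurable_exp.comp (((continuous_abs.measurable.comp h1).max
        (continuous_abs.measurable.comp h2)).const_mul _)
  have hvar : ∀ s : Fin q → Fin m,
      ENNReal.ofReal (variance (fun v => P.oracle θ (stratumPoint m s v)) (cubeUniform q)) ≤
        ENNReal.ofReal (C₂ ^ 2) * ∑ i, ∏ j, ∫⁻ t', ∫⁻ t, g i s j (t, t') ∂unifI ∂unifI := by
    intro s
    refine (ofReal_variance_le_lintegral
      (memLp_comp_stratumPoint hm s (hP.memLp_oracle hθ))).trans ?_
    have hgood : ∀ᵐ v ∂cubeUniform q,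
        stratumPoint m s v ∈ (univ.pi fun _ : Fin q => Ioo (0 : ℝ) 1) ∧
        ∀ j, P.muInv θ (stratumPoint m s v) j = H j (cellPoint m (s j) (v j)) :=
      (ae_stratumPoint hm s (ae_mem_openCube q)).and
        (ae_stratumPoint hm s (hI.muInv_ae_eq hP hθ))
    calc _ ≤ ∫⁻ v', ∫⁻ v, ENNReal.ofReal (C₂ ^ 2) * ∑ i, ∏ j, g i s j (v j, v' j)
          ∂cubeUniform q ∂cubeUniform q := by
          refine lintegral_mono_ae ?_
          filter_upwards [hgood] with v' hv'
          refine lintegral_mono_ae ?_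
          filter_upwards [hgood] with v hv
          have h := hP.sq_oracle_sub_le hθ hb (hF θ hθ) hv.1 hv'.1
          simp only [hv.2, hv'.2] at h
          refine (ENNReal.ofReal_le_ofReal h).trans_eq ?_
          rw [ENNReal.ofReal_mul (sq_nonneg _)]
          congr 1
          rw [ENNReal.ofReal_sum_of_nonneg fun i _ => Finset.prod_nonneg fun j _ => hw0 i j _ _]
          refine Finset.sum_congr rfl fun i _ => ?_
          exact ENNReal.ofReal_prod_of_nonneg fun j _ => hw0 i j _ _
      _ = _ := lintegral_lintegral_sum_prod _ fun i j => hgm i s j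
  have hsum : ∀ i, ∑ s : Fin q → Fin m, ∏ j, ∫⁻ t', ∫⁻ t, g i s j (t, t') ∂unifI ∂unifI ≤
      ENNReal.ofReal ((m : ℝ) ^ q * (K * (m : ℝ) ^ (-p) * (2 * E) ^ (q - 1))) := by
    intro i
    have h1 := Fintype.prod_sum fun (j : Fin q) (l : Fin m) => ∫⁻ t', ∫⁻ t,
      ENNReal.ofReal (w i j (cellPoint m l t) (cellPoint m l t')) ∂unifI ∂unifI
    rw [← h1]
    have h2 : ∀ j, ∑ l : Fin m, ∫⁻ t', ∫⁻ t,
        ENNReal.ofReal (w i j (cellPoint m l t) (cellPoint m l t')) ∂unifI ∂unifI ≤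
        ENNReal.ofReal (m * if j = i then K * (m : ℝ) ^ (-p) else 2 * E) := by
      intro j
      rw [ENNReal.ofReal_mul hm0.le, ENNReal.ofReal_natCast]
      split_ifs with hji
      · simp only [hw, hji, if_true]
        exact hK (H i) (hHm i) (hI.monotoneOn_quantile hP hθ i) (hHt i) m hm
      · simp only [hw, hji, if_false, one_mul]
        set e : ℝ → ℝ≥0∞ := fun t => ENNReal.ofReal (Real.exp (2 * b * |H j t|)) with he
        have hem : Measurable e := by
          refine ENNReal.measurable_ofReal.comp (Real.measurable_exp.comp ?_)
          exact (continuous_abs.measurable.comp (hHm j)).const_mul _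
        have hec : ∀ l : Fin m, Measurable fun t => e (cellPoint m l t) := fun l =>
          hem.comp (measurable_cellPoint m l)
        calc _ ≤ ∑ l : Fin m, 2 * ∫⁻ t, e (cellPoint m l t) ∂unifI := by
              refine Finset.sum_le_sum fun l _ => ?_
              calc _ ≤ ∫⁻ t', ∫⁻ t, (e (cellPoint m l t) + e (cellPoint m l t'))
                    ∂unifI ∂unifI := by
                    refine lintegral_mono fun t' => lintegral_mono fun t => ?_
                    simp only [he]
                    rcases max_choice |H j (cellPoint m l t)| |H j (cellPoint m l t')| with h | h
                    · rw [h]; exact le_self_add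
                    · rw [h]; exact le_add_self
                _ = _ := by
                    have : ∀ t', ∫⁻ t, (e (cellPoint m l t) + e (cellPoint m l t')) ∂unifI =
                        (∫⁻ t, e (cellPoint m l t) ∂unifI) + e (cellPoint m l t') := by
                      intro t'
                      rw [lintegral_add_left (hec l)]; simp
                    simp only [this]
                    rw [lintegral_add_left measurable_const]
                    simp [two_mul]
          _ = 2 * (m * ∫⁻ t, e t ∂unifI) := by
              rw [← Finset.mul_sum, sum_lintegral_cellPoint hm hem]
          _ ≤ _ := by
              rw [ENNReal.ofReal_mul (by norm_num), ENNReal.ofReal_ofNat, mul_left_comm]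
              gcongr
              exact hE (H j) (hHm j) (hHt j)
    calc _ ≤ ∏ j : Fin q, ENNReal.ofReal (m * if j = i then K * (m : ℝ) ^ (-p) else 2 * E) :=
          Finset.prod_le_prod' fun j _ => h2 j
      _ = ENNReal.ofReal (∏ j : Fin q, (m * if j = i then K * (m : ℝ) ^ (-p) else 2 * E)) := by
          refine (ENNReal.ofReal_prod_of_nonneg fun j _ => ?_).symm
          split_ifs <;> positivity
      _ = _ := by
          congr 1
          rw [Finset.prod_mul_distrib, Finset.prod_const, Finset.card_univ, Fintype.card_fin,
            ← Finset.mul_prod_erase _ _ (Finset.mem_univ i), if_pos rfl]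
          congr 2
          rw [Finset.prod_congr rfl (g := fun _ => 2 * E) fun j hj =>
            if_neg (Finset.ne_of_mem_erase hj), Finset.prod_const,
            Finset.card_erase_of_mem (Finset.mem_univ i), Finset.card_univ, Fintype.card_fin]
  have htot : ∑ s : Fin q → Fin m,
      variance (fun v => P.oracle θ (stratumPoint m s v)) (cubeUniform q) ≤
      C₂ ^ 2 * ∑ _i : Fin q, (m : ℝ) ^ q * (K * (m : ℝ) ^ (-p) * (2 * E) ^ (q - 1)) := by
    have hnn : 0 ≤ C₂ ^ 2 * ∑ _i : Fin q, (m : ℝ) ^ q * (K * (m : ℝ) ^ (-p) * (2 * E) ^ (q - 1)) :=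
      mul_nonneg (sq_nonneg _) (Finset.sum_nonneg fun i _ => by positivity)
    rw [← ENNReal.ofReal_le_ofReal_iff hnn,
      ENNReal.ofReal_sum_of_nonneg fun s _ => variance_nonneg _ _]
    refine (Finset.sum_le_sum fun s _ => hvar s).trans ?_
    rw [← Finset.mul_sum, Finset.sum_comm, ENNReal.ofReal_mul (sq_nonneg _),
      ENNReal.ofReal_sum_of_nonneg fun i _ => by positivity]
    gcongr with i
    exact hsum i
  unfold stratVar
  calc _ ≤ (1 / (m : ℝ) ^ q) *
        (C₂ ^ 2 * ∑ _i : Fin q, (m : ℝ) ^ q * (K * (m : ℝ) ^ (-p) * (2 * E) ^ (q - 1))) := by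
        gcongr
    _ = _ := by
        simp only [Finset.sum_const, nsmul_eq_mul]
        field_simp

end Problem

namespace Problem

variable {d q : ℕ} {P : Problem d q}

theorem SubExponential.exists_uniform {κ : Fin q → ℝ} (h : P.SubExponential κ) {κ₀ : ℝ}
    (hκ : ∀ i, κ₀ ≤ κ i) :
    ∃ C : ℝ, ∀ θ ∈ P.Θ, ∀ j, ∀ y : ℝ, 0 ≤ y →
      (P.law θ).real {x | y ≤ |x j|} ≤ C * Real.exp (-(κ₀ * y)) := by
  choose C hC using h
  refine ⟨∑ i, |C i|, fun θ hθ j y hy => (hC j θ hθ y hy).trans ?_⟩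
  have h1 : C j ≤ ∑ i, |C i| := (le_abs_self _).trans
    (Finset.single_le_sum (f := fun i => |C i|) (fun _ _ => abs_nonneg _) (Finset.mem_univ j))
  have h2 : 0 ≤ ∑ i, |C i| := Finset.sum_nonneg fun _ _ => abs_nonneg _
  have h3 := mul_le_mul_of_nonneg_right (hκ j) hy
  gcongr

theorem SubGaussian.subExponential {ξ : Fin q → ℝ} (hξ : ∀ i, 0 < ξ i) (h : P.SubGaussian ξ)
    (κ : ℝ) : P.SubExponential fun _ => κ := by
  intro i
  obtain ⟨C, hC⟩ := h i
  refine ⟨|C| * Real.exp (κ ^ 2 * ξ i ^ 2 / 4), fun θ hθ y hy => (hC θ hθ y hy).trans ?_⟩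
  rw [mul_assoc, ← Real.exp_add]
  have h1 : -(y / ξ i) ^ 2 ≤ κ ^ 2 * ξ i ^ 2 / 4 + -(κ * y) := by
    have h2 := sq_nonneg (y / ξ i - κ * ξ i / 2)
    have h3 : y / ξ i * (κ * ξ i) = κ * y := by
      have := (hξ i).ne'
      field_simp
    nlinarith
  calc C * Real.exp (-(y / ξ i) ^ 2) ≤ |C| * Real.exp (-(y / ξ i) ^ 2) := by
        gcongr; exact le_abs_self C
    _ ≤ _ := by gcongr

theorem PolynomialGrowth.exists_exp {a : Fin q → ℕ} (h : P.PolynomialGrowth a) {b : ℝ}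
    (hb : 0 < b) :
    ∃ C : ℝ, ∀ θ ∈ P.Θ, ∀ x ∈ convexHull ℝ (P.supp θ),
      ‖fderiv ℝ (P.F θ) x‖ ≤ C * Real.exp (b * ∑ j, |x j|) := by
  obtain ⟨-, C, hC⟩ := h
  refine ⟨|C| * (1 + ∑ j, (a j).factorial / b ^ a j), fun θ hθ x hx => (hC θ hθ x hx).trans ?_⟩
  set e := Real.exp (b * ∑ j, |x j|) with he
  have h0 : 0 ≤ b * ∑ j, |x j| := mul_nonneg hb.le (Finset.sum_nonneg fun _ _ => abs_nonneg _)
  have h1 : ∀ j, |x j| ^ a j ≤ (a j).factorial / b ^ a j * e := by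
    intro j
    have h2 := Real.pow_div_factorial_le_exp (b * |x j|) (by positivity) (a j)
    have h3 : Real.exp (b * |x j|) ≤ e := by
      refine Real.exp_le_exp.2 (mul_le_mul_of_nonneg_left ?_ hb.le)
      exact Finset.single_le_sum (f := fun j => |x j|) (fun _ _ => abs_nonneg _)
        (Finset.mem_univ j)
    have h4 : |x j| ^ a j =
        (a j).factorial / b ^ a j * ((b * |x j|) ^ a j / (a j).factorial) := by
      rw [mul_pow]
      have : ((a j).factorial : ℝ) ≠ 0 := by exact_mod_cast (a j).factorial_ne_zero
      field_simp
    rw [h4]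
    exact mul_le_mul_of_nonneg_left (h2.trans h3) (by positivity)
  have h5 : 1 + ∑ j, |x j| ^ a j ≤ (1 + ∑ j, (a j).factorial / b ^ a j) * e := by
    rw [add_mul, one_mul, Finset.sum_mul]
    exact add_le_add (Real.one_le_exp h0) (Finset.sum_le_sum fun j _ => h1 j)
  have h6 : 0 ≤ 1 + ∑ j, |x j| ^ a j :=
    add_nonneg zero_le_one (Finset.sum_nonneg fun _ _ => by positivity)
  calc C * (1 + ∑ j, |x j| ^ a j) ≤ |C| * (1 + ∑ j, |x j| ^ a j) := by
        gcongr; exact le_abs_self C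
    _ ≤ |C| * ((1 + ∑ j, (a j).factorial / b ^ a j) * e) := by gcongr
    _ = _ := by ring

theorem ExponentialGrowth.exists_exp {b : Fin q → ℝ} (h : P.ExponentialGrowth b) {b₀ : ℝ}
    (hb : ∀ j, b j ≤ b₀) :
    ∃ C : ℝ, ∀ θ ∈ P.Θ, ∀ x ∈ convexHull ℝ (P.supp θ),
      ‖fderiv ℝ (P.F θ) x‖ ≤ C * Real.exp (b₀ * ∑ j, |x j|) := by
  obtain ⟨-, C, hC⟩ := h
  refine ⟨|C|, fun θ hθ x hx => (hC θ hθ x hx).trans ?_⟩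
  have h1 : ∑ j, b j * |x j| ≤ b₀ * ∑ j, |x j| := by
    rw [Finset.mul_sum]
    exact Finset.sum_le_sum fun j _ => mul_le_mul_of_nonneg_right (hb j) (abs_nonneg _)
  calc C * Real.exp (∑ j, b j * |x j|) ≤ |C| * Real.exp (∑ j, b j * |x j|) := by
        gcongr; exact le_abs_self C
    _ ≤ _ := by gcongr

theorem IndepMargins.varianceDecay_of_exponential (hI : P.IndepMargins) (hP : P.Standing)
    {κ b : Fin q → ℝ} {κ₀ b₀ p : ℝ} (hκ₀ : 0 < κ₀) (hκ : ∀ i, κ₀ ≤ κ i) (hb₀ : 0 ≤ b₀)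
    (hb : ∀ j, b j ≤ b₀) (hS : P.SubExponential κ) (hE : P.ExponentialGrowth b) (hp0 : 0 < p)
    (hp : p < 1 - 2 * b₀ / κ₀) : P.VarianceDecay p := by
  obtain ⟨C₁, h₁⟩ := hS.exists_uniform hκ
  obtain ⟨C₂, h₂⟩ := hE.exists_exp hb
  exact hI.varianceDecay hP hb₀ hκ₀ h₁ h₂ hp0 hp

theorem IndepMargins.varianceDecay_of_polynomial (hI : P.IndepMargins) (hP : P.Standing)
    {κ : Fin q → ℝ} {a : Fin q → ℕ} {p : ℝ} (hq : 1 ≤ q) (hκ : ∀ i, 0 < κ i)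
    (hS : P.SubExponential κ) (hE : P.PolynomialGrowth a) (hp0 : 0 < p) (hp : p < 1) :
    P.VarianceDecay p := by
  have : Nonempty (Fin q) := ⟨⟨0, hq⟩⟩
  obtain ⟨i₀, hi₀⟩ := Finite.exists_min κ
  have hb : 0 < (1 - p) * κ i₀ / 4 := by
    have := mul_pos (sub_pos.2 hp) (hκ i₀)
    linarith
  obtain ⟨C₁, h₁⟩ := hS.exists_uniform hi₀
  obtain ⟨C₂, h₂⟩ := hE.exists_exp hb
  refine hI.varianceDecay hP hb.le (hκ i₀) h₁ h₂ hp0 ?_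
  have : 2 * ((1 - p) * κ i₀ / 4) / κ i₀ = (1 - p) / 2 := by
    have := (hκ i₀).ne'
    field_simp; ring
  rw [this]; linarith

theorem IndepMargins.varianceDecay_of_subGaussian (hI : P.IndepMargins) (hP : P.Standing)
    {ξ b : Fin q → ℝ} {p : ℝ} (hξ : ∀ i, 0 < ξ i) (hS : P.SubGaussian ξ)
    (hE : P.ExponentialGrowth b) (hp0 : 0 < p) (hp : p < 1) : P.VarianceDecay p := by
  set b₀ := ∑ j, |b j| with hb₀
  have hb₀0 : 0 ≤ b₀ := Finset.sum_nonneg fun _ _ => abs_nonneg _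
  have hb : ∀ j, b j ≤ b₀ := fun j => (le_abs_self _).trans
    (Finset.single_le_sum (f := fun i => |b i|) (fun _ _ => abs_nonneg _) (Finset.mem_univ j))
  -- Sub-Gaussian tails are sub-exponential with any rate; this one is large enough for `b₀`.
  set κ₀ := (2 * b₀ + 1) / (1 - p) with hκ₀
  have hp' : 0 < 1 - p := sub_pos.2 hp
  have hκ₀0 : 0 < κ₀ := by positivity
  refine hI.varianceDecay_of_exponential hP hκ₀0 (fun _ => le_rfl) hb₀0 hb
    (hS.subExponential hξ κ₀) hE hp0 ?_
  have h1 : 2 * b₀ / κ₀ < 1 - p := by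
    rw [div_lt_iff₀ hκ₀0, hκ₀, mul_div_cancel₀ _ hp'.ne']
    linarith
  linarith

end Problem

/-! ### Complexity of a sequence of trust-region steps -/

/-- Constants of the analysis of a trust-region trajectory. -/
structure StepConsts where
  γup : ℝ
  γlow : ℝ
  Δmax : ℝ
  τ : ℝ
  c₁ : ℝ
  C₃ : ℝ
  γlow_pos : 0 < γlow
  γlow_lt_one : γlow < 1
  one_lt_γup : 1 < γup
  Δmax_pos : 0 < Δmax
  τ_pos : 0 < τ
  τ_le : τ ≤ 1 / 2
  c₁_pos : 0 < c₁
  C₃_pos : 0 < C₃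

/-- The step from `k` to `k + 1` of a trajectory with radii `a`, objective values `φ` and gradient
norms `g`, when the estimation errors are at most of order `a ^ (2 - τ)`, and of order `a ^ 2` with
a small constant if the radius is at least `1 / k ^ 2`. The first alternative is an accepted step,
the second one a rejected step. -/
def StepOK (c : StepConsts) (a φ g : ℕ → ℝ) (k : ℕ) : Prop :=
  (a (k + 1) = min (c.γup * a k) c.Δmax ∧ φ (k + 1) ≤ φ k + 2 * a k ^ (2 - c.τ) ∧
    (1 / (k : ℝ) ^ 2 ≤ a k → φ (k + 1) ≤ φ k - c.c₁ * a k ^ 2)) ∨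
  (a (k + 1) = c.γlow * a k ∧ φ (k + 1) = φ k ∧ g k ≤ c.C₃ * (a k + a k ^ (1 - c.τ)) ∧
    (1 / (k : ℝ) ^ 2 ≤ a k → g k ≤ c.C₃ * a k))

/-- The potential `φ + α a ^ 2` decreases by a multiple of `a ^ 2` up to a summable error, so the
squared radii are summable. -/
theorem exists_sum_sq_radius_le {c : StepConsts} {a φ g : ℕ → ℝ} {K : ℕ} (hK : 1 ≤ K)
    (ha : ∀ k, 0 < a k) {φmin : ℝ} (hφ : ∀ k, φmin ≤ φ k) (hstep : ∀ k, K ≤ k → StepOK c a φ g k) :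
    ∃ S : ℝ, 0 ≤ S ∧ ∀ n, ∑ k ∈ Finset.Ico K n, a k ^ 2 ≤ S := by
  have hγ := c.one_lt_γup
  set α := c.c₁ / (2 * c.γup ^ 2) with hα
  have hα0 : 0 < α := div_pos c.c₁_pos (by positivity)
  have hαγ : α * c.γup ^ 2 = c.c₁ / 2 := by
    have : c.γup ≠ 0 := by linarith
    rw [hα]; field_simp
  set c₂ := min (c.c₁ / 2) (α * (1 - c.γlow ^ 2)) with hc₂
  have hlow : 0 < 1 - c.γlow ^ 2 := by nlinarith [c.γlow_pos, c.γlow_lt_one]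
  have hc₂0 : 0 < c₂ := lt_min (by linarith [c.c₁_pos]) (mul_pos hα0 hlow)
  set D := 2 + c.c₁ / 2 + c₂ with hD
  have hD0 : 0 < D := by linarith [c.c₁_pos]
  have hdec : ∀ k, K ≤ k →
      φ (k + 1) + α * a (k + 1) ^ 2 ≤ φ k + α * a k ^ 2 - c₂ * a k ^ 2 + D * (1 / (k : ℝ) ^ 2) := by
    intro k hk
    have hk1 : (1 : ℝ) ≤ k := by exact_mod_cast hK.trans hk
    have hak := ha k
    have hk2 : 0 < 1 / (k : ℝ) ^ 2 := by positivity
    have hk21 : 1 / (k : ℝ) ^ 2 ≤ 1 := by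
      rw [div_le_one (by positivity)]; exact one_le_pow₀ hk1
    rcases hstep k hk with ⟨h1, h2, h3⟩ | ⟨h1, h2, -, -⟩
    · have h4 : α * a (k + 1) ^ 2 ≤ c.c₁ / 2 * a k ^ 2 := by
        rw [← hαγ, mul_assoc, ← mul_pow]
        have : a (k + 1) ≤ c.γup * a k := h1 ▸ min_le_left _ _
        have := (ha (k + 1)).le
        gcongr
      by_cases hA : 1 / (k : ℝ) ^ 2 ≤ a k
      · have h5 := h3 hA
        have h6 : c₂ * a k ^ 2 ≤ c.c₁ / 2 * a k ^ 2 := by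
          gcongr; exact min_le_left _ _
        nlinarith [mul_pos hα0 (pow_pos hak 2), mul_pos hD0 hk2]
      · push Not at hA
        have hak1 : a k ≤ 1 := (hA.trans_le hk21).le
        have h5 : a k ^ (2 - c.τ) ≤ 1 / (k : ℝ) ^ 2 := by
          calc a k ^ (2 - c.τ) ≤ a k ^ (1 : ℝ) :=
                Real.rpow_le_rpow_of_exponent_ge hak hak1 (by linarith [c.τ_le])
            _ ≤ _ := by rw [Real.rpow_one]; exact hA.le
        have h6 : a k ^ 2 ≤ 1 / (k : ℝ) ^ 2 := by nlinarith
        have h7 := mul_le_mul_of_nonneg_left h6 (by linarith [c.c₁_pos] : 0 ≤ c.c₁ / 2)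
        have h8 := mul_le_mul_of_nonneg_left h6 hc₂0.le
        have h9 := mul_pos hα0 (pow_pos hak 2)
        have h10 : D * (1 / (k : ℝ) ^ 2) = 2 * (1 / (k : ℝ) ^ 2) + c.c₁ / 2 * (1 / (k : ℝ) ^ 2) +
          c₂ * (1 / (k : ℝ) ^ 2) := by rw [hD]; ring
        linarith
    · rw [h1, h2]
      have h6 : c₂ * a k ^ 2 ≤ α * (1 - c.γlow ^ 2) * a k ^ 2 := by
        gcongr; exact min_le_right _ _
      nlinarith [mul_pos hD0 hk2]
  have hsum : Summable fun k : ℕ => 1 / (k : ℝ) ^ 2 := Real.summable_one_div_nat_pow.2 one_lt_two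
  set Z := ∑' k : ℕ, 1 / (k : ℝ) ^ 2 with hZ
  have htel : ∀ n, K ≤ n → c₂ * ∑ k ∈ Finset.Ico K n, a k ^ 2 ≤
      φ K + α * a K ^ 2 - (φ n + α * a n ^ 2) +
        D * ∑ k ∈ Finset.Ico K n, 1 / (k : ℝ) ^ 2 := by
    intro n hn
    induction n, hn using Nat.le_induction with
    | base => simp
    | succ n hn ih =>
      rw [Finset.sum_Ico_succ_top hn, Finset.sum_Ico_succ_top hn, mul_add, mul_add]
      linarith [hdec n hn]
  set S := (φ K + α * a K ^ 2 - φmin + D * Z) / c₂ with hS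
  have hbound : ∀ n, K ≤ n → ∑ k ∈ Finset.Ico K n, a k ^ 2 ≤ S := by
    intro n hn
    rw [hS, le_div_iff₀ hc₂0, mul_comm]
    have h1 : ∑ k ∈ Finset.Ico K n, 1 / (k : ℝ) ^ 2 ≤ Z :=
      hsum.sum_le_tsum _ fun k _ => by positivity
    have h2 := mul_le_mul_of_nonneg_left h1 hD0.le
    have h3 := mul_pos hα0 (pow_pos (ha n) 2)
    linarith [htel n hn, hφ n]
  have hS0 : 0 ≤ S := by simpa using hbound K le_rfl
  refine ⟨S, hS0, fun n => ?_⟩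
  rcases le_total K n with hn | hn
  · exact hbound n hn
  · rw [Finset.Ico_eq_empty_of_le hn]; simpa using hS0

theorem tsum_ite_lt_const (n : ℕ) (X : ℝ≥0∞) : ∑' k : ℕ, (if k < n then X else 0) = n * X := by
  rw [tsum_eq_sum (s := Finset.range n) fun k hk => if_neg (by simpa using hk),
    Finset.sum_congr rfl fun k hk => if_pos (Finset.mem_range.1 hk)]
  simp

section Trajectory

variable {c : StepConsts} {a φ g : ℕ → ℝ} {K : ℕ} {ε : ℝ} {T : ℕ∞}

/-- Until the gradient falls below `ε`, radii stay above a multiple of `ε ^ (1 / (1 - τ))`. -/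
theorem radius_ge_rpow (ha : ∀ k, 0 < a k) (hstep : ∀ k, K ≤ k → StepOK c a φ g k)
    (hT : ∀ n : ℕ, (n : ℕ∞) ≤ T → ∀ k < n, ε < g k) {x : ℝ} (hx0 : 0 < x) (hx1 : x ≤ 1)
    (hxε : ε = 2 * c.C₃ * x) (hxa : x ≤ a K) (hxΔ : x ≤ c.Δmax) :
    ∀ k, K ≤ k → (k : ℕ∞) ≤ T → c.γlow * x ^ (1 / (1 - c.τ)) ≤ a k := by
  have hτ : 0 < 1 - c.τ := by linarith [c.τ_le]
  have hb1 : 1 ≤ 1 / (1 - c.τ) := by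
    rw [le_div_iff₀ hτ]; linarith [c.τ_pos]
  have hxb : x ^ (1 / (1 - c.τ)) ≤ x := by
    simpa using Real.rpow_le_rpow_of_exponent_ge hx0 hx1 hb1
  have hxb0 : 0 < x ^ (1 / (1 - c.τ)) := Real.rpow_pos_of_pos hx0 _
  have hlow : c.γlow * x ^ (1 / (1 - c.τ)) ≤ x := by nlinarith [c.γlow_lt_one]
  intro k hk
  induction k, hk using Nat.le_induction with
  | base => exact fun _ => hlow.trans hxa
  | succ k hk ih =>
    intro hkT
    have hk' : (k : ℕ∞) ≤ T := le_trans (by exact_mod_cast Nat.le_succ k) hkT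
    have hg := hT _ hkT k (Nat.lt_succ_self k)
    have hak := ha k
    rcases hstep k hk with ⟨h1, -, -⟩ | ⟨h1, -, h2, -⟩
    · rw [h1]
      refine le_min ?_ (hlow.trans hxΔ)
      nlinarith [ih hk', c.one_lt_γup]
    · rw [h1]
      refine mul_le_mul_of_nonneg_left ?_ c.γlow_pos.le
      rcases le_total (a k) 1 with h | h
      · have h3 : a k ≤ a k ^ (1 - c.τ) := by
          simpa using Real.rpow_le_rpow_of_exponent_ge hak h
            (by linarith [c.τ_pos] : 1 - c.τ ≤ 1)
        have h4 : x ≤ a k ^ (1 - c.τ) := by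
          by_contra! hcon
          have := mul_lt_mul_of_pos_left hcon c.C₃_pos
          nlinarith [mul_le_mul_of_nonneg_left h3 c.C₃_pos.le]
        calc x ^ (1 / (1 - c.τ)) ≤ (a k ^ (1 - c.τ)) ^ (1 / (1 - c.τ)) := by gcongr
          _ = a k := by
            rw [← Real.rpow_mul hak.le, mul_one_div_cancel hτ.ne', Real.rpow_one]
      · linarith

/-- Once all radii are at least `1 / k ^ 2`, accepted steps bring the radius up to a multiple of
`ε`, below which it does not fall before the gradient falls below `ε`. -/
theorem radius_ge_linear (ha : ∀ k, 0 < a k) (hstep : ∀ k, K ≤ k → StepOK c a φ g k)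
    (hT : ∀ n : ℕ, (n : ℕ∞) ≤ T → ∀ k < n, ε < g k) {x y : ℝ} (hx0 : 0 < x) (hy0 : 0 < y)
    (hxε : ε = 2 * c.C₃ * x) (hxΔ : x ≤ c.Δmax) {n₁ : ℕ} (hn₁ : K ≤ n₁)
    (hlow : ∀ k, n₁ ≤ k → (k : ℕ∞) ≤ T → y ≤ a k)
    (hbig : ∀ k, n₁ ≤ k → (k : ℕ∞) ≤ T → 1 / (k : ℝ) ^ 2 ≤ a k) (j : ℕ)
    (hj : ((n₁ + j : ℕ) : ℕ∞) ≤ T) :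
    min (c.γlow * x) ((1 + j * (c.γup - 1)) * y) ≤ a (n₁ + j) := by
  have hγ := c.one_lt_γup
  have hγx : c.γlow * x ≤ x := by nlinarith [c.γlow_lt_one]
  have hγx0 : 0 < c.γlow * x := mul_pos c.γlow_pos hx0
  induction j with
  | zero => exact (min_le_right _ _).trans (by simpa using hlow n₁ le_rfl (by simpa using hj))
  | succ j ih =>
    have hj' : ((n₁ + j : ℕ) : ℕ∞) ≤ T := le_trans (by exact_mod_cast (by omega)) hj
    have hg := hT _ hj (n₁ + j) (by omega)
    have hak := ha (n₁ + j)
    have ih' := ih hj'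
    rw [← add_assoc]
    rcases hstep (n₁ + j) (by omega) with ⟨h1, -, -⟩ | ⟨h1, -, -, h2⟩
    · rw [h1]
      refine le_min ?_ ((min_le_left _ _).trans (hγx.trans hxΔ))
      rcases min_le_iff.1 ih' with h | h
      · exact (min_le_left _ _).trans (by nlinarith)
      · refine (min_le_right _ _).trans ?_
        calc (1 + ((j + 1 : ℕ) : ℝ) * (c.γup - 1)) * y
            ≤ (c.γup * (1 + j * (c.γup - 1))) * y := by
              gcongr
              push_cast
              have : 0 ≤ (j : ℝ) * (c.γup - 1) ^ 2 := by positivity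
              nlinarith
          _ ≤ c.γup * a (n₁ + j) := by nlinarith
    · rw [h1]
      have h3 := h2 (hbig _ (by omega) hj')
      refine (min_le_left _ _).trans (mul_le_mul_of_nonneg_left ?_ c.γlow_pos.le)
      by_contra! hcon
      nlinarith [c.C₃_pos]

/-- After `O(1 / x)` steps the radius stays above a multiple of `x = ε / (2 C₃)`. -/
theorem exists_radius_ge_linear (ha : ∀ k, 0 < a k) (hstep : ∀ k, K ≤ k → StepOK c a φ g k)
    (hT : ∀ n : ℕ, (n : ℕ∞) ≤ T → ∀ k < n, ε < g k) {x : ℝ} (hx0 : 0 < x) (hx1 : x ≤ 1)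
    (hxε : ε = 2 * c.C₃ * x) (hxa : x ≤ a K) (hxΔ : x ≤ c.Δmax) :
    ∃ n₂ : ℕ, K ≤ n₂ ∧ (∀ k, n₂ ≤ k → (k : ℕ∞) ≤ T → c.γlow * x ≤ a k) ∧
      (n₂ : ℝ) ≤ ((K + 2) + (c.γlow ^ (-(1 / 2 : ℝ)) + c.γlow⁻¹ * (c.γlow / (c.γup - 1)))) *
        x ^ (-(1 : ℝ)) := by
  have hγlow := c.γlow_pos
  have hγup := c.one_lt_γup
  have hτ0 := c.τ_pos
  have hτ2 := c.τ_le
  have h1τ : 0 < 1 - c.τ := by linarith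
  have hpow : ∀ u v : ℝ, u ≤ v → x ^ (-u) ≤ x ^ (-v) := fun u v huv =>
    Real.rpow_le_rpow_of_exponent_ge hx0 hx1 (by linarith)
  have hlow := radius_ge_rpow ha hstep hT hx0 hx1 hxε hxa hxΔ
  set b := 1 / (1 - c.τ) with hb
  have hb2 : b ≤ 2 := by rw [hb, div_le_iff₀ h1τ]; linarith
  set y := c.γlow * x ^ b with hy
  have hxb0 : 0 < x ^ b := Real.rpow_pos_of_pos hx0 _
  have hy0 : 0 < y := by positivity
  set n₁ := max K ⌈y ^ (-(1 / 2 : ℝ))⌉₊ with hn₁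
  have hn₁K : K ≤ n₁ := le_max_left _ _
  have hbig : ∀ k, n₁ ≤ k → (k : ℕ∞) ≤ T → 1 / (k : ℝ) ^ 2 ≤ a k := by
    intro k hk hkT
    refine le_trans ?_ (hlow k (hn₁K.trans hk) hkT)
    have h1 : y ^ (-(1 / 2 : ℝ)) ≤ k :=
      (Nat.le_ceil _).trans (by exact_mod_cast (le_max_right _ _).trans hk)
    have h2 : 0 < y ^ (-(1 / 2 : ℝ)) := Real.rpow_pos_of_pos hy0 _
    rw [one_div, inv_le_comm₀ (by nlinarith) hy0]
    calc y⁻¹ = (y ^ (-(1 / 2 : ℝ))) ^ 2 := by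
          rw [← Real.rpow_natCast, ← Real.rpow_mul hy0.le, ← Real.rpow_neg_one]
          norm_num
      _ ≤ (k : ℝ) ^ 2 := by gcongr
  set n₂ := n₁ + ⌈c.γlow * x / (y * (c.γup - 1))⌉₊ with hn₂
  have hlin : ∀ k, n₂ ≤ k → (k : ℕ∞) ≤ T → c.γlow * x ≤ a k := by
    intro k hk hkT
    obtain ⟨j, rfl⟩ := Nat.exists_eq_add_of_le ((Nat.le_add_right _ _).trans hk : n₁ ≤ k)
    have h := radius_ge_linear ha hstep hT hx0 hy0 hxε hxΔ hn₁K
      (fun k hk => hlow k (hn₁K.trans hk)) hbig j hkT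
    refine le_trans (le_min le_rfl ?_) h
    have h1 : c.γlow * x / (y * (c.γup - 1)) ≤ j :=
      (Nat.le_ceil _).trans (by exact_mod_cast (by omega))
    rw [div_le_iff₀ (mul_pos hy0 (by linarith))] at h1
    nlinarith
  refine ⟨n₂, by omega, hlin, ?_⟩
  have h1 : (n₁ : ℝ) ≤ K + (y ^ (-(1 / 2 : ℝ)) + 1) := by
    have h2 : n₁ ≤ K + ⌈y ^ (-(1 / 2 : ℝ))⌉₊ := by omega
    have h3 := (Nat.ceil_lt_add_one (Real.rpow_pos_of_pos hy0 (-(1 / 2 : ℝ))).le).le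
    have h4 : (n₁ : ℝ) ≤ K + (⌈y ^ (-(1 / 2 : ℝ))⌉₊ : ℝ) := by exact_mod_cast h2
    linarith
  have h2 : (n₂ : ℝ) ≤ n₁ + (c.γlow * x / (y * (c.γup - 1)) + 1) := by
    rw [hn₂]; push_cast
    have h3 : 0 ≤ c.γlow * x / (y * (c.γup - 1)) :=
      div_nonneg (by positivity) (mul_nonneg hy0.le (by linarith))
    linarith [(Nat.ceil_lt_add_one h3).le]
  have h3 : y ^ (-(1 / 2 : ℝ)) ≤ c.γlow ^ (-(1 / 2 : ℝ)) * x ^ (-(1 : ℝ)) := by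
    rw [hy, Real.mul_rpow hγlow.le hxb0.le, ← Real.rpow_mul hx0.le]
    refine mul_le_mul_of_nonneg_left ?_ (Real.rpow_pos_of_pos hγlow _).le
    rw [mul_neg]
    exact hpow _ _ (by linarith)
  have h4 : c.γlow * x / (y * (c.γup - 1)) ≤
      c.γlow⁻¹ * (c.γlow / (c.γup - 1)) * x ^ (-(1 : ℝ)) := by
    have h5 : x / x ^ b ≤ x ^ (-(1 : ℝ)) := by
      calc x / x ^ b = x ^ (-(b - 1)) := by
            rw [neg_sub, Real.rpow_sub hx0, Real.rpow_one]
        _ ≤ _ := hpow _ _ (by linarith)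
    have h6 : 0 < c.γup - 1 := by linarith
    calc c.γlow * x / (y * (c.γup - 1)) = c.γlow⁻¹ * (c.γlow / (c.γup - 1)) * (x / x ^ b) := by
          rw [hy]; field_simp
      _ ≤ _ := by gcongr
  have h5 := hpow 0 1 zero_le_one
  rw [neg_zero, Real.rpow_zero] at h5
  have h6 : (K : ℝ) + 2 ≤ (K + 2) * x ^ (-(1 : ℝ)) := le_mul_of_one_le_right (by positivity) h5
  rw [add_mul, add_mul]
  linarith

/-- The number of steps until the gradient falls below `ε` is `O(1 / ε ^ 2)`, as the squared radii
are summable. -/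
theorem steps_le {S C₆ x : ℝ} {n₂ n : ℕ} (hS0 : 0 ≤ S)
    (hS : ∀ n, ∑ k ∈ Finset.Ico K n, a k ^ 2 ≤ S) (hx0 : 0 < x) (hx1 : x ≤ 1) (hC₆0 : 0 ≤ C₆)
    (hKn₂ : K ≤ n₂) (hlin : ∀ k, n₂ ≤ k → (k : ℕ∞) ≤ T → c.γlow * x ≤ a k)
    (hn₂le : (n₂ : ℝ) ≤ C₆ * x ^ (-(1 : ℝ))) (hn : (n : ℕ∞) ≤ T) :
    (n : ℝ) + 1 ≤ (C₆ + S / c.γlow ^ 2 + 1) * x ^ (-(2 : ℝ)) := by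
  have hγlow := c.γlow_pos
  have h0 : (n : ℝ) ≤ n₂ + S / (c.γlow * x) ^ 2 := by
    rcases le_total n n₂ with h | h
    · have h1 : (n : ℝ) ≤ n₂ := by exact_mod_cast h
      have : 0 ≤ S / (c.γlow * x) ^ 2 := by positivity
      linarith
    · have h1 : ((n : ℝ) - n₂) * (c.γlow * x) ^ 2 ≤ S := by
        calc ((n : ℝ) - n₂) * (c.γlow * x) ^ 2 = ∑ k ∈ Finset.Ico n₂ n, (c.γlow * x) ^ 2 := by
              simp [Nat.cast_sub h]
          _ ≤ ∑ k ∈ Finset.Ico n₂ n, a k ^ 2 := by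
              refine Finset.sum_le_sum fun k hk => ?_
              rw [Finset.mem_Ico] at hk
              have := hlin k hk.1 (le_trans (by exact_mod_cast hk.2.le) hn)
              gcongr
          _ ≤ ∑ k ∈ Finset.Ico K n, a k ^ 2 := by
              refine Finset.sum_le_sum_of_subset_of_nonneg
                (Finset.Ico_subset_Ico_left hKn₂) fun _ _ _ => sq_nonneg _
          _ ≤ S := hS n
      have h2 : (n : ℝ) - n₂ ≤ S / (c.γlow * x) ^ 2 := by
        rwa [le_div_iff₀ (by positivity)]
      linarith
  have h1 : S / (c.γlow * x) ^ 2 = S / c.γlow ^ 2 * x ^ (-(2 : ℝ)) := by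
    rw [Real.rpow_neg hx0.le, Real.rpow_two]; field_simp
  have h2 : C₆ * x ^ (-(1 : ℝ)) ≤ C₆ * x ^ (-(2 : ℝ)) := by
    exact mul_le_mul_of_nonneg_left
      (Real.rpow_le_rpow_of_exponent_ge hx0 hx1 (by norm_num)) hC₆0
  have h3 := Real.one_le_rpow_of_pos_of_le_one_of_nonpos hx0 hx1 (by norm_num : -(2 : ℝ) ≤ 0)
  rw [add_mul, add_mul, one_mul]
  linarith

/-- The evaluations of a trajectory whose radius is at least `γlow * x ^ b` in the first `n₂` steps
and at least `γlow * x` afterwards. -/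
theorem sum_evaluations_le (ha : ∀ k, 0 < a k) {N : ℕ → ℝ≥0∞} {C₄ C₆ C₇ s γ b x : ℝ}
    {n₂ : ℕ} (hC₄ : 0 < C₄)
    (hC₆0 : 0 < C₆) (hC₇0 : 0 < C₇) (hs : 0 ≤ s) (hγ : 0 < γ)
    (hN : ∀ k, K ≤ k → N k ≤ ENNReal.ofReal (C₄ * (k : ℝ) ^ s * a k ^ (-(2 * γ)))) (hx0 : 0 < x)
    (hlow : ∀ k, K ≤ k → (k : ℕ∞) ≤ T → c.γlow * x ^ b ≤ a k)
    (hlin : ∀ k, n₂ ≤ k → (k : ℕ∞) ≤ T → c.γlow * x ≤ a k)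
    (hn₂le : (n₂ : ℝ) ≤ C₆ * x ^ (-(1 : ℝ)))
    (hTle : ∀ n : ℕ, (n : ℕ∞) ≤ T → (n : ℝ) + 1 ≤ C₇ * x ^ (-(2 : ℝ))) :
    ∑' k : ℕ, (if (k : ℕ∞) ≤ T then N k else 0) ≤ (∑ k ∈ Finset.range K, N k) +
      (ENNReal.ofReal (C₆ * x ^ (-(1 : ℝ)) *
          (C₄ * (C₆ * x ^ (-(1 : ℝ))) ^ s * (c.γlow * x ^ b) ^ (-(2 * γ)))) +
        ENNReal.ofReal (C₇ * x ^ (-(2 : ℝ)) *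
          (C₄ * (C₇ * x ^ (-(2 : ℝ))) ^ s * (c.γlow * x) ^ (-(2 * γ))))) := by
  have hγlow := c.γlow_pos
  set y := c.γlow * x ^ b with hy
  have hxb0 : 0 < x ^ b := Real.rpow_pos_of_pos hx0 _
  have hy0 : 0 < y := by positivity
  -- The number of evaluations in the early steps, and in the remaining ones.
  set X := C₄ * (C₆ * x ^ (-(1 : ℝ))) ^ s * y ^ (-(2 * γ)) with hX
  set Y := C₄ * (C₇ * x ^ (-(2 : ℝ))) ^ s * (c.γlow * x) ^ (-(2 * γ)) with hY
  have hX0 : 0 ≤ X := by positivity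
  have hY0 : 0 ≤ Y := by positivity
  set B := ⌊C₇ * x ^ (-(2 : ℝ))⌋₊ with hB
  have hterm : ∀ k : ℕ, (if (k : ℕ∞) ≤ T then N k else 0) ≤
      (if k < K then N k else 0) + ((if k < n₂ then ENNReal.ofReal X else 0) +
        (if k < B then ENNReal.ofReal Y else 0)) := by
    intro k
    split_ifs with hkT hkK hk₂ hkB hkB hk₂ hkB hkB <;> try exact zero_le
    · exact le_self_add
    · exact le_self_add
    · exact le_self_add
    · exact le_self_add
    · rw [zero_add]
      refine le_trans ?_ le_self_add
      push Not at hkK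
      have hak := ha k
      refine (hN k hkK).trans (ENNReal.ofReal_le_ofReal ?_)
      have h1 : (k : ℝ) ≤ C₆ * x ^ (-(1 : ℝ)) := le_trans (by exact_mod_cast hk₂.le) hn₂le
      have h2 := Real.rpow_le_rpow_of_nonpos hy0 (hlow k hkK hkT) (by linarith : -(2 * γ) ≤ 0)
      rw [hX]
      gcongr
    · rw [zero_add]
      refine le_trans ?_ le_self_add
      push Not at hkK
      have hak := ha k
      refine (hN k hkK).trans (ENNReal.ofReal_le_ofReal ?_)
      have h1 : (k : ℝ) ≤ C₆ * x ^ (-(1 : ℝ)) := le_trans (by exact_mod_cast hk₂.le) hn₂le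
      have h2 := Real.rpow_le_rpow_of_nonpos hy0 (hlow k hkK hkT) (by linarith : -(2 * γ) ≤ 0)
      rw [hX]
      gcongr
    · rw [zero_add, zero_add]
      push Not at hkK hk₂
      have hak := ha k
      refine (hN k hkK).trans (ENNReal.ofReal_le_ofReal ?_)
      have h1 : (k : ℝ) ≤ C₇ * x ^ (-(2 : ℝ)) := by linarith [hTle k hkT]
      have h2 := Real.rpow_le_rpow_of_nonpos (by positivity) (hlin k hk₂ hkT)
        (by linarith : -(2 * γ) ≤ 0)
      rw [hY]
      gcongr
    · exfalso
      refine hkB ?_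
      rw [hB]
      have h1 := hTle k hkT
      have h2 : k + 1 ≤ ⌊C₇ * x ^ (-(2 : ℝ))⌋₊ := Nat.le_floor (by exact_mod_cast h1)
      omega
  calc ∑' k : ℕ, (if (k : ℕ∞) ≤ T then N k else 0)
      ≤ ∑' k : ℕ, ((if k < K then N k else 0) + ((if k < n₂ then ENNReal.ofReal X else 0) +
        (if k < B then ENNReal.ofReal Y else 0))) := ENNReal.tsum_le_tsum hterm
    _ = (∑ k ∈ Finset.range K, N k) + (n₂ * ENNReal.ofReal X + B * ENNReal.ofReal Y) := by
        rw [ENNReal.tsum_add, ENNReal.tsum_add, tsum_ite_lt_const, tsum_ite_lt_const,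
          tsum_eq_sum (s := Finset.range K) fun k hk => if_neg (by simpa using hk),
          Finset.sum_congr rfl fun k hk => if_pos (Finset.mem_range.1 hk)]
    _ ≤ _ := by
        have hBle : (B : ℝ) ≤ C₇ * x ^ (-(2 : ℝ)) := Nat.floor_le (by positivity)
        rw [← ENNReal.ofReal_natCast n₂, ← ENNReal.ofReal_natCast B,
          ← ENNReal.ofReal_mul (Nat.cast_nonneg _), ← ENNReal.ofReal_mul (Nat.cast_nonneg _)]
        gcongr

end Trajectory

/-- A trajectory of steps satisfying `StepOK` from some index on, with `O(k ^ s a_k ^ (-2 γ))`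
evaluations in step `k`, uses `O(ε ^ (-(2 s + 2 + 2 γ)))` evaluations until the gradient falls
below `ε`. The `O(1 / ε)` steps in which the radius may be smaller than a multiple of `ε` are few
enough not to matter. -/
theorem exists_sum_evaluations_le {c : StepConsts} {a φ g : ℕ → ℝ} {N : ℕ → ℝ≥0∞} {K : ℕ}
    (hK : 1 ≤ K) (ha : ∀ k, 0 < a k) {φmin : ℝ} (hφ : ∀ k, φmin ≤ φ k)
    (hstep : ∀ k, K ≤ k → StepOK c a φ g k) {C₄ s γ : ℝ} (hC₄ : 0 < C₄) (hs : 0 ≤ s) (hγ : 0 < γ)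
    (hτ : 4 * γ * c.τ ≤ 1 + s)
    (hN : ∀ k, K ≤ k → N k ≤ ENNReal.ofReal (C₄ * (k : ℝ) ^ s * a k ^ (-(2 * γ))))
    (hNfin : ∀ k, N k ≠ ∞) :
    ∃ C > 0, ∃ ε₀ > 0, ∀ ε : ℝ, 0 < ε → ε ≤ ε₀ → ∀ T : ℕ∞,
      (∀ n : ℕ, (n : ℕ∞) ≤ T → ∀ k < n, ε < g k) →
      ∑' k : ℕ, (if (k : ℕ∞) ≤ T then N k else 0) ≤
        ENNReal.ofReal (C * ε ^ (-(2 * s + 2 + 2 * γ))) := by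
  obtain ⟨S, hS0, hS⟩ := exists_sum_sq_radius_le hK ha hφ hstep
  have hC₃ := c.C₃_pos
  have hγlow := c.γlow_pos
  have hγup := c.one_lt_γup
  have hτ0 := c.τ_pos
  have hτ2 := c.τ_le
  have h1τ : 0 < 1 - c.τ := by linarith
  set b := 1 / (1 - c.τ) with hb
  have hb1 : 1 ≤ b := by rw [hb, le_div_iff₀ h1τ]; linarith
  have hb2 : b ≤ 2 := by rw [hb, div_le_iff₀ h1τ]; linarith
  have hbτ : b ≤ 1 + 2 * c.τ := by rw [hb, div_le_iff₀ h1τ]; nlinarith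
  have hγb : 2 * γ * b ≤ 2 * γ + (1 + s) := by nlinarith
  set C₆ : ℝ := (K + 2) + (c.γlow ^ (-(1 / 2 : ℝ)) + c.γlow⁻¹ * (c.γlow / (c.γup - 1))) with hC₆
  have hC₆0 : 0 < C₆ := by
    have h1 : 0 < c.γup - 1 := by linarith
    have h2 : 0 < c.γlow ^ (-(1 / 2 : ℝ)) := Real.rpow_pos_of_pos hγlow _
    rw [hC₆]; positivity
  set C₇ : ℝ := C₆ + S / c.γlow ^ 2 + 1 with hC₇
  have hC₇0 : 0 < C₇ := by rw [hC₇]; positivity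
  set C₀ : ℝ := (∑ k ∈ Finset.range K, N k).toReal with hC₀
  have hC₀0 : 0 ≤ C₀ := ENNReal.toReal_nonneg
  set C₈ : ℝ := C₀ + C₆ * (C₄ * C₆ ^ s * c.γlow ^ (-(2 * γ))) +
    C₇ * (C₄ * C₇ ^ s * c.γlow ^ (-(2 * γ))) + 1 with hC₈
  have hC₈0 : 0 < C₈ := by rw [hC₈]; positivity
  set e := 2 * s + 2 + 2 * γ with he
  refine ⟨C₈ * (2 * c.C₃) ^ e, by positivity,
    2 * c.C₃ * min 1 (min (a K) c.Δmax), ?_, fun ε hε hεle T hT => ?_⟩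
  · have := lt_min one_pos (lt_min (ha K) c.Δmax_pos)
    positivity
  set x := ε / (2 * c.C₃) with hx
  have hx0 : 0 < x := by positivity
  have hxε : ε = 2 * c.C₃ * x := by rw [hx]; field_simp
  have hxle : x ≤ min 1 (min (a K) c.Δmax) := by
    rw [hx, div_le_iff₀ (by positivity), mul_comm]; exact hεle
  have hx1 : x ≤ 1 := hxle.trans (min_le_left _ _)
  have hxa : x ≤ a K := hxle.trans ((min_le_right _ _).trans (min_le_left _ _))
  have hxΔ : x ≤ c.Δmax := hxle.trans ((min_le_right _ _).trans (min_le_right _ _))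
  have hpow : ∀ u v : ℝ, u ≤ v → x ^ (-u) ≤ x ^ (-v) := fun u v huv =>
    Real.rpow_le_rpow_of_exponent_ge hx0 hx1 (by linarith)
  have hxb0 : 0 < x ^ b := Real.rpow_pos_of_pos hx0 _
  have hlow := radius_ge_rpow ha hstep hT hx0 hx1 hxε hxa hxΔ
  obtain ⟨n₂, hKn₂, hlin, hn₂le⟩ := exists_radius_ge_linear ha hstep hT hx0 hx1 hxε hxa hxΔ
  rw [← hC₆] at hn₂le
  have hTle : ∀ n : ℕ, (n : ℕ∞) ≤ T → (n : ℝ) + 1 ≤ C₇ * x ^ (-(2 : ℝ)) := fun n hn =>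
    steps_le hS0 hS hx0 hx1 hC₆0.le hKn₂ hlin hn₂le hn
  have h1 : C₆ * x ^ (-(1 : ℝ)) *
      (C₄ * (C₆ * x ^ (-(1 : ℝ))) ^ s * (c.γlow * x ^ b) ^ (-(2 * γ))) ≤
      C₆ * (C₄ * C₆ ^ s * c.γlow ^ (-(2 * γ))) * x ^ (-e) := by
    have h4 : x ^ (-(1 : ℝ)) * x ^ (-(s + 2 * γ * b)) ≤ x ^ (-e) := by
      rw [← Real.rpow_add hx0, ← neg_add]
      exact hpow _ _ (by rw [he]; linarith)
    rw [Real.mul_rpow hC₆0.le (Real.rpow_pos_of_pos hx0 _).le,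
      Real.mul_rpow hγlow.le hxb0.le, ← Real.rpow_mul hx0.le, ← Real.rpow_mul hx0.le]
    rw [show -(s + 2 * γ * b) = -1 * s + b * -(2 * γ) by ring, Real.rpow_add hx0] at h4
    calc _ = C₆ * (C₄ * C₆ ^ s * c.γlow ^ (-(2 * γ))) *
          (x ^ (-(1 : ℝ)) * (x ^ (-1 * s) * x ^ (b * -(2 * γ)))) := by ring
      _ ≤ _ := by gcongr
  have h2 : C₇ * x ^ (-(2 : ℝ)) *
      (C₄ * (C₇ * x ^ (-(2 : ℝ))) ^ s * (c.γlow * x) ^ (-(2 * γ))) =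
      C₇ * (C₄ * C₇ ^ s * c.γlow ^ (-(2 * γ))) * x ^ (-e) := by
    rw [Real.mul_rpow hC₇0.le (Real.rpow_pos_of_pos hx0 _).le,
      Real.mul_rpow hγlow.le hx0.le, ← Real.rpow_mul hx0.le]
    rw [show -e = -2 + (-2 * s + -(2 * γ)) by rw [he]; ring, Real.rpow_add hx0, Real.rpow_add hx0]
    ring
  have h3 : 1 ≤ x ^ (-e) :=
    Real.one_le_rpow_of_pos_of_le_one_of_nonpos hx0 hx1 (by rw [he]; linarith)
  have h4 : C₀ ≤ C₀ * x ^ (-e) := le_mul_of_one_le_right hC₀0 h3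
  refine (sum_evaluations_le ha hC₄ hC₆0 hC₇0 hs hγ hN hx0 hlow hlin hn₂le hTle).trans ?_
  rw [← ENNReal.ofReal_toReal (ENNReal.sum_ne_top.2 fun k _ => hNfin k :
      ∑ k ∈ Finset.range K, N k ≠ ∞), ← hC₀, ← ENNReal.ofReal_add (by positivity) (by positivity),
    ← ENNReal.ofReal_add hC₀0 (by positivity)]
  refine ENNReal.ofReal_le_ofReal ?_
  have h5 : C₈ * (2 * c.C₃) ^ e * ε ^ (-e) = C₈ * x ^ (-e) := by
    rw [hxε, Real.mul_rpow (by positivity) hx0.le, mul_assoc,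
      ← mul_assoc ((2 * c.C₃) ^ e), ← Real.rpow_add (by positivity)]
    simp
  have h6 : C₈ * x ^ (-e) = C₀ * x ^ (-e) +
      C₆ * (C₄ * C₆ ^ s * c.γlow ^ (-(2 * γ))) * x ^ (-e) +
      C₇ * (C₄ * C₇ ^ s * c.γlow ^ (-(2 * γ))) * x ^ (-e) + x ^ (-e) := by rw [hC₈]; ring
  rw [h5, h6]
  linarith

/-! ### One trust-region step -/

section Model

variable {d : ℕ}

/-- The linear coefficients of a model, as a vector. -/
def modelGrad (β : DesignIdx d → ℝ) : Dec d := WithLp.toLp 2 fun j => β (Sum.inr (Sum.inl j))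

theorem dqModel_eq (θ : Dec d) (β : DesignIdx d → ℝ) (x : Dec d) :
    dqModel θ β x = β (Sum.inl ()) + inner ℝ (modelGrad β) (x - θ) +
      ∑ j, β (Sum.inr (Sum.inr j)) * ((x j - θ j) ^ 2 / 2) := by
  simp only [dqModel, Fintype.sum_sum_type, Finset.univ_unique, PUnit.default_eq_unit,
    Finset.sum_singleton, dqBasis, mul_one, modelGrad, PiLp.inner_apply, PiLp.sub_apply]
  simp only [RCLike.inner_apply, conj_trivial]
  rw [add_assoc]
  congr 2
  exact Finset.sum_congr rfl fun j _ => mul_comm _ _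

theorem dqModel_center (θ : Dec d) (β : DesignIdx d → ℝ) :
    dqModel θ β θ = β (Sum.inl ()) := by
  simp [dqModel_eq]

theorem gradient_dqModel (θ : Dec d) (β : DesignIdx d → ℝ) :
    gradient (dqModel θ β) θ = modelGrad β := by
  refine HasGradientAt.gradient ?_
  rw [hasGradientAt_iff_hasFDerivAt]
  have h1 : HasFDerivAt (fun x : Dec d => inner ℝ (modelGrad β) (x - θ))
      (InnerProductSpace.toDual ℝ (Dec d) (modelGrad β)) θ := by
    have h := (InnerProductSpace.toDual ℝ (Dec d) (modelGrad β)).hasFDerivAt.comp θ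
      ((hasFDerivAt_id θ).sub_const θ)
    simpa [Function.comp_def] using h
  have h2 : ∀ j, HasFDerivAt (fun x : Dec d => β (Sum.inr (Sum.inr j)) * ((x j - θ j) ^ 2 / 2))
      (0 : Dec d →L[ℝ] ℝ) θ := by
    intro j
    have h3 : HasFDerivAt (fun x : Dec d => x j - θ j)
        (EuclideanSpace.proj j : Dec d →L[ℝ] ℝ) θ :=
      ((EuclideanSpace.proj j : Dec d →L[ℝ] ℝ).hasFDerivAt).sub_const _
    have h4 := ((h3.pow 2).mul_const (1 / 2)).const_mul (β (Sum.inr (Sum.inr j)))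
    refine (h4.congr_fderiv ?_).congr_of_eventuallyEq (Filter.Eventually.of_forall fun x => ?_)
    · simp
    · simp [div_eq_mul_inv]
  have h3 := (h1.const_add (β (Sum.inl ()))).add (HasFDerivAt.fun_sum (u := Finset.univ)
    fun j _ => h2 j)
  simp only [Finset.sum_const_zero, add_zero] at h3
  refine h3.congr_of_eventuallyEq (Filter.Eventually.of_forall fun x => ?_)
  simp only [dqModel_eq, Pi.add_apply]

theorem norm_sq_eq_sum (x : Dec d) : ‖x‖ ^ 2 = ∑ j, x j ^ 2 := by
  rw [EuclideanSpace.norm_sq_eq]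
  simp

theorem norm_le_card_mul {x : Dec d} {C : ℝ} (hC : 0 ≤ C) (h : ∀ j, |x j| ≤ C) :
    ‖x‖ ≤ d * C := by
  have h1 : ‖x‖ ^ 2 ≤ d * C ^ 2 := by
    rw [norm_sq_eq_sum]
    calc ∑ j, x j ^ 2 ≤ ∑ _j : Fin d, C ^ 2 :=
          Finset.sum_le_sum fun j _ => by rw [← sq_abs]; gcongr; exact h j
      _ = d * C ^ 2 := by simp
  refine abs_le_of_sq_le_sq' ?_ (by positivity) |>.2
  refine h1.trans ?_
  rw [mul_pow]
  gcongr
  rcases Nat.eq_zero_or_pos d with rfl | hd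
  · simp
  · have : (1 : ℝ) ≤ d := by exact_mod_cast hd
    nlinarith

/-- The quadratic part of the model is bounded by its largest coefficient. -/
theorem abs_quadratic_le {β : DesignIdx d → ℝ} {H : ℝ} (h : ∀ j, |β (Sum.inr (Sum.inr j))| ≤ H)
    (θ x : Dec d) :
    |∑ j, β (Sum.inr (Sum.inr j)) * ((x j - θ j) ^ 2 / 2)| ≤ H / 2 * ‖x - θ‖ ^ 2 := by
  rw [norm_sq_eq_sum, Finset.mul_sum]
  refine (Finset.abs_sum_le_sum_abs _ _).trans (Finset.sum_le_sum fun j _ => ?_)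
  rw [abs_mul, abs_of_nonneg (by positivity : (0 : ℝ) ≤ (x j - θ j) ^ 2 / 2), PiLp.sub_apply]
  have := mul_le_mul_of_nonneg_right (h j) (by positivity : (0 : ℝ) ≤ (x j - θ j) ^ 2 / 2)
  linarith

/-- Decrease of the model along the steepest descent direction. -/
theorem cauchy_decrease {β : DesignIdx d → ℝ} {H : ℝ} (hH0 : 0 ≤ H)
    (h : ∀ j, |β (Sum.inr (Sum.inr j))| ≤ H) {θ θs : Dec d} {Δ : ℝ}
    (hmin : IsMinOn (dqModel θ β) (Metric.closedBall θ Δ) θs) {t : ℝ} (ht0 : 0 ≤ t) (ht : t ≤ Δ) :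
    ‖modelGrad β‖ * t - H / 2 * t ^ 2 ≤ dqModel θ β θ - dqModel θ β θs := by
  set g := modelGrad β with hg
  set x : Dec d := θ - (t / ‖g‖) • g with hx
  have hxθ : x - θ = -((t / ‖g‖) • g) := by rw [hx]; abel
  have hnorm : ‖x - θ‖ ≤ t := by
    rw [hxθ, norm_neg, norm_smul, norm_div, norm_norm, Real.norm_of_nonneg ht0]
    rcases eq_or_ne ‖g‖ 0 with h0 | h0
    · simpa [h0] using ht0
    · rw [div_mul_cancel₀ _ h0]
  have hmem : x ∈ Metric.closedBall θ Δ := by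
    rw [Metric.mem_closedBall, dist_eq_norm]; exact hnorm.trans ht
  have h1 : dqModel θ β θs ≤ dqModel θ β x := hmin hmem
  have h2 := abs_le.1 (abs_quadratic_le h θ x)
  have h3 : inner ℝ g (x - θ) = -(‖g‖ * t) := by
    rw [hxθ, inner_neg_right, inner_smul_right, real_inner_self_eq_norm_sq]
    rcases eq_or_ne ‖g‖ 0 with h0 | h0
    · simp [h0]
    · field_simp
  have h4 : H / 2 * ‖x - θ‖ ^ 2 ≤ H / 2 * t ^ 2 := by gcongr
  rw [dqModel_center]
  rw [dqModel_eq θ β x, ← hg, h3] at h1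
  linarith [h2.2]

end Model

section Step

variable {d : ℕ} {f : Dec d → ℝ} {θ : Dec d} {Δ L ζ : ℝ}

/-- First-order Taylor expansion of a function with Lipschitz gradient on a ball. -/
theorem abs_sub_taylor_le (hL : 0 ≤ L)
    (hd : ∀ x ∈ Metric.closedBall θ Δ, DifferentiableAt ℝ f x)
    (hlip : ∀ x ∈ Metric.closedBall θ Δ, ‖gradient f x - gradient f θ‖ ≤ L * ‖x - θ‖)
    {x : Dec d} (hx : x ∈ Metric.closedBall θ Δ) :
    |f x - f θ - inner ℝ (gradient f θ) (x - θ)| ≤ L * ‖x - θ‖ ^ 2 := by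
  set r := ‖x - θ‖ with hr
  have hsub : Metric.closedBall θ r ⊆ Metric.closedBall θ Δ := by
    refine Metric.closedBall_subset_closedBall ?_
    rwa [Metric.mem_closedBall, dist_eq_norm] at hx
  have h := (convex_closedBall θ r).norm_image_sub_le_of_norm_hasFDerivWithin_le'
    (f := f) (f' := fun z => fderiv ℝ f z) (φ := fderiv ℝ f θ) (C := L * r)
    (fun z hz => (hd z (hsub hz)).hasFDerivAt.hasFDerivWithinAt) (fun z hz => ?_)
    (Metric.mem_closedBall_self (norm_nonneg _))
    (show x ∈ Metric.closedBall θ r by rw [Metric.mem_closedBall, dist_eq_norm])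
  · have h1 : inner ℝ (gradient f θ) (x - θ) = fderiv ℝ f θ (x - θ) := by
      unfold gradient
      exact InnerProductSpace.toDual_symm_apply
    rw [h1, ← Real.norm_eq_abs]
    refine h.trans_eq ?_
    rw [← hr]; ring
  · have h1 : ‖fderiv ℝ f z - fderiv ℝ f θ‖ = ‖gradient f z - gradient f θ‖ := by
      unfold gradient
      rw [← map_sub, LinearIsometryEquiv.norm_map]
    rw [h1]
    refine (hlip z (hsub hz)).trans ?_
    rw [Metric.mem_closedBall, dist_eq_norm] at hz
    gcongr

theorem designPoint_mem_closedBall (hΔ : 0 ≤ Δ) (i : DesignIdx d) :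
    designPoint θ Δ i ∈ Metric.closedBall θ Δ := by
  rw [Metric.mem_closedBall, dist_eq_norm]
  rcases i with i | j | j
  · simpa [designPoint] using hΔ
  · simp [designPoint, norm_smul, abs_of_nonneg hΔ]
  · simp [designPoint, norm_smul, abs_of_nonneg hΔ]

theorem dqCoeff_interpolates (hΔ : 0 < Δ) (y : DesignIdx d → ℝ) :
    dqCoeff θ Δ y (Sum.inl ()) = y (Sum.inl ()) ∧ ∀ j,
      dqCoeff θ Δ y (Sum.inl ()) + Δ * dqCoeff θ Δ y (Sum.inr (Sum.inl j)) +
        Δ ^ 2 / 2 * dqCoeff θ Δ y (Sum.inr (Sum.inr j)) = y (Sum.inr (Sum.inl j)) ∧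
      dqCoeff θ Δ y (Sum.inl ()) - Δ * dqCoeff θ Δ y (Sum.inr (Sum.inl j)) +
        Δ ^ 2 / 2 * dqCoeff θ Δ y (Sum.inr (Sum.inr j)) = y (Sum.inr (Sum.inr j)) := by
  have h := (dqMatrix_mulVec_eq_iff θ hΔ.ne' y (dqCoeff θ Δ y)).2 rfl
  rw [dqMatrix_mulVec] at h
  exact ⟨congrFun h (Sum.inl ()), fun j =>
    ⟨congrFun h (Sum.inr (Sum.inl j)), congrFun h (Sum.inr (Sum.inr j))⟩⟩

theorem taylor_axis (hΔ : 0 ≤ Δ) (hL : 0 ≤ L)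
    (hd : ∀ x ∈ Metric.closedBall θ Δ, DifferentiableAt ℝ f x)
    (hlip : ∀ x ∈ Metric.closedBall θ Δ, ‖gradient f x - gradient f θ‖ ≤ L * ‖x - θ‖) (j : Fin d) :
    |f (designPoint θ Δ (Sum.inr (Sum.inl j))) - f θ - Δ * gradient f θ j| ≤ L * Δ ^ 2 ∧
      |f (designPoint θ Δ (Sum.inr (Sum.inr j))) - f θ + Δ * gradient f θ j| ≤ L * Δ ^ 2 := by
  have h1 := abs_sub_taylor_le hL hd hlip
    (designPoint_mem_closedBall (θ := θ) hΔ (Sum.inr (Sum.inl j)))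
  have h2 := abs_sub_taylor_le hL hd hlip
    (designPoint_mem_closedBall (θ := θ) hΔ (Sum.inr (Sum.inr j)))
  have h3 : designPoint θ Δ (Sum.inr (Sum.inl j)) - θ = Δ • EuclideanSpace.single j (1 : ℝ) := by
    simp [designPoint]
  have h4 : designPoint θ Δ (Sum.inr (Sum.inr j)) - θ =
      -(Δ • EuclideanSpace.single j (1 : ℝ)) := by
    simp [designPoint]
  have h5 : ‖Δ • EuclideanSpace.single j (1 : ℝ)‖ = Δ := by
    simp [norm_smul, abs_of_nonneg hΔ]
  have h6 : inner ℝ (gradient f θ) (Δ • EuclideanSpace.single j (1 : ℝ)) =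
      Δ * gradient f θ j := by
    rw [inner_smul_right, EuclideanSpace.inner_single_right]; simp
  rw [h3, h5, h6] at h1
  rw [h4, norm_neg, h5, inner_neg_right, h6, sub_neg_eq_add] at h2
  exact ⟨h1, h2⟩

/-- Accuracy of the interpolation model: its gradient is accurate to order `Δ`, and its curvature
is bounded, as soon as the interpolated values are accurate to order `Δ ^ 2`. -/
theorem model_accuracy (hΔ : 0 < Δ) (hL : 0 ≤ L) (hζ : 0 ≤ ζ)
    (hd : ∀ x ∈ Metric.closedBall θ Δ, DifferentiableAt ℝ f x)
    (hlip : ∀ x ∈ Metric.closedBall θ Δ, ‖gradient f x - gradient f θ‖ ≤ L * ‖x - θ‖)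
    {y : DesignIdx d → ℝ} (hy : ∀ i, |y i - f (designPoint θ Δ i)| ≤ ζ * Δ ^ 2) :
    ‖modelGrad (dqCoeff θ Δ y) - gradient f θ‖ ≤ d * ((L + ζ) * Δ) ∧
      ∀ j, |dqCoeff θ Δ y (Sum.inr (Sum.inr j))| ≤ 2 * L + 4 * ζ := by
  obtain ⟨hc, hpm⟩ := dqCoeff_interpolates (θ := θ) hΔ y
  have hΔ2 : 0 < Δ ^ 2 := by positivity
  have key : ∀ j, |dqCoeff θ Δ y (Sum.inr (Sum.inl j)) - gradient f θ j| ≤ (L + ζ) * Δ ∧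
      |dqCoeff θ Δ y (Sum.inr (Sum.inr j))| ≤ 2 * L + 4 * ζ := by
    intro j
    obtain ⟨hp, hm⟩ := hpm j
    obtain ⟨ht1, ht2⟩ := taylor_axis hΔ.le hL hd hlip j
    have h0 := abs_le.1 (hy (Sum.inl ()))
    have h1 := abs_le.1 (hy (Sum.inr (Sum.inl j)))
    have h2 := abs_le.1 (hy (Sum.inr (Sum.inr j)))
    have h0' : designPoint θ Δ (Sum.inl ()) = θ := rfl
    rw [h0'] at h0
    rw [abs_le] at ht1 ht2
    constructor
    · have h3 : Δ * |dqCoeff θ Δ y (Sum.inr (Sum.inl j)) - gradient f θ j| ≤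
          Δ * ((L + ζ) * Δ) := by
        rw [← abs_of_pos hΔ, ← abs_mul, abs_of_pos hΔ, abs_le]
        constructor <;> nlinarith
      exact le_of_mul_le_mul_left h3 hΔ
    · have h3 : Δ ^ 2 * |dqCoeff θ Δ y (Sum.inr (Sum.inr j))| ≤ Δ ^ 2 * (2 * L + 4 * ζ) := by
        rw [← abs_of_pos hΔ2, ← abs_mul, abs_of_pos hΔ2, abs_le]
        constructor <;> nlinarith
      exact le_of_mul_le_mul_left h3 hΔ2
  exact ⟨norm_le_card_mul (by positivity) fun j => (key j).1, fun j => (key j).2⟩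

/-- A trust-region step is accepted if the gradient is large compared with the radius. -/
theorem accept_of_large_gradient (hΔ : 0 < Δ) (hL : 0 ≤ L) (hζ : 0 ≤ ζ)
    (hd : ∀ x ∈ Metric.closedBall θ Δ, DifferentiableAt ℝ f x)
    (hlip : ∀ x ∈ Metric.closedBall θ Δ, ‖gradient f x - gradient f θ‖ ≤ L * ‖x - θ‖)
    {y : DesignIdx d → ℝ} (hy : ∀ i, |y i - f (designPoint θ Δ i)| ≤ ζ * Δ ^ 2)
    {θs : Dec d} (hθs : θs ∈ Metric.closedBall θ Δ)
    (hmin : IsMinOn (dqModel θ (dqCoeff θ Δ y)) (Metric.closedBall θ Δ) θs)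
    {ys : ℝ} (hys : |ys - f θs| ≤ ζ * Δ ^ 2) {η ηt : ℝ} (hη : η < 1) (hηt : 0 < ηt)
    (hbig : ((2 + d * (L + 1) + (L + 2) + L) / (1 - η) + (L + 2) + 1 / ηt + d * (L + 1)) *
      ((1 + ζ) * Δ) ≤ ‖gradient f θ‖) :
    η ≤ (y (Sum.inl ()) - ys) /
        (dqModel θ (dqCoeff θ Δ y) θ - dqModel θ (dqCoeff θ Δ y) θs) ∧
      Δ ≤ ηt * ‖modelGrad (dqCoeff θ Δ y)‖ := by
  obtain ⟨hg, hh⟩ := model_accuracy hΔ hL hζ hd hlip hy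
  obtain ⟨hc, -⟩ := dqCoeff_interpolates (θ := θ) hΔ y
  set β := dqCoeff θ Δ y with hβ
  set g := modelGrad β with hgdef
  set b := (1 + ζ) * Δ with hb
  have hb0 : 0 < b := by positivity
  have hη' : 0 < 1 - η := by linarith
  set Ca : ℝ := 2 + d * (L + 1) + (L + 2) + L with hCa
  have hCa0 : 0 < Ca := by positivity
  have hdb : (d : ℝ) * ((L + ζ) * Δ) ≤ d * (L + 1) * b := by
    rw [mul_assoc]
    refine mul_le_mul_of_nonneg_left ?_ (Nat.cast_nonneg _)
    rw [hb, ← mul_assoc]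
    refine mul_le_mul_of_nonneg_right ?_ hΔ.le
    nlinarith [mul_nonneg hL hζ]
  have hgn : (Ca / (1 - η) + (L + 2) + 1 / ηt) * b ≤ ‖g‖ := by
    have h1 : ‖gradient f θ‖ ≤ ‖g‖ + ‖g - gradient f θ‖ := by
      have := norm_sub_norm_le (gradient f θ) (gradient f θ - g)
      rw [sub_sub_cancel, norm_sub_rev (gradient f θ) g] at this
      linarith
    linarith
  have hpred := cauchy_decrease (by positivity : 0 ≤ 2 * L + 4 * ζ) hh hmin hΔ.le le_rfl
  rw [← hgdef] at hpred
  have hHb : (2 * L + 4 * ζ) / 2 * Δ ^ 2 ≤ (L + 2) * b * Δ := by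
    have h1 : (2 * L + 4 * ζ) / 2 ≤ (L + 2) * (1 + ζ) := by nlinarith [mul_nonneg hL hζ]
    calc (2 * L + 4 * ζ) / 2 * Δ ^ 2 ≤ (L + 2) * (1 + ζ) * Δ ^ 2 := by gcongr
      _ = _ := by rw [hb]; ring
  have hpred2 : Ca / (1 - η) * b * Δ ≤ dqModel θ β θ - dqModel θ β θs := by
    have h1 : 0 ≤ 1 / ηt * b * Δ := by positivity
    have h2 := mul_le_mul_of_nonneg_right hgn hΔ.le
    linarith
  have hpos : 0 < Ca / (1 - η) * b * Δ := by positivity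
  refine ⟨?_, ?_⟩
  · rw [le_div_iff₀ (hpos.trans_le hpred2)]
    -- The model value at the candidate differs from its estimate by a multiple of `b * Δ`.
    have hx : ‖θs - θ‖ ≤ Δ := by rwa [Metric.mem_closedBall, dist_eq_norm] at hθs
    have hx0 := norm_nonneg (θs - θ)
    have ht := abs_le.1 (abs_sub_taylor_le hL hd hlip hθs)
    have hq := abs_le.1 (abs_quadratic_le hh θ θs)
    have hin : |inner ℝ (g - gradient f θ) (θs - θ)| ≤ d * (L + 1) * b * Δ :=
      (abs_real_inner_le_norm _ _).trans
        (mul_le_mul (hg.trans hdb) hx hx0 (by positivity))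
    rw [inner_sub_left] at hin
    have hin' := abs_le.1 hin
    have h0 := abs_le.1 (hy (Sum.inl ()))
    have h0' : designPoint θ Δ (Sum.inl ()) = θ := rfl
    rw [h0', ← hc] at h0
    have hs' := abs_le.1 hys
    have hx2 : ‖θs - θ‖ ^ 2 ≤ Δ ^ 2 := by gcongr
    have hq2 : (2 * L + 4 * ζ) / 2 * ‖θs - θ‖ ^ 2 ≤ (L + 2) * b * Δ :=
      (mul_le_mul_of_nonneg_left hx2 (by positivity)).trans hHb
    have hbΔ : b * Δ = Δ ^ 2 + ζ * Δ ^ 2 := by rw [hb]; ring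
    have hΔ2 : 0 ≤ Δ ^ 2 := sq_nonneg _
    have hζ2 : 0 ≤ ζ * Δ ^ 2 := by positivity
    have hL2 : L * ‖θs - θ‖ ^ 2 ≤ L * (b * Δ) := by
      refine mul_le_mul_of_nonneg_left (hx2.trans ?_) hL
      linarith
    have hdiff : dqModel θ β θs - ys ≥ -(Ca * (b * Δ)) := by
      rw [dqModel_eq, ← hgdef, hCa]
      linarith
    have hcen : dqModel θ β θ = y (Sum.inl ()) := by rw [dqModel_center, hc]
    have h1 : Ca * (b * Δ) ≤ (1 - η) * (dqModel θ β θ - dqModel θ β θs) := by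
      have := mul_le_mul_of_nonneg_left hpred2 hη'.le
      calc Ca * (b * Δ) = (1 - η) * (Ca / (1 - η) * b * Δ) := by field_simp
        _ ≤ _ := this
    rw [← hcen]
    linarith
  · have h1 : 1 / ηt * b ≤ ‖g‖ := by
      refine le_trans ?_ hgn
      gcongr
      have : 0 ≤ Ca / (1 - η) := by positivity
      linarith
    have h2 : Δ ≤ b := by rw [hb]; nlinarith
    have h3 := mul_le_mul_of_nonneg_left h1 hηt.le
    rw [← mul_assoc, mul_one_div_cancel hηt.ne', one_mul] at h3
    linarith

/-- Decrease of the model in an accepted step, relative to the radius. -/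
theorem model_decrease_of_accept (hΔ : 0 < Δ) {H ηt : ℝ} (hH : 0 < H) (hηt : 0 < ηt)
    {β : DesignIdx d → ℝ} (hh : ∀ j, |β (Sum.inr (Sum.inr j))| ≤ H) {θs : Dec d}
    (hmin : IsMinOn (dqModel θ β) (Metric.closedBall θ Δ) θs) (hg : Δ ≤ ηt * ‖modelGrad β‖) :
    min 1 (1 / (ηt * H)) / (2 * ηt) * Δ ^ 2 ≤ dqModel θ β θ - dqModel θ β θs := by
  set ω := min 1 (1 / (ηt * H)) with hω
  have hω0 : 0 < ω := lt_min one_pos (by positivity)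
  have hω1 : ω ≤ 1 := min_le_left _ _
  have hωH : ω * H ≤ 1 / ηt := by
    have h1 : ω ≤ 1 / (ηt * H) := min_le_right _ _
    calc ω * H ≤ 1 / (ηt * H) * H := by gcongr
      _ = 1 / ηt := by field_simp
  have h := cauchy_decrease hH.le hh hmin (t := ω * Δ) (by positivity) (by nlinarith)
  refine le_trans ?_ h
  have hg' : Δ / ηt ≤ ‖modelGrad β‖ := by rw [div_le_iff₀ hηt, mul_comm]; exact hg
  have h1 : Δ / ηt * (ω * Δ) ≤ ‖modelGrad β‖ * (ω * Δ) := by gcongr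
  have h2 : H / 2 * (ω * Δ) ^ 2 ≤ 1 / ηt / 2 * ω * Δ ^ 2 := by
    calc H / 2 * (ω * Δ) ^ 2 = ω * H / 2 * ω * Δ ^ 2 := by ring
      _ ≤ _ := by gcongr
  have h3 : ω / (2 * ηt) * Δ ^ 2 = Δ / ηt * (ω * Δ) - 1 / ηt / 2 * ω * Δ ^ 2 := by
    field_simp; ring
  linarith

end Step

section Run

variable {d q : ℕ} (P : Problem d q) (A : Params d) (lam : ℕ → ℝ) (gam : ℝ)

/-- The estimate of the objective at the `i`-th point of an iteration. -/
def pointEstimate (k : ℕ) (θ : Dec d) (Δ : ℝ) (w : PointIdx d → ℕ → Draws q) (i : PointIdx d) : ℝ :=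
  adaptiveEstimate P A lam gam k (evalPoint P A lam gam k θ Δ w i) Δ (w i)

variable {P A lam gam}

theorem evalPoint_mem_closedBall (hA : A.Admissible) {k : ℕ} {θ : Dec d} {Δ : ℝ} (hΔ : 0 < Δ)
    (w : PointIdx d → ℕ → Draws q) (i : PointIdx d) :
    evalPoint P A lam gam k θ Δ w i ∈ Metric.closedBall θ Δ := by
  rcases i with _ | i
  · exact hA.solver_mem _ _ _ hΔ
  · exact designPoint_mem_closedBall hΔ.le i

theorem run_radius_pos (hA : A.Admissible) (v : SampleIdx d q → (Fin q → ℝ)) (k : ℕ) :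
    0 < (run P A lam gam v k).2 := by
  induction k with
  | zero => exact hA.Δ₀_pos
  | succ k ih =>
    simp only [run, iterate]
    split_ifs
    · exact lt_min (mul_pos (by linarith [hA.one_lt_γup]) ih) hA.Δmax_pos
    · exact mul_pos hA.γlow_pos ih

theorem run_radius_le (hA : A.Admissible) (v : SampleIdx d q → (Fin q → ℝ)) (k : ℕ) :
    (run P A lam gam v k).2 ≤ max A.Δ₀ A.Δmax := by
  induction k with
  | zero => exact le_max_left _ _
  | succ k ih =>
    have h0 := run_radius_pos (P := P) (lam := lam) (gam := gam) hA v k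
    simp only [run, iterate]
    split_ifs
    · exact (min_le_right _ _).trans (le_max_right _ _)
    · refine le_trans ?_ ih
      nlinarith [hA.γlow_lt_one]

/-- A step of the algorithm with estimation errors at most `Δ ^ (2 - τ)`, and at most `c₀ Δ ^ 2`
if `Δ ≥ 1 / k ^ 2`, satisfies `StepOK`. -/
theorem exists_stepOK (hA : A.Admissible) {L τ : ℝ} (hL : 0 ≤ L) (hτ0 : 0 < τ) (hτ : τ ≤ 1 / 2) :
    ∃ c : StepConsts, c.τ = τ ∧ ∃ c₀ > 0, ∀ (v : SampleIdx d q → (Fin q → ℝ)) (k : ℕ) (θ : Dec d)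
      (Δ : ℝ) (w : PointIdx d → ℕ → Draws q), run P A lam gam v k = (θ, Δ) → drawsAt v k = w →
      (∀ x ∈ Metric.closedBall θ Δ, DifferentiableAt ℝ P.f x) →
      (∀ x ∈ Metric.closedBall θ Δ, ‖gradient P.f x - gradient P.f θ‖ ≤ L * ‖x - θ‖) →
      (∀ i, |pointEstimate P A lam gam k θ Δ w i - P.f (evalPoint P A lam gam k θ Δ w i)| ≤
        Δ ^ (2 - τ)) →
      (1 / (k : ℝ) ^ 2 ≤ Δ → ∀ i,
        |pointEstimate P A lam gam k θ Δ w i - P.f (evalPoint P A lam gam k θ Δ w i)| ≤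
          c₀ * Δ ^ 2) →
      StepOK c (fun k => (run P A lam gam v k).2) (fun k => P.f (run P A lam gam v k).1)
        (fun k => ‖gradient P.f (run P A lam gam v k).1‖) k := by
  have hη0 := hA.η_pos
  have hη1 := hA.η_lt_one
  have hηt := hA.ηt_pos
  have h1η : 0 < 1 - A.η := by linarith
  set H : ℝ := 2 * L + 4 with hH
  have hH0 : 0 < H := by positivity
  set ω : ℝ := min 1 (1 / (A.ηt * H)) with hω
  have hω0 : 0 < ω := lt_min one_pos (by positivity)
  set p : ℝ := ω / (2 * A.ηt) with hp
  have hp0 : 0 < p := by positivity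
  set C : ℝ := (2 + d * (L + 1) + (L + 2) + L) / (1 - A.η) + (L + 2) + 1 / A.ηt + d * (L + 1)
    with hC
  have hC0 : 0 < C := by positivity
  set c₀ : ℝ := min 1 (A.η * p / 4) with hc₀
  have hc₀0 : 0 < c₀ := lt_min one_pos (by positivity)
  refine ⟨{ γup := A.γup, γlow := A.γlow, Δmax := A.Δmax, τ := τ, c₁ := A.η * p / 2, C₃ := 2 * C
            γlow_pos := hA.γlow_pos, γlow_lt_one := hA.γlow_lt_one, one_lt_γup := hA.one_lt_γup
            Δmax_pos := hA.Δmax_pos, τ_pos := hτ0, τ_le := hτ, c₁_pos := by positivity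
            C₃_pos := by positivity }, rfl, c₀, hc₀0, ?_⟩
  intro v k θ Δ w hrun hw hd hlip he1 he2
  have hΔ : 0 < Δ := by
    have := run_radius_pos (P := P) (lam := lam) (gam := gam) hA v k
    rwa [hrun] at this
  have hsucc : run P A lam gam v (k + 1) = iterate P A lam gam k (θ, Δ) w := by
    rw [← hrun, ← hw]; rfl
  set θs := evalPoint P A lam gam k θ Δ w none with hθs
  set y : DesignIdx d → ℝ := fun i => pointEstimate P A lam gam k θ Δ w (some i) with hy
  set ys := pointEstimate P A lam gam k θ Δ w none with hys
  have hmin : IsMinOn (dqModel θ (dqCoeff θ Δ y)) (Metric.closedBall θ Δ) θs :=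
    hA.solver_isMinOn _ _ _ hΔ
  have hmem : θs ∈ Metric.closedBall θ Δ := evalPoint_mem_closedBall hA hΔ w none
  have hacc : acceptanceRatio P A lam gam k θ Δ w = (y (Sum.inl ()) - ys) /
      (dqModel θ (dqCoeff θ Δ y) θ - dqModel θ (dqCoeff θ Δ y) θs) := rfl
  have hgrad : ‖gradient (dqModel θ (modelCoeff P A lam gam k θ Δ w)) θ‖ =
      ‖modelGrad (dqCoeff θ Δ y)‖ := by rw [gradient_dqModel]; rfl
  have hreject : ∀ ζ : ℝ, 0 ≤ ζ →
      (∀ i, |pointEstimate P A lam gam k θ Δ w i - P.f (evalPoint P A lam gam k θ Δ w i)| ≤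
        ζ * Δ ^ 2) →
      ¬ (A.η ≤ acceptanceRatio P A lam gam k θ Δ w ∧
        Δ ≤ A.ηt * ‖gradient (dqModel θ (modelCoeff P A lam gam k θ Δ w)) θ‖) →
      ‖gradient P.f θ‖ ≤ C * ((1 + ζ) * Δ) := by
    intro ζ hζ he hna
    by_contra! hcon
    refine hna ?_
    rw [hacc, hgrad]
    exact accept_of_large_gradient hΔ hL hζ hd hlip (fun i => he (some i)) hmem hmin (he none)
      hη1 hηt hcon.le
  have hΔτ : Δ ^ (2 - τ) = Δ ^ (-τ) * Δ ^ 2 := by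
    rw [← Real.rpow_two, ← Real.rpow_add hΔ]; congr 1; ring
  unfold StepOK
  simp only [hrun, hsucc, iterate]
  split_ifs with hif
  · left
    rw [hacc, hgrad] at hif
    have hpred0 : 0 ≤ dqModel θ (dqCoeff θ Δ y) θ - dqModel θ (dqCoeff θ Δ y) θs :=
      sub_nonneg.2 (hmin (Metric.mem_closedBall_self hΔ.le))
    have hpred : 0 < dqModel θ (dqCoeff θ Δ y) θ - dqModel θ (dqCoeff θ Δ y) θs := by
      refine hpred0.lt_of_ne fun h => ?_
      rw [← h, div_zero] at hif
      linarith [hif.1]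
    have hact := hif.1
    rw [le_div_iff₀ hpred] at hact
    have hcost : ∀ E : ℝ, (∀ i, |pointEstimate P A lam gam k θ Δ w i -
        P.f (evalPoint P A lam gam k θ Δ w i)| ≤ E) →
        P.f θs ≤ P.f θ + 2 * E -
          A.η * (dqModel θ (dqCoeff θ Δ y) θ - dqModel θ (dqCoeff θ Δ y) θs) := by
      intro E hE
      have h1 := abs_le.1 (hE none)
      have h2 : |y (Sum.inl ()) - P.f θ| ≤ E := hE (some (Sum.inl ()))
      have h2 := abs_le.1 h2
      rw [← hθs, ← hys] at h1
      linarith [h1.1, h2.2]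
    refine ⟨rfl, ?_, fun hA1 => ?_⟩
    · have h1 := hcost _ he1
      have h2 := mul_pos hη0 hpred
      linarith
    · have h1 := hcost _ (he2 hA1)
      have hc₀1 : c₀ ≤ 1 := min_le_left _ _
      obtain ⟨-, hh⟩ := model_accuracy hΔ hL hc₀0.le hd hlip (fun i => he2 hA1 (some i))
      have h2 := model_decrease_of_accept hΔ hH0 hηt
        (fun j => (hh j).trans (by rw [hH]; linarith)) hmin hif.2
      have h3 := mul_le_mul_of_nonneg_left h2 hη0.le
      have h4 : 2 * (c₀ * Δ ^ 2) ≤ A.η * p / 2 * Δ ^ 2 := by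
        have : c₀ ≤ A.η * p / 4 := min_le_right _ _
        nlinarith [sq_nonneg Δ]
      have h5 : A.η * (ω / (2 * A.ηt) * Δ ^ 2) = A.η * p * Δ ^ 2 := by rw [hp]; ring
      rw [← hω, h5] at h3
      linarith
  · right
    refine ⟨rfl, rfl, ?_, fun hA1 => ?_⟩
    · have h1 := hreject (Δ ^ (-τ)) (Real.rpow_pos_of_pos hΔ _).le
        (fun i => (he1 i).trans_eq hΔτ) hif
      have h2 : Δ ^ (1 - τ) = Δ ^ (-τ) * Δ := by
        nth_rewrite 3 [← Real.rpow_one Δ]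
        rw [← Real.rpow_add hΔ]; congr 1; ring
      have h3 : 0 ≤ Δ ^ (-τ) := (Real.rpow_pos_of_pos hΔ _).le
      rw [h2]
      have h4 : 0 ≤ C * ((1 + Δ ^ (-τ)) * Δ) := by positivity
      calc _ ≤ _ := h1
        _ ≤ 2 * (C * ((1 + Δ ^ (-τ)) * Δ)) := by linarith
        _ = _ := by ring
    · have h1 := hreject c₀ hc₀0.le (he2 hA1) hif
      have hc₀1 : c₀ ≤ 1 := min_le_left _ _
      refine h1.trans ?_
      rw [show 2 * C * Δ = C * ((1 + 1) * Δ) by ring]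
      gcongr

end Run

/-! ### Error bounds for one call of the sampling routine -/

section Estimator

variable {Ω : Type*} {d q : ℕ} {P : Problem d q} {A : Params d}
  {V : SampleIdx d q → Ω → (Fin q → ℝ)}

/-- The draw used for the `r`-th oracle value in the stratum `s`. -/
def drawIdx (k : ℕ) (i : PointIdx d) (m : ℕ) {n : ℕ} (z : (Fin q → Fin m) × Fin n) :
    SampleIdx d q := (k, i, m, fun j => (z.1 j : ℕ), (z.2 : ℕ))

theorem drawIdx_injective (k : ℕ) (i : PointIdx d) (m : ℕ) {n : ℕ} :
    Function.Injective (drawIdx (q := q) k i m (n := n)) := by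
  rintro ⟨s, r⟩ ⟨s', r'⟩ h
  simp only [drawIdx, Prod.mk.injEq, true_and] at h
  refine Prod.ext (funext fun j => Fin.ext (congrFun h.1 j)) (Fin.ext h.2)

/-- The sample variance of the strata, averaged over the strata. -/
def meanStratumVar (P : Problem d q) (A : Params d) (θ : Dec d) (m : ℕ) (v : Draws q) : ℝ :=
  (1 / (m : ℝ) ^ q) * ∑ s, stratumVar P A θ m v s

/-- The oracle value obtained in the stratum `s` from the draw with index `a`. -/
def valueAt (P : Problem d q) (V : SampleIdx d q → Ω → (Fin q → ℝ)) (θ : Dec d) {m : ℕ}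
    (s : Fin q → Fin m) (a : SampleIdx d q) (ω : Ω) : ℝ := P.oracle θ (stratumPoint m s (V a ω))

theorem stratifiedEstimate_eq (θ : Dec d) (m : ℕ) (k : ℕ) (i : PointIdx d) (ω : Ω) :
    stratifiedEstimate P A θ m (drawsAt (fun a => V a ω) k i m) =
      (1 / ((A.nbar : ℝ) * (m : ℝ) ^ q)) * (∑ z : (Fin q → Fin m) × Fin A.nbar,
        valueAt P V θ z.1 (drawIdx k i m z)) ω := by
  rw [Finset.sum_apply, Fintype.sum_prod_type]
  simp only [stratifiedEstimate, stratumMean]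
  rw [← Finset.mul_sum, ← mul_assoc]
  congr 1
  rw [one_div, one_div, one_div, mul_inv, mul_comm]

variable [MeasurableSpace Ω] {Pr : Measure Ω}

section Value

variable (hP : P.Standing) (hV_meas : ∀ a, Measurable (V a))
  (hV_law : ∀ a, Pr.map (V a) = cubeUniform q) {θ : Dec d} (hθ : θ ∈ P.Θ) {m : ℕ} (hm : 1 ≤ m)

include hP hV_meas hV_law hθ hm

theorem memLp_valueAt (s : Fin q → Fin m) (a : SampleIdx d q) :
    MemLp (valueAt P V θ s a) 2 Pr := by
  have h := memLp_comp_stratumPoint hm s (hP.memLp_oracle hθ)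
  rw [← hV_law a] at h
  exact h.comp_of_map (hV_meas a).aemeasurable

theorem integral_valueAt (s : Fin q → Fin m) (a : SampleIdx d q) :
    ∫ ω, valueAt P V θ s a ω ∂Pr = ∫ v, P.oracle θ (stratumPoint m s v) ∂cubeUniform q := by
  have h := memLp_comp_stratumPoint hm s (hP.memLp_oracle hθ)
  rw [← hV_law a] at h ⊢
  exact (integral_map (hV_meas a).aemeasurable h.aestronglyMeasurable).symm

theorem variance_valueAt (s : Fin q → Fin m) (a : SampleIdx d q) :
    variance (valueAt P V θ s a) Pr =
      variance (fun v => P.oracle θ (stratumPoint m s v)) (cubeUniform q) := by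
  have h := memLp_comp_stratumPoint hm s (hP.memLp_oracle hθ)
  rw [← hV_law a] at h ⊢
  exact (variance_map h.aestronglyMeasurable.aemeasurable (hV_meas a).aemeasurable).symm

end Value

theorem variance_stratifiedEstimate (hP : P.Standing) (hA : A.Admissible)
    (hV_meas : ∀ a, Measurable (V a)) (hV_law : ∀ a, Pr.map (V a) = cubeUniform q)
    (hV_indep : iIndepFun V Pr) {θ : Dec d} (hθ : θ ∈ P.Θ) {m : ℕ} (hm : 1 ≤ m) (k : ℕ)
    (i : PointIdx d) :
    variance (fun ω => stratifiedEstimate P A θ m (drawsAt (fun a => V a ω) k i m)) Pr =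
      stratVar (P.oracle θ) m / ((A.nbar : ℝ) * (m : ℝ) ^ q) := by
  have hm0 : (0 : ℝ) < m := by exact_mod_cast hm
  have hn0 : (0 : ℝ) < A.nbar := by have := hA.two_le_nbar; positivity
  simp only [stratifiedEstimate_eq]
  rw [variance_const_mul, IndepFun.variance_sum]
  · simp only [variance_valueAt hP hV_meas hV_law hθ hm]
    rw [Fintype.sum_prod_type]
    simp only [Finset.sum_const, Finset.card_univ, Fintype.card_fin, nsmul_eq_mul]
    rw [← Finset.mul_sum, stratVar]
    field_simp
  · exact fun z _ => memLp_valueAt hP hV_meas hV_law hθ hm z.1 _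
  · intro z _ z' _ hzz'
    have h := (hV_indep.precomp (drawIdx_injective k i m (n := A.nbar))).indepFun hzz'
    exact h.comp
      ((hP.measurable_oracle_right θ).comp (measurable_stratumPoint m z.1))
      ((hP.measurable_oracle_right θ).comp (measurable_stratumPoint m z'.1))

variable [IsProbabilityMeasure Pr]

/-- The stratified estimator is unbiased. -/
theorem integral_stratifiedEstimate (hP : P.Standing) (hA : A.Admissible)
    (hV_meas : ∀ a, Measurable (V a)) (hV_law : ∀ a, Pr.map (V a) = cubeUniform q) {θ : Dec d}
    (hθ : θ ∈ P.Θ) {m : ℕ} (hm : 1 ≤ m) (k : ℕ) (i : PointIdx d) :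
    ∫ ω, stratifiedEstimate P A θ m (drawsAt (fun a => V a ω) k i m) ∂Pr = P.f θ := by
  have hm0 : (0 : ℝ) < m := by exact_mod_cast hm
  have hn0 : (0 : ℝ) < A.nbar := by have := hA.two_le_nbar; positivity
  simp only [stratifiedEstimate_eq]
  rw [integral_const_mul]
  simp only [Finset.sum_apply]
  rw [integral_finsetSum _ fun z _ =>
    (memLp_valueAt hP hV_meas hV_law hθ hm z.1 (drawIdx k i m z)).integrable one_le_two]
  simp only [integral_valueAt hP hV_meas hV_law hθ hm]
  rw [Fintype.sum_prod_type]
  simp only [Finset.sum_const, Finset.card_univ, Fintype.card_fin, nsmul_eq_mul]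
  rw [← Finset.mul_sum, sum_integral_stratumPoint hm ((hP.memLp_oracle hθ).integrable one_le_two),
    hP.integral_oracle hθ]
  field_simp

/-- Chebyshev's inequality for the stratified estimator. -/
theorem measure_estimate_error_le (hP : P.Standing) (hA : A.Admissible)
    (hV_meas : ∀ a, Measurable (V a)) (hV_law : ∀ a, Pr.map (V a) = cubeUniform q)
    (hV_indep : iIndepFun V Pr) {θ : Dec d} (hθ : θ ∈ P.Θ) {m : ℕ} (hm : 1 ≤ m) (k : ℕ)
    (i : PointIdx d) {t : ℝ} (ht : 0 < t) :
    Pr {ω | t < |stratifiedEstimate P A θ m (drawsAt (fun a => V a ω) k i m) - P.f θ|} ≤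
      ENNReal.ofReal (stratVar (P.oracle θ) m / ((A.nbar : ℝ) * (m : ℝ) ^ q) / t ^ 2) := by
  have hL : MemLp (fun ω => stratifiedEstimate P A θ m (drawsAt (fun a => V a ω) k i m)) 2 Pr := by
    simp only [stratifiedEstimate_eq]
    refine MemLp.const_mul ?_ _
    exact memLp_finsetSum' _ fun z _ => memLp_valueAt hP hV_meas hV_law hθ hm z.1 _
  have h := meas_ge_le_variance_div_sq hL ht
  rw [integral_stratifiedEstimate hP hA hV_meas hV_law hθ hm,
    variance_stratifiedEstimate hP hA hV_meas hV_law hV_indep hθ hm] at h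
  refine (measure_mono fun ω hω => ?_).trans h
  exact (show t < _ from hω).le

/-- The sample variance is at most the mean square around any number, up to normalization. -/
theorem stratumVar_le (hA : A.Admissible) (θ : Dec d) (m : ℕ) (v : Draws q) (s : Fin q → Fin m)
    (c : ℝ) :
    stratumVar P A θ m v s ≤
      (1 / ((A.nbar : ℝ) - 1)) * ∑ r, (oracleValue P A θ m v s r - c) ^ 2 := by
  have hn : (2 : ℝ) ≤ A.nbar := by exact_mod_cast hA.two_le_nbar
  unfold stratumVar
  refine mul_le_mul_of_nonneg_left ?_ (by rw [one_div, inv_nonneg]; linarith)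
  set μ := stratumMean P A θ m v s with hμ
  have hsum : ∑ r, oracleValue P A θ m v s r = A.nbar * μ := by
    rw [hμ, stratumMean]; field_simp
  have h1 : ∑ r, (oracleValue P A θ m v s r - c) ^ 2 =
      ∑ r, (oracleValue P A θ m v s r - μ) ^ 2 + A.nbar * (μ - c) ^ 2 := by
    have h2 : ∀ r, (oracleValue P A θ m v s r - c) ^ 2 =
        (oracleValue P A θ m v s r - μ) ^ 2 +
          (2 * (μ - c) * oracleValue P A θ m v s r + (c ^ 2 - μ ^ 2)) := fun r => by ring
    simp only [h2, Finset.sum_add_distrib, ← Finset.mul_sum, hsum, Finset.sum_const,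
      Finset.card_univ, Fintype.card_fin, nsmul_eq_mul]
    ring
  rw [h1]
  have : 0 ≤ (A.nbar : ℝ) * (μ - c) ^ 2 := by positivity
  linarith

/-- Markov's inequality for the averaged sample variance. -/
theorem measure_meanStratumVar_le (hP : P.Standing) (hA : A.Admissible)
    (hV_meas : ∀ a, Measurable (V a)) (hV_law : ∀ a, Pr.map (V a) = cubeUniform q) {θ : Dec d}
    (hθ : θ ∈ P.Θ) {m : ℕ} (hm : 1 ≤ m) (k : ℕ) (i : PointIdx d) {t : ℝ} (ht : 0 < t) :
    Pr {ω | t < meanStratumVar P A θ m (drawsAt (fun a => V a ω) k i m)} ≤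
      ENNReal.ofReal (2 * stratVar (P.oracle θ) m / t) := by
  have hm0 : (0 : ℝ) < m := by exact_mod_cast hm
  have hn : (2 : ℝ) ≤ A.nbar := by exact_mod_cast hA.two_le_nbar
  set c : (Fin q → Fin m) → ℝ := fun s => ∫ v, P.oracle θ (stratumPoint m s v) ∂cubeUniform q
    with hc
  set Y : Ω → ℝ := fun ω => (1 / (m : ℝ) ^ q) * ∑ s : Fin q → Fin m, (1 / ((A.nbar : ℝ) - 1)) *
    ∑ r : Fin A.nbar, (valueAt P V θ s (drawIdx k i m (s, r)) ω - c s) ^ 2 with hY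
  have hsq : ∀ (s : Fin q → Fin m) (r : Fin A.nbar), Integrable
      (fun ω => (valueAt P V θ s (drawIdx k i m (s, r)) ω - c s) ^ 2) Pr := fun s r =>
    ((memLp_valueAt hP hV_meas hV_law hθ hm s _).sub (memLp_const (c s))).integrable_sq
  have hYi : Integrable Y Pr :=
    (integrable_finsetSum _ fun s _ => (integrable_finsetSum _ fun r _ => hsq s r).const_mul
      _).const_mul _
  have hY0 : ∀ ω, 0 ≤ Y ω := fun ω => by
    refine mul_nonneg (by positivity) (Finset.sum_nonneg fun s _ => ?_)
    exact mul_nonneg (by rw [one_div, inv_nonneg]; linarith)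
      (Finset.sum_nonneg fun _ _ => sq_nonneg _)
  have hint : ∫ ω, Y ω ∂Pr ≤ 2 * stratVar (P.oracle θ) m := by
    have h1 : ∀ (s : Fin q → Fin m) (r : Fin A.nbar),
        ∫ ω, (valueAt P V θ s (drawIdx k i m (s, r)) ω - c s) ^ 2 ∂Pr =
          variance (fun v => P.oracle θ (stratumPoint m s v)) (cubeUniform q) := by
      intro s r
      rw [← variance_valueAt hP hV_meas hV_law hθ hm s (drawIdx k i m (s, r)),
        variance_eq_integral
          (memLp_valueAt hP hV_meas hV_law hθ hm s _).aestronglyMeasurable.aemeasurable,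
        integral_valueAt hP hV_meas hV_law hθ hm]
    simp only [hY]
    rw [integral_const_mul, integral_finsetSum _ fun s _ =>
      (integrable_finsetSum _ fun r _ => hsq s r).const_mul _]
    simp only [integral_const_mul]
    simp only [integral_finsetSum _ fun r (_ : r ∈ Finset.univ) => hsq _ r, h1, Finset.sum_const,
      Finset.card_univ, Fintype.card_fin, nsmul_eq_mul]
    rw [← Finset.mul_sum, ← Finset.mul_sum, stratVar]
    have h2 : (1 / ((A.nbar : ℝ) - 1)) * A.nbar ≤ 2 := by
      rw [one_div, inv_mul_le_iff₀ (by linarith)]; linarith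
    have h3 : 0 ≤ ∑ s : Fin q → Fin m,
        variance (fun v => P.oracle θ (stratumPoint m s v)) (cubeUniform q) :=
      Finset.sum_nonneg fun _ _ => variance_nonneg _ _
    calc _ = (1 / ((A.nbar : ℝ) - 1) * A.nbar) * ((1 / (m : ℝ) ^ q) * ∑ s : Fin q → Fin m,
          variance (fun v => P.oracle θ (stratumPoint m s v)) (cubeUniform q)) := by ring
      _ ≤ _ := by gcongr
  have hle : ∀ ω, meanStratumVar P A θ m (drawsAt (fun a => V a ω) k i m) ≤ Y ω := by
    intro ω
    simp only [meanStratumVar, hY]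
    gcongr with s
    exact stratumVar_le hA θ m _ s (c s)
  have hmarkov := mul_meas_ge_le_integral_of_nonneg (Filter.Eventually.of_forall hY0) hYi t
  calc Pr {ω | t < meanStratumVar P A θ m (drawsAt (fun a => V a ω) k i m)}
      ≤ Pr {ω | t ≤ Y ω} := measure_mono fun ω hω => (show t < _ from hω).le.trans (hle ω)
    _ = ENNReal.ofReal (Pr.real {ω | t ≤ Y ω}) := by rw [ofReal_measureReal]
    _ ≤ _ := by
        refine ENNReal.ofReal_le_ofReal ?_
        rw [le_div_iff₀ ht, mul_comm]
        exact hmarkov.trans hint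

end Estimator

/-! ### Measurability of the algorithm -/

section Measurability

variable {d q : ℕ} {P : Problem d q} {A : Params d} {lam : ℕ → ℝ} {gam : ℝ}
  {β : Type*} [MeasurableSpace β]

theorem measurable_designPoint {θ : β → Dec d} {Δ : β → ℝ} (hθ : Measurable θ)
    (hΔ : Measurable Δ) (i : DesignIdx d) : Measurable fun x => designPoint (θ x) (Δ x) i := by
  rcases i with i | j | j
  · exact hθ
  · exact hθ.add (hΔ.smul_const _)
  · exact hθ.sub (hΔ.smul_const _)

theorem continuous_dqMatrix : Continuous fun z : Dec d × ℝ => dqMatrix z.1 z.2 := by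
  refine continuous_matrix fun i r => ?_
  have h1 : Continuous fun z : Dec d × ℝ => designPoint z.1 z.2 i := by
    rcases i with i | j | j <;> simp only [designPoint] <;> fun_prop
  rcases r with r | j | j <;> simp only [dqMatrix, Matrix.of_apply, dqBasis]
  · fun_prop
  · fun_prop
  · fun_prop

theorem measurable_dqCoeff {θ : β → Dec d} {Δ : β → ℝ} {y : β → DesignIdx d → ℝ}
    (hθ : Measurable θ) (hΔ : Measurable Δ) (hy : Measurable y) :
    Measurable fun x => dqCoeff (θ x) (Δ x) (y x) := by
  have hinv : ∀ i r, Measurable fun z : Dec d × ℝ => (dqMatrix z.1 z.2)⁻¹ i r := by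
    intro i r
    simp only [Matrix.inv_def, Ring.inverse_eq_inv', Matrix.smul_apply, smul_eq_mul]
    exact (continuous_dqMatrix.matrix_det.measurable.inv).mul
      (continuous_dqMatrix.matrix_adjugate.matrix_elem i r).measurable
  refine measurable_pi_lambda _ fun i => ?_
  simp only [dqCoeff, Matrix.mulVec, dotProduct]
  exact Finset.measurable_sum _ fun r _ => ((hinv i r).comp (hθ.prodMk hΔ)).mul
    ((measurable_pi_apply r).comp hy)

theorem measurable_dqModel {θ x : β → Dec d} {y : β → DesignIdx d → ℝ} (hθ : Measurable θ)
    (hy : Measurable y) (hx : Measurable x) : Measurable fun z => dqModel (θ z) (y z) (x z) := by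
  simp only [dqModel]
  refine Finset.measurable_sum _ fun r _ => ((measurable_pi_apply r).comp hy).mul ?_
  rcases r with r | j | j <;> simp only [dqBasis] <;> fun_prop

theorem measurable_modelGrad : Measurable (modelGrad (d := d)) := by
  unfold modelGrad
  fun_prop

section Estimates

variable (hP : P.Standing) {θ : β → Dec d} {Δ : β → ℝ} {v : β → Draws q} {w : β → ℕ → Draws q}
  (hθ : Measurable θ) (hΔ : Measurable Δ) (hv : Measurable v) (hw : Measurable w)

include hP hθ hv in
theorem measurable_oracleValue (m : ℕ) (s : Fin q → Fin m) (r : Fin A.nbar) :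
    Measurable fun x => oracleValue P A (θ x) m (v x) s r := by
  have h : Measurable fun x => v x (fun i => s i) r :=
    (measurable_pi_apply _).comp ((measurable_pi_apply _).comp hv)
  exact hP.measurable_oracle.comp (hθ.prodMk ((measurable_stratumPoint m s).comp h))

include hP hθ hv in
theorem measurable_stratumMean (m : ℕ) (s : Fin q → Fin m) :
    Measurable fun x => stratumMean P A (θ x) m (v x) s :=
  (Finset.measurable_sum _ fun r _ => measurable_oracleValue hP hθ hv m s r).const_mul _

include hP hθ hv in
theorem measurable_stratifiedEstimate (m : ℕ) :
    Measurable fun x => stratifiedEstimate P A (θ x) m (v x) :=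
  (Finset.measurable_sum _ fun s _ => measurable_stratumMean hP hθ hv m s).const_mul _

include hP hθ hv in
theorem measurable_meanStratumVar (m : ℕ) :
    Measurable fun x => meanStratumVar P A (θ x) m (v x) :=
  (Finset.measurable_sum _ fun s _ => (Finset.measurable_sum _ fun r _ =>
    ((measurable_oracleValue hP hθ hv m s r).sub
      (measurable_stratumMean hP hθ hv m s)).pow_const 2).const_mul _).const_mul _

include hP hθ hΔ hw

theorem measurableSet_passes (k m : ℕ) :
    MeasurableSet {x | Passes P A lam gam k (θ x) (Δ x) (w x) m} := by
  have h1 : Measurable fun x => varEstimate P A (θ x) m (w x m) :=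
    (measurable_const.max
      (measurable_meanStratumVar hP hθ ((measurable_pi_apply m).comp hw) m)).const_mul _
  refine (MeasurableSet.const _).inter ((MeasurableSet.const _).inter ?_)
  exact measurableSet_le h1.sqrt (((hΔ.pow_const gam).const_mul _).div_const _)

theorem measurable_strataPerAxis (k : ℕ) :
    Measurable fun x => strataPerAxis P A lam gam k (θ x) (Δ x) (w x) := by
  refine ENat.measurable_iff.2 fun n => ?_
  have hset : (fun x => strataPerAxis P A lam gam k (θ x) (Δ x) (w x)) ⁻¹' {(n : ℕ∞)} =
      {x | Passes P A lam gam k (θ x) (Δ x) (w x) n} ∩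
        ⋂ m ∈ Set.Iio n, {x | Passes P A lam gam k (θ x) (Δ x) (w x) m}ᶜ := by
    ext x
    simp only [mem_preimage, mem_singleton_iff, mem_inter_iff, mem_ofPred_eq, mem_iInter, mem_Iio,
      mem_compl_iff, strataPerAxis]
    constructor
    · intro h
      have hlt : ∀ m < n, ¬ Passes P A lam gam k (θ x) (Δ x) (w x) m := fun m hm hp => by
        have := h.symm.le.trans (iInf₂_le m hp)
        exact absurd (by exact_mod_cast this : n ≤ m) (not_le.2 hm)
      refine ⟨?_, hlt⟩
      by_contra hn
      have h2 : ((n + 1 : ℕ) : ℕ∞) ≤ n := by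
        rw [← h]
        refine le_iInf₂ fun m hp => ?_
        have : n + 1 ≤ m := by
          rcases lt_trichotomy m n with h' | h' | h'
          · exact absurd hp (hlt m h')
          · exact absurd (h' ▸ hp) hn
          · exact h'
        exact_mod_cast this
      exact absurd (by exact_mod_cast h2 : n + 1 ≤ n) (by omega)
    · rintro ⟨hn, hlt⟩
      refine le_antisymm (iInf₂_le n hn) (le_iInf₂ fun m hp => ?_)
      have : n ≤ m := not_lt.1 fun h => hlt m h hp
      exact_mod_cast this
  rw [hset]
  exact (measurableSet_passes hP hθ hΔ hw k n).inter
    (MeasurableSet.biInter (Set.to_countable _) fun m _ =>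
      (measurableSet_passes hP hθ hΔ hw k m).compl)

omit hΔ in
theorem measurable_stratifiedEstimate_random {N : β → ℕ∞} (hN : Measurable N) :
    Measurable fun x => stratifiedEstimate P A (θ x) (N x).toNat (w x (N x).toNat) := by
  have h : Measurable fun p : ℕ × β => stratifiedEstimate P A (θ p.2) p.1 (w p.2 p.1) :=
by
    refine measurable_from_prod_countable_right fun m => ?_
    have hm : Measurable fun x => w x m := (measurable_pi_apply m).comp hw
    exact measurable_stratifiedEstimate hP hθ hm m
  have hN' : Measurable fun x => (N x).toNat := (measurable_of_countable ENat.toNat).comp hN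
  have hN2 : Measurable fun x => ((N x).toNat, x) := hN'.prodMk measurable_id
  exact Measurable.comp
    (g := fun p : ℕ × β => stratifiedEstimate P A (θ p.2) p.1 (w p.2 p.1))
    (f := fun x => ((N x).toNat, x)) h hN2

theorem measurable_adaptiveEstimate (k : ℕ) :
    Measurable fun x => adaptiveEstimate P A lam gam k (θ x) (Δ x) (w x) :=
  measurable_stratifiedEstimate_random hP hθ hw (measurable_strataPerAxis hP hθ hΔ hw k)

end Estimates

section Iteration

variable (hP : P.Standing) (hA : A.Admissible) {θ : β → Dec d} {Δ : β → ℝ}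
  {w : β → PointIdx d → ℕ → Draws q} (hθ : Measurable θ) (hΔ : Measurable Δ) (hw : Measurable w)

include hP hθ hΔ hw

theorem measurable_modelCoeff (k : ℕ) :
    Measurable fun x => modelCoeff P A lam gam k (θ x) (Δ x) (w x) :=
  measurable_dqCoeff hθ hΔ (measurable_pi_lambda _ fun i =>
    measurable_adaptiveEstimate hP (measurable_designPoint hθ hΔ i) hΔ
      ((measurable_pi_apply (some i)).comp hw) k)

include hA

theorem measurable_evalPoint (k : ℕ) (i : PointIdx d) :
    Measurable fun x => evalPoint P A lam gam k (θ x) (Δ x) (w x) i := by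
  rcases i with _ | i
  · exact hA.solver_measurable.comp (hθ.prodMk (hΔ.prodMk (measurable_modelCoeff hP hθ hΔ hw k)))
  · exact measurable_designPoint hθ hΔ i

theorem measurable_iterate (k : ℕ) :
    Measurable fun x => iterate P A lam gam k (θ x, Δ x) (w x) := by
  have hβ := measurable_modelCoeff (A := A) (lam := lam) (gam := gam) hP hθ hΔ hw k
  have he := measurable_evalPoint (lam := lam) (gam := gam) hP hA hθ hΔ hw k none
  have hρ : Measurable fun x => acceptanceRatio P A lam gam k (θ x) (Δ x) (w x) :=
    ((measurable_adaptiveEstimate hP hθ hΔ ((measurable_pi_apply _).comp hw) k).sub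
      (measurable_adaptiveEstimate hP he hΔ ((measurable_pi_apply _).comp hw) k)).div
      ((measurable_dqModel hθ hβ hθ).sub (measurable_dqModel hθ hβ he))
  simp only [iterate, gradient_dqModel]
  refine Measurable.ite ?_ (he.prodMk ((hΔ.const_mul _).min measurable_const))
    (hθ.prodMk (hΔ.const_mul _))
  exact (measurableSet_le measurable_const hρ).inter
    (measurableSet_le hΔ ((measurable_modelGrad.comp hβ).norm.const_mul _))

end Iteration

theorem measurable_drawsAt (k : ℕ) :
    Measurable fun v : SampleIdx d q → (Fin q → ℝ) => drawsAt v k := by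
  exact measurable_pi_lambda _ fun i => measurable_pi_lambda _ fun m => measurable_pi_lambda _
    fun s => measurable_pi_lambda _ fun r => measurable_pi_apply _

theorem measurable_run (hP : P.Standing) (hA : A.Admissible) (k : ℕ) :
    Measurable fun v : SampleIdx d q → (Fin q → ℝ) => run P A lam gam v k := by
  induction k with
  | zero => exact measurable_const
  | succ k ih => exact measurable_iterate hP hA ih.fst ih.snd (measurable_drawsAt k) k

end Measurability

/-! ### Independence of past and present draws -/

section Independence

variable {Ω : Type*} [MeasurableSpace Ω] {Pr : Measure Ω} {ι E : Type*} [MeasurableSpace E]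
  [Zero E] {V : ι → Ω → E}

open Classical in
/-- The family `v` with the entries outside of `S` replaced by zero. -/
def maskTo (S : Set ι) (v : ι → E) : ι → E := fun a => if a ∈ S then v a else 0

omit [MeasurableSpace E] in
theorem apply_maskTo_of_dependsOn {α : Type*} {Φ : (ι → E) → α} {S : Set ι} (hΦ : DependsOn Φ S)
    (v : ι → E) : Φ (maskTo S v) = Φ v :=
  hΦ fun a ha => by simp [maskTo, ha]

theorem indepFun_maskTo (hV_meas : ∀ a, Measurable (V a)) (hV_indep : iIndepFun V Pr)
    {S T : Set ι} (hST : Disjoint S T) :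
    IndepFun (fun ω => maskTo S fun a => V a ω) (fun ω => maskTo T fun a => V a ω) Pr := by
  have hle : ∀ S : Set ι, MeasurableSpace.comap (fun ω => maskTo S fun a => V a ω)
      MeasurableSpace.pi ≤ ⨆ a ∈ S, MeasurableSpace.comap (V a) inferInstance := by
    intro S
    rw [← measurable_iff_comap_le]
    refine @measurable_pi_lambda _ _ _ (_) _ _ fun a => ?_
    by_cases ha : a ∈ S
    · simp only [maskTo, ha, if_true]
      rw [measurable_iff_comap_le]
      exact le_iSup₂_of_le a ha le_rfl
    · simp only [maskTo, ha, if_false]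
      exact measurable_const
  exact indep_of_indep_of_le_left (indep_of_indep_of_le_right
    (indep_iSup_of_disjoint (fun a => (hV_meas a).comap_le) hV_indep hST) (hle T)) (hle S)

/-- Functions of disjoint subfamilies are independent. -/
theorem indepFun_of_dependsOn (hV_meas : ∀ a, Measurable (V a)) (hV_indep : iIndepFun V Pr)
    {S T : Set ι} (hST : Disjoint S T) {α β : Type*} [MeasurableSpace α] [MeasurableSpace β]
    {Φ : (ι → E) → α} {Ψ : (ι → E) → β} (hΦ : Measurable Φ) (hΨ : Measurable Ψ)
    (hΦS : DependsOn Φ S) (hΨT : DependsOn Ψ T) :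
    IndepFun (fun ω => Φ fun a => V a ω) (fun ω => Ψ fun a => V a ω) Pr := by
  have h := (indepFun_maskTo hV_meas hV_indep hST).comp hΦ hΨ
  simpa only [Function.comp_def, apply_maskTo_of_dependsOn hΦS,
    apply_maskTo_of_dependsOn hΨT] using h

/-- Freezing: a bound for the probability of an event that involves a parameter `z` and the draws
in `T` remains true if a function of the draws outside of `T` is substituted for `z`. -/
theorem measure_subst_le [IsProbabilityMeasure Pr] (hV_meas : ∀ a, Measurable (V a))
    (hV_indep : iIndepFun V Pr) {S T : Set ι} (hST : Disjoint S T) {α : Type*}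
    [MeasurableSpace α] {Φ : (ι → E) → α} (hΦ : Measurable Φ) (hΦS : DependsOn Φ S)
    {B : α → (ι → E) → Prop} (hB : MeasurableSet {p : α × (ι → E) | B p.1 p.2})
    (hBT : ∀ z, DependsOn (B z) T) {c : ℝ≥0∞} (hc : ∀ z, Pr {ω | B z fun a => V a ω} ≤ c) :
    Pr {ω | B (Φ fun a => V a ω) fun a => V a ω} ≤ c := by
  have hVm : Measurable fun ω => fun a => V a ω := measurable_pi_lambda _ hV_meas
  have hmask : Measurable (maskTo (E := E) T) := by
    refine measurable_pi_lambda _ fun a => ?_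
    by_cases ha : a ∈ T
    · simpa only [maskTo, ha, if_true] using measurable_pi_apply a
    · simp only [maskTo, ha, if_false, measurable_const]
  set X : Ω → α := fun ω => Φ fun a => V a ω
  set W : Ω → (ι → E) := fun ω => maskTo T fun a => V a ω
  have hX : Measurable X := hΦ.comp hVm
  have hW : Measurable W := hmask.comp hVm
  have hXW : IndepFun X W Pr := by
    have h := (indepFun_maskTo hV_meas hV_indep hST).comp hΦ measurable_id
    simpa only [Function.comp_def, apply_maskTo_of_dependsOn hΦS, id] using h
  have hmap := (indepFun_iff_map_prod_eq_prod_map_map hX.aemeasurable hW.aemeasurable).1 hXW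
  have h1 : {ω | B (Φ fun a => V a ω) fun a => V a ω} =
      (fun ω => (X ω, W ω)) ⁻¹' {p | B p.1 p.2} := by
    ext ω
    exact (apply_maskTo_of_dependsOn (hBT _) _).to_iff.symm
  have : IsProbabilityMeasure (Pr.map X) := Measure.isProbabilityMeasure_map hX.aemeasurable
  have : IsProbabilityMeasure (Pr.map W) := Measure.isProbabilityMeasure_map hW.aemeasurable
  rw [h1, ← Measure.map_apply (hX.prodMk hW) hB, hmap, Measure.prod_apply hB]
  calc ∫⁻ z, Pr.map W (Prod.mk z ⁻¹' {p | B p.1 p.2}) ∂(Pr.map X) ≤ ∫⁻ _, c ∂(Pr.map X) := by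
        refine lintegral_mono fun z => ?_
        rw [Measure.map_apply hW (measurable_prodMk_left hB)]
        refine le_trans (le_of_eq ?_) (hc z)
        congr 1
        ext ω
        exact (apply_maskTo_of_dependsOn (hBT _) _).to_iff
    _ = c := by simp

end Independence

/-! ### The adaptive sampling rule -/

section Rule

variable {d q : ℕ} {P : Problem d q} {A : Params d}

/-- The sample size that the adaptive sampling rule requires in any case, because of the variance
floor. Here `ℓ` is the deterministic lower bound of the iteration. -/
def floorSize (A : Params d) (gam ℓ Δ : ℝ) : ℝ :=
  ℓ * max 1 (A.σminSq / (A.κas ^ 2 * Δ ^ (2 * gam)))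

/-- The least number of strata per axis with at least `floorSize` draws. -/
def minStrata (q : ℕ) (A : Params d) (gam ℓ Δ : ℝ) : ℕ :=
  max 1 ⌈(floorSize A gam ℓ Δ / A.nbar) ^ ((q : ℝ)⁻¹)⌉₊

variable {gam ℓ Δ : ℝ}

theorem one_le_minStrata : 1 ≤ minStrata q A gam ℓ Δ := le_max_left _ _

theorem le_floorSize (hℓ : 1 ≤ ℓ) : ℓ ≤ floorSize A gam ℓ Δ :=
  le_mul_of_one_le_right (by linarith) (le_max_left _ _)

theorem minStrata_le_iff (hq : 1 ≤ q) (hA : A.Admissible) (hℓ : 1 ≤ ℓ) {m : ℕ} (hm : 1 ≤ m) :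
    minStrata q A gam ℓ Δ ≤ m ↔ floorSize A gam ℓ Δ ≤ A.nbar * (m : ℝ) ^ q := by
  have hn : (0 : ℝ) < A.nbar := by have := hA.two_le_nbar; positivity
  have hR : 0 ≤ floorSize A gam ℓ Δ := by linarith [le_floorSize (A := A) (gam := gam) (Δ := Δ) hℓ]
  rw [minStrata, max_le_iff, Nat.ceil_le, Real.rpow_inv_le_iff_of_pos (by positivity)
    (by positivity) (by positivity), Real.rpow_natCast, div_le_iff₀ hn, mul_comm]
  exact and_iff_right hm

theorem floorSize_le_minStrata (hq : 1 ≤ q) (hA : A.Admissible) (hℓ : 1 ≤ ℓ) :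
    floorSize A gam ℓ Δ ≤ A.nbar * (minStrata q A gam ℓ Δ : ℝ) ^ q :=
  (minStrata_le_iff hq hA hℓ one_le_minStrata).1 le_rfl

theorem sampling_bound_iff (hA : A.Admissible) (hℓ : 1 ≤ ℓ) (hΔ : 0 < Δ) {n : ℝ} (hn : 0 < n) :
    Real.sqrt (1 / n * A.σminSq) ≤ A.κas * Δ ^ gam / Real.sqrt ℓ ↔
      ℓ * (A.σminSq / (A.κas ^ 2 * Δ ^ (2 * gam))) ≤ n := by
  have hκ := hA.κas_pos
  have hσ := hA.σminSq_pos
  have hpow : Δ ^ (2 * gam) = (Δ ^ gam) ^ 2 := by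
    rw [← Real.rpow_natCast, ← Real.rpow_mul hΔ.le]; congr 1; push_cast; ring
  have hD : 0 < Δ ^ gam := Real.rpow_pos_of_pos hΔ _
  rw [Real.sqrt_le_left (by positivity), div_pow, Real.sq_sqrt (by linarith), mul_pow, ← hpow,
    one_div_mul_eq_div, div_le_div_iff₀ hn (by linarith), ← mul_div_assoc,
    div_le_iff₀ (by positivity), mul_comm ℓ, mul_comm n]

variable {lam : ℕ → ℝ} {k : ℕ} {θ : Dec d} {w : ℕ → Draws q}

theorem minStrata_le_of_passes (hq : 1 ≤ q) (hA : A.Admissible) (hℓ : 1 ≤ lam k) (hΔ : 0 < Δ)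
    {m : ℕ} (hm : Passes P A lam gam k θ Δ w m) : minStrata q A gam (lam k) Δ ≤ m := by
  obtain ⟨h1, h2, h3⟩ := hm
  have hn : 0 < (A.nbar : ℝ) * (m : ℝ) ^ q := lt_of_lt_of_le (by linarith) h2
  rw [minStrata_le_iff hq hA hℓ h1, floorSize, mul_max_of_nonneg _ _ (by linarith), mul_one]
  refine max_le h2 ((sampling_bound_iff hA hℓ hΔ hn).1 (le_trans (Real.sqrt_le_sqrt ?_) h3))
  exact mul_le_mul_of_nonneg_left (le_max_left _ _) (by positivity)

theorem passes_of_meanStratumVar_le (hq : 1 ≤ q) (hA : A.Admissible) (hℓ : 1 ≤ lam k) (hΔ : 0 < Δ)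
    {m : ℕ} (hm : minStrata q A gam (lam k) Δ ≤ m)
    (hv : meanStratumVar P A θ m (w m) ≤ A.σminSq) : Passes P A lam gam k θ Δ w m := by
  have h1 : 1 ≤ m := one_le_minStrata.trans hm
  have h2 := (minStrata_le_iff hq hA hℓ h1).1 hm
  have hR := le_floorSize (A := A) (gam := gam) (Δ := Δ) hℓ
  have hn : 0 < (A.nbar : ℝ) * (m : ℝ) ^ q := by linarith
  rw [floorSize, mul_max_of_nonneg _ _ (by linarith), mul_one, max_le_iff] at h2
  refine ⟨h1, h2.1, ?_⟩
  have : varEstimate P A θ m (w m) = 1 / ((A.nbar : ℝ) * (m : ℝ) ^ q) * A.σminSq :=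
    congrArg _ (max_eq_left hv)
  rw [this]
  exact (sampling_bound_iff hA hℓ hΔ hn).2 h2.2

/-- Once the sample variance in some admissible stratification is below the variance floor,
sampling stops there or earlier. -/
theorem exists_strataPerAxis_eq (hq : 1 ≤ q) (hA : A.Admissible) (hℓ : 1 ≤ lam k) (hΔ : 0 < Δ)
    {m : ℕ} (hm : minStrata q A gam (lam k) Δ ≤ m)
    (hv : meanStratumVar P A θ m (w m) ≤ A.σminSq) :
    ∃ n : ℕ, minStrata q A gam (lam k) Δ ≤ n ∧ n ≤ m ∧
      strataPerAxis P A lam gam k θ Δ w = n := by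
  classical
  have hp := passes_of_meanStratumVar_le hq hA hℓ hΔ hm hv
  have hex : ∃ n, Passes P A lam gam k θ Δ w n := ⟨m, hp⟩
  refine ⟨Nat.find hex, minStrata_le_of_passes hq hA hℓ hΔ (Nat.find_spec hex),
    Nat.find_min' hex hp, ?_⟩
  exact le_antisymm (iInf₂_le _ (Nat.find_spec hex))
    (le_iInf₂ fun n hn => by exact_mod_cast Nat.find_min' hex hn)

theorem floorSize_le (hA : A.Admissible) (hℓ : 1 ≤ ℓ) {D : ℝ} (hΔ : 0 < Δ) (hΔD : Δ ≤ D)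
    (hgam : 0 ≤ gam) :
    floorSize A gam ℓ Δ ≤ (D ^ (2 * gam) + A.σminSq / A.κas ^ 2) * ℓ * Δ ^ (-(2 * gam)) := by
  have hκ := hA.κas_pos
  have hσ := hA.σminSq_pos
  have hpos : 0 < Δ ^ (2 * gam) := Real.rpow_pos_of_pos hΔ _
  have h1 : Δ ^ (2 * gam) ≤ D ^ (2 * gam) := Real.rpow_le_rpow hΔ.le hΔD (by positivity)
  have h0 : 0 ≤ A.σminSq / A.κas ^ 2 := by positivity
  rw [floorSize, Real.rpow_neg hΔ.le, mul_comm _ ℓ, mul_assoc]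
  refine mul_le_mul_of_nonneg_left (max_le ?_ ?_) (by linarith)
  · rw [← div_eq_mul_inv, one_le_div hpos]; linarith
  · rw [← div_div, ← div_eq_mul_inv]
    have : 0 ≤ D ^ (2 * gam) := hpos.le.trans h1
    gcongr
    linarith

/-- Up to a constant, stopping at most `J` steps late does not increase the sample size. -/
theorem sample_size_window_le (hq : 1 ≤ q) (hA : A.Admissible) (hℓ : 1 ≤ ℓ) {J n : ℕ}
    (hn : n ≤ minStrata q A gam ℓ Δ + J) :
    (A.nbar : ℝ) * (n : ℝ) ^ q ≤ A.nbar * ((J : ℝ) + 2) ^ q * floorSize A gam ℓ Δ := by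
  have hn2 : (2 : ℝ) ≤ A.nbar := by exact_mod_cast hA.two_le_nbar
  have hR := le_floorSize (A := A) (gam := gam) (Δ := Δ) hℓ
  set R := floorSize A gam ℓ Δ with hRdef
  set x : ℝ := (R / A.nbar) ^ ((q : ℝ)⁻¹) with hx
  have hx0 : 0 ≤ x := Real.rpow_nonneg (div_nonneg (by linarith) (by linarith)) _
  have hxq : x ^ q ≤ R := by
    rw [hx, ← Real.rpow_natCast, Real.rpow_inv_rpow (div_nonneg (by linarith) (by linarith))
      (by positivity)]
    exact div_le_self (by linarith) (by linarith)
  have hyq : (max 1 x) ^ q ≤ R := by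
    rcases max_cases 1 x with ⟨h, -⟩ | ⟨h, -⟩ <;> rw [h]
    · rw [one_pow]; linarith
    · exact hxq
  have hm : (minStrata q A gam ℓ Δ : ℝ) ≤ x + 1 := by
    rw [minStrata, Nat.cast_max, Nat.cast_one]
    exact max_le (by linarith) (Nat.ceil_lt_add_one hx0).le
  have hnr : (n : ℝ) ≤ ((J : ℝ) + 2) * max 1 x := by
    have h1 : (n : ℝ) ≤ minStrata q A gam ℓ Δ + J := by exact_mod_cast hn
    have h2 := le_max_left 1 x
    have h3 := le_max_right 1 x
    have h4 : (J : ℝ) * 1 ≤ J * max 1 x := by gcongr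
    linarith
  rw [mul_assoc]
  refine mul_le_mul_of_nonneg_left ?_ (by linarith)
  calc (n : ℝ) ^ q ≤ (((J : ℝ) + 2) * max 1 x) ^ q := by gcongr
    _ = ((J : ℝ) + 2) ^ q * (max 1 x) ^ q := mul_pow _ _ _
    _ ≤ _ := by gcongr

theorem minStrata_rpow_le (hq : 1 ≤ q) (hA : A.Admissible) (hℓ : 1 ≤ ℓ) {a : ℝ} (ha : 0 ≤ a) :
    (minStrata q A gam ℓ Δ : ℝ) ^ (-(q * a)) ≤
      (A.nbar : ℝ) ^ a * floorSize A gam ℓ Δ ^ (-a) := by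
  have hn2 : (2 : ℝ) ≤ A.nbar := by exact_mod_cast hA.two_le_nbar
  have hR := le_floorSize (A := A) (gam := gam) (Δ := Δ) hℓ
  have hm : (0 : ℝ) < minStrata q A gam ℓ Δ := by
    exact_mod_cast one_le_minStrata (q := q) (A := A) (gam := gam) (ℓ := ℓ) (Δ := Δ)
  have h := floorSize_le_minStrata (gam := gam) (Δ := Δ) hq hA hℓ
  rw [Real.rpow_neg (by linarith) a, ← div_eq_mul_inv, ← Real.div_rpow (by linarith) (by linarith),
    ← mul_neg, Real.rpow_mul hm.le, Real.rpow_natCast, Real.rpow_neg (by positivity),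
    ← Real.inv_rpow (by positivity)]
  refine Real.rpow_le_rpow (by positivity) ?_ ha
  rw [inv_eq_one_div, div_le_div_iff₀ (by positivity) (by linarith)]
  linarith

theorem floorSize_rpow_le (hA : A.Admissible) (hℓ : 1 ≤ ℓ) (hΔ : 0 < Δ) {a : ℝ} (ha : 0 ≤ a) :
    floorSize A gam ℓ Δ ^ (-a) ≤
      (A.σminSq / A.κas ^ 2) ^ (-a) * ℓ ^ (-a) * Δ ^ (2 * gam * a) := by
  have hκ := hA.κas_pos
  have hσ := hA.σminSq_pos
  have hpos : 0 < Δ ^ (2 * gam) := Real.rpow_pos_of_pos hΔ _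
  have h1 : ℓ * (A.σminSq / A.κas ^ 2 * (Δ ^ (2 * gam))⁻¹) ≤ floorSize A gam ℓ Δ := by
    rw [floorSize, ← div_div, div_eq_mul_inv _ (Δ ^ (2 * gam))]
    exact mul_le_mul_of_nonneg_left (le_max_right _ _) (by linarith)
  have hb : 0 < A.σminSq / A.κas ^ 2 := by positivity
  calc floorSize A gam ℓ Δ ^ (-a)
      ≤ (ℓ * (A.σminSq / A.κas ^ 2 * (Δ ^ (2 * gam))⁻¹)) ^ (-a) :=
        Real.rpow_le_rpow_of_nonpos (by positivity) h1 (by linarith)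
    _ = _ := by
        rw [Real.mul_rpow (by linarith) (by positivity), Real.mul_rpow hb.le (by positivity),
          Real.inv_rpow hpos.le, Real.rpow_neg hpos.le, inv_inv, ← Real.rpow_mul hΔ.le]
        ring

end Rule

/-! ### Failure probabilities of one call of the sampling routine -/

section Call

variable {d q : ℕ} {P : Problem d q} {A : Params d} {gam : ℝ}

/-- A successful call: the sampling rule is met at most `J` steps after the least admissible number
of strata, and until then all estimates have error at most `t`. The objective is written as an
integral over the cube, which is a measurable function of `θ`. -/
def GoodCall (P : Problem d q) (A : Params d) (gam ℓ : ℝ) (J : ℕ) (t : ℝ) (θ : Dec d) (Δ : ℝ)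
    (w : ℕ → Draws q) : Prop :=
  (∃ m, minStrata q A gam ℓ Δ ≤ m ∧ m ≤ minStrata q A gam ℓ Δ + J ∧
    meanStratumVar P A θ m (w m) ≤ A.σminSq) ∧
  ∀ m, minStrata q A gam ℓ Δ ≤ m → m ≤ minStrata q A gam ℓ Δ + J →
    |stratifiedEstimate P A θ m (w m) - ∫ u, P.oracle θ u ∂cubeUniform q| ≤ t

variable {Ω : Type*} [MeasurableSpace Ω] {Pr : Measure Ω} [IsProbabilityMeasure Pr]
  {V : SampleIdx d q → Ω → (Fin q → ℝ)}

theorem measurable_meanStratumVar_drawsAt (hP : P.Standing) (θ : Dec d) (k : ℕ) (i : PointIdx d)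
    (m : ℕ) : Measurable fun v : SampleIdx d q → (Fin q → ℝ) =>
      meanStratumVar P A θ m (drawsAt v k i m) :=
  measurable_meanStratumVar hP measurable_const ((measurable_pi_apply m).comp
    ((measurable_pi_apply i).comp (measurable_drawsAt k))) m

omit [IsProbabilityMeasure Pr] in
/-- Stratifications with different numbers of strata use independent draws. -/
theorem measure_forall_meanStratumVar_le (hP : P.Standing) (hV_meas : ∀ a, Measurable (V a))
    (hV_indep : iIndepFun V Pr) (θ : Dec d) (k : ℕ) (i : PointIdx d) {t : ℝ} {c : ℝ≥0∞} (m₀ : ℕ)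
    (hc : ∀ m, m₀ ≤ m →
      Pr {ω | t < meanStratumVar P A θ m (drawsAt (fun a => V a ω) k i m)} ≤ c) (J : ℕ) :
    Pr {ω | ∀ m, m₀ ≤ m → m ≤ m₀ + J →
      t < meanStratumVar P A θ m (drawsAt (fun a => V a ω) k i m)} ≤ c ^ (J + 1) := by
  have hmeas : ∀ m, MeasurableSet {v : SampleIdx d q → (Fin q → ℝ) |
      t < meanStratumVar P A θ m (drawsAt v k i m)} := fun m =>
    measurableSet_lt measurable_const (measurable_meanStratumVar_drawsAt hP θ k i m)
  have hVm : Measurable fun ω => fun a => V a ω := measurable_pi_lambda _ hV_meas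
  induction J with
  | zero =>
    rw [zero_add, pow_one]
    refine le_trans (measure_mono fun ω hω => ?_) (hc m₀ le_rfl)
    exact hω m₀ le_rfl le_rfl
  | succ J ih =>
    set Φ : (SampleIdx d q → (Fin q → ℝ)) → Prop := fun v => ∀ m, m₀ ≤ m → m ≤ m₀ + J →
      t < meanStratumVar P A θ m (drawsAt v k i m) with hΦ
    set Ψ : (SampleIdx d q → (Fin q → ℝ)) → Prop := fun v =>
      t < meanStratumVar P A θ (m₀ + J + 1) (drawsAt v k i (m₀ + J + 1)) with hΨ
    have hΦm : Measurable Φ := by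
      refine Measurable.forall fun m => ?_
      exact Measurable.imp measurable_const (Measurable.imp measurable_const
        (measurableSet_setOfPred.1 (hmeas m)))
    have hΨm : Measurable Ψ := measurableSet_setOfPred.1 (hmeas _)
    have hΦS : DependsOn Φ {a | a.2.2.1 ≤ m₀ + J} := by
      intro v v' h
      refine propext (forall_congr' fun m => imp_congr_right fun _ => imp_congr_right fun hm => ?_)
      have : drawsAt v k i m = drawsAt v' k i m := funext fun s => funext fun r => h _ hm
      rw [this]
    have hΨT : DependsOn Ψ {a | a.2.2.1 = m₀ + J + 1} := by
      intro v v' h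
      have : drawsAt v k i (m₀ + J + 1) = drawsAt v' k i (m₀ + J + 1) :=
        funext fun s => funext fun r => h _ rfl
      simp only [hΨ, this]
    have hdisj : Disjoint {a : SampleIdx d q | a.2.2.1 ≤ m₀ + J} {a | a.2.2.1 = m₀ + J + 1} := by
      rw [Set.disjoint_left]
      intro a (h : a.2.2.1 ≤ m₀ + J) (h' : a.2.2.1 = m₀ + J + 1)
      omega
    have hind := indepFun_of_dependsOn hV_meas hV_indep hdisj hΦm hΨm hΦS hΨT
    have hprod := hind.measure_inter_preimage_eq_mul {True} {True} (measurableSet_singleton _)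
      (measurableSet_singleton _)
    calc _ ≤ Pr ((fun ω => Φ fun a => V a ω) ⁻¹' {True} ∩
          (fun ω => Ψ fun a => V a ω) ⁻¹' {True}) := by
          refine measure_mono fun ω hω => ⟨?_, ?_⟩
          · exact eq_true fun m h1 h2 => hω m h1 (by omega)
          · exact eq_true (hω _ (by omega) (by omega))
      _ = Pr ((fun ω => Φ fun a => V a ω) ⁻¹' {True}) *
          Pr ((fun ω => Ψ fun a => V a ω) ⁻¹' {True}) := hprod
      _ ≤ c ^ (J + 1) * c := by
          gcongr
          · exact (measure_mono fun ω hω => of_eq_true hω).trans ih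
          · exact (measure_mono fun ω hω => of_eq_true hω).trans (hc _ (by omega))
      _ = _ := (pow_succ _ _).symm

/-- Almost surely, the sampling rule is eventually met. -/
theorem measure_never_passes_eq_zero (hP : P.Standing) (hA : A.Admissible)
    (hV_meas : ∀ a, Measurable (V a)) (hV_law : ∀ a, Pr.map (V a) = cubeUniform q)
    {p : ℝ} (hp : 0 < p) (hdec : P.VarianceDecay p) {θ : Dec d} (hθ : θ ∈ P.Θ) (k : ℕ)
    (i : PointIdx d) (m₀ : ℕ) :
    Pr {ω | ∀ m, m₀ ≤ m →
      A.σminSq < meanStratumVar P A θ m (drawsAt (fun a => V a ω) k i m)} = 0 := by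
  obtain ⟨C, hC⟩ := hdec
  have hσ := hA.σminSq_pos
  have hlim : Filter.Tendsto (fun m : ℕ => ENNReal.ofReal (2 * (C * (m : ℝ) ^ (-p)) / A.σminSq))
      Filter.atTop (nhds 0) := by
    rw [← ENNReal.ofReal_zero]
    refine ENNReal.tendsto_ofReal ?_
    have h := (tendsto_rpow_neg_atTop hp).comp (tendsto_natCast_atTop_atTop (R := ℝ))
    have h2 := ((h.const_mul C).const_mul 2).div_const A.σminSq
    simpa using h2
  refine le_antisymm (ge_of_tendsto hlim ?_) zero_le
  filter_upwards [Filter.eventually_ge_atTop (max 1 m₀)] with m hm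
  have hm1 : 1 ≤ m := (le_max_left _ _).trans hm
  refine le_trans (measure_mono fun ω hω => ?_)
    ((measure_meanStratumVar_le hP hA hV_meas hV_law hθ hm1 k i hσ).trans
      (ENNReal.ofReal_le_ofReal ?_))
  · exact hω m ((le_max_right _ _).trans hm)
  have := hC θ hθ m hm1
  gcongr

/-- The probability that a call is not successful. The first term stems from `J + 1` independent
failures of the stopping rule, the second one from Chebyshev's inequality for the estimates. -/
theorem measure_not_goodCall_le (hq : 1 ≤ q) (hP : P.Standing) (hA : A.Admissible)
    (hV_meas : ∀ a, Measurable (V a)) (hV_law : ∀ a, Pr.map (V a) = cubeUniform q)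
    (hV_indep : iIndepFun V Pr) {p : ℝ} (hp : 0 < p) (hdec : P.VarianceDecay p) (J : ℕ) :
    ∃ K : ℝ, 0 ≤ K ∧ ∀ (k : ℕ) (i : PointIdx d) (ℓ Δ t : ℝ) (θ : Dec d), θ ∈ P.Θ → 1 ≤ ℓ →
      0 < Δ → 0 < t →
      Pr {ω | ¬ GoodCall P A gam ℓ J t θ Δ (drawsAt (fun a => V a ω) k i)} ≤
        ENNReal.ofReal (K * (ℓ ^ (-(p / q * (J + 1))) +
          ℓ ^ (-((q + p) / q)) * Δ ^ (2 * gam * ((q + p) / q)) / t ^ 2)) := by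
  obtain ⟨C', hC'⟩ := hdec
  set C := max C' 0 with hCdef
  have hC0 : 0 ≤ C := le_max_right _ _
  have hC : ∀ θ ∈ P.Θ, ∀ m : ℕ, 1 ≤ m → stratVar (P.oracle θ) m ≤ C * (m : ℝ) ^ (-p) :=
    fun θ hθ m hm => (hC' θ hθ m hm).trans (by gcongr; exact le_max_left _ _)
  have hσ := hA.σminSq_pos
  have hκ := hA.κas_pos
  have hq0 : (0 : ℝ) < q := by exact_mod_cast hq
  have hn2 : (2 : ℝ) ≤ A.nbar := by exact_mod_cast hA.two_le_nbar
  set a := (q + p) / q with ha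
  set a₁ := p / q with ha₁
  have ha0 : 0 ≤ a := by positivity
  have ha₁0 : 0 ≤ a₁ := by positivity
  have hqa : q * a = q + p := by rw [ha]; field_simp
  have hqa₁ : q * a₁ = p := by rw [ha₁]; field_simp
  set K₁ : ℝ := 2 * (C * (A.nbar : ℝ) ^ a₁) / A.σminSq with hK₁
  set K₂ : ℝ := C / A.nbar * ((A.nbar : ℝ) ^ a * (A.σminSq / A.κas ^ 2) ^ (-a)) with hK₂
  have hK₁0 : 0 ≤ K₁ := by positivity
  have hK₂0 : 0 ≤ K₂ := by positivity
  refine ⟨K₁ ^ (J + 1) + (J + 1) * K₂, by positivity, fun k i ℓ Δ t θ hθ hℓ hΔ ht => ?_⟩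
  have hℓ0 : 0 < ℓ := by linarith
  set m₀ := minStrata q A gam ℓ Δ with hm₀
  have hm₀1 : 1 ≤ m₀ := one_le_minStrata
  have hm₀r : (0 : ℝ) < m₀ := by exact_mod_cast hm₀1
  set X := ℓ ^ (-a) * Δ ^ (2 * gam * a) / t ^ 2 with hX
  have hX0 : 0 ≤ X := by positivity
  -- the variance event
  have hB1 : ∀ m, m₀ ≤ m → Pr {ω | A.σminSq < meanStratumVar P A θ m
      (drawsAt (fun a => V a ω) k i m)} ≤ ENNReal.ofReal (K₁ * ℓ ^ (-a₁)) := by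
    intro m hm
    refine (measure_meanStratumVar_le hP hA hV_meas hV_law hθ (hm₀1.trans hm) k i hσ).trans
      (ENNReal.ofReal_le_ofReal ?_)
    have h1 : (m : ℝ) ^ (-p) ≤ (A.nbar : ℝ) ^ a₁ * ℓ ^ (-a₁) := by
      calc (m : ℝ) ^ (-p) ≤ (m₀ : ℝ) ^ (-p) :=
            Real.rpow_le_rpow_of_nonpos hm₀r (by exact_mod_cast hm) (by linarith)
        _ ≤ (A.nbar : ℝ) ^ a₁ * floorSize A gam ℓ Δ ^ (-a₁) := by
            rw [← hqa₁]; exact minStrata_rpow_le hq hA hℓ ha₁0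
        _ ≤ _ := by
            gcongr ?_ * ?_
            exact Real.rpow_le_rpow_of_nonpos hℓ0 (le_floorSize hℓ) (by linarith)
    calc 2 * stratVar (P.oracle θ) m / A.σminSq
        ≤ 2 * (C * ((A.nbar : ℝ) ^ a₁ * ℓ ^ (-a₁))) / A.σminSq := by
          have := hC θ hθ m (hm₀1.trans hm)
          gcongr
          exact this.trans (by gcongr)
      _ = _ := by rw [hK₁]; ring
  -- the error events
  have hB2 : ∀ m, m₀ ≤ m → Pr {ω | t < |stratifiedEstimate P A θ m
      (drawsAt (fun a => V a ω) k i m) - P.f θ|} ≤ ENNReal.ofReal (K₂ * X) := by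
    intro m hm
    have hmr : (0 : ℝ) < m := by exact_mod_cast (hm₀1.trans hm)
    refine (measure_estimate_error_le hP hA hV_meas hV_law hV_indep hθ (hm₀1.trans hm) k i
      ht).trans (ENNReal.ofReal_le_ofReal ?_)
    have h1 : (m : ℝ) ^ (-p) / (m : ℝ) ^ q ≤
        (A.nbar : ℝ) ^ a * ((A.σminSq / A.κas ^ 2) ^ (-a) * ℓ ^ (-a) * Δ ^ (2 * gam * a)) := by
      calc (m : ℝ) ^ (-p) / (m : ℝ) ^ q = (m : ℝ) ^ (-(q * a)) := by
            rw [hqa, div_eq_mul_inv, ← Real.rpow_natCast, ← Real.rpow_neg hmr.le,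
              ← Real.rpow_add hmr]
            congr 1; ring
        _ ≤ (m₀ : ℝ) ^ (-(q * a)) :=
            Real.rpow_le_rpow_of_nonpos hm₀r (by exact_mod_cast hm) (by
              have : 0 ≤ q * a := by positivity
              linarith)
        _ ≤ (A.nbar : ℝ) ^ a * floorSize A gam ℓ Δ ^ (-a) := minStrata_rpow_le hq hA hℓ ha0
        _ ≤ _ := by gcongr ?_ * ?_; exact floorSize_rpow_le hA hℓ hΔ ha0
    calc stratVar (P.oracle θ) m / ((A.nbar : ℝ) * (m : ℝ) ^ q) / t ^ 2
        ≤ C * (m : ℝ) ^ (-p) / ((A.nbar : ℝ) * (m : ℝ) ^ q) / t ^ 2 := by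
          have := hC θ hθ m (hm₀1.trans hm)
          gcongr
      _ = C / A.nbar * ((m : ℝ) ^ (-p) / (m : ℝ) ^ q) / t ^ 2 := by
          field_simp
      _ ≤ C / A.nbar * ((A.nbar : ℝ) ^ a *
          ((A.σminSq / A.κas ^ 2) ^ (-a) * ℓ ^ (-a) * Δ ^ (2 * gam * a))) / t ^ 2 := by gcongr
      _ = _ := by rw [hK₂, hX]; ring
  have hsub : {ω | ¬ GoodCall P A gam ℓ J t θ Δ (drawsAt (fun a => V a ω) k i)} ⊆
      {ω | ∀ m, m₀ ≤ m → m ≤ m₀ + J →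
        A.σminSq < meanStratumVar P A θ m (drawsAt (fun a => V a ω) k i m)} ∪
      ⋃ m ∈ Finset.Icc m₀ (m₀ + J), {ω | t < |stratifiedEstimate P A θ m
        (drawsAt (fun a => V a ω) k i m) - P.f θ|} := by
    intro ω hω
    by_contra hcon
    simp only [mem_union, mem_iUnion, not_or, not_exists, Finset.mem_Icc, mem_ofPred_eq,
      not_lt, not_forall] at hcon
    refine hω ⟨?_, fun m h1 h2 => ?_⟩
    · obtain ⟨m, h1, h2, h3⟩ := hcon.1
      exact ⟨m, h1, h2, h3⟩
    · rw [hP.integral_oracle hθ]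
      exact hcon.2 m ⟨h1, h2⟩
  calc _ ≤ _ := measure_mono hsub
    _ ≤ _ := measure_union_le _ _
    _ ≤ ENNReal.ofReal (K₁ * ℓ ^ (-a₁)) ^ (J + 1) +
        ∑ m ∈ Finset.Icc m₀ (m₀ + J), ENNReal.ofReal (K₂ * X) := by
        refine add_le_add
          (measure_forall_meanStratumVar_le hP hV_meas hV_indep θ k i m₀ hB1 J)
          ((measure_biUnion_finset_le _ _).trans (Finset.sum_le_sum fun m hm => ?_))
        exact hB2 m (Finset.mem_Icc.1 hm).1
    _ = ENNReal.ofReal ((K₁ * ℓ ^ (-a₁)) ^ (J + 1) + (J + 1) * (K₂ * X)) := by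
        rw [Finset.sum_const, Nat.card_Icc, ENNReal.ofReal_add (by positivity) (by positivity),
          ENNReal.ofReal_pow (by positivity), ENNReal.ofReal_mul (by positivity : (0 : ℝ) ≤ J + 1),
          nsmul_eq_mul]
        congr 2
        rw [← Nat.cast_succ, ENNReal.ofReal_natCast]
        congr 1
        omega
    _ ≤ _ := by
        refine ENNReal.ofReal_le_ofReal ?_
        rw [mul_pow, ← Real.rpow_natCast (ℓ ^ (-a₁)), ← Real.rpow_mul hℓ0.le]
        push_cast
        rw [neg_mul]
        have h1 : 0 ≤ K₁ ^ (J + 1) * X := by positivity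
        have h2 : 0 ≤ ((J : ℝ) + 1) * K₂ * ℓ ^ (-(a₁ * (J + 1))) := by positivity
        nlinarith

end Call

/-! ### Almost sure success of all but finitely many iterations -/

section Path

variable {d q : ℕ} {P : Problem d q} {A : Params d} {lam : ℕ → ℝ} {gam : ℝ}

theorem dependsOn_run (k : ℕ) :
    DependsOn (fun v : SampleIdx d q → (Fin q → ℝ) => run P A lam gam v k) {a | a.1 < k} := by
  induction k with
  | zero => exact fun _ _ _ => rfl
  | succ k ih =>
    intro v v' h
    have h1 : run P A lam gam v k = run P A lam gam v' k :=
      ih fun a (ha : a.1 < k) => h a (Nat.lt_succ_of_lt ha)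
    have h2 : drawsAt v k = drawsAt v' k :=
      funext fun i => funext fun m => funext fun s => funext fun r => h _ (Nat.lt_succ_self k)
    simp only [run, h1, h2]

/-- The point at which a call of the sampling routine takes place, and the trust-region radius. -/
def callState (P : Problem d q) (A : Params d) (lam : ℕ → ℝ) (gam : ℝ) (k : ℕ) (i : PointIdx d)
    (v : SampleIdx d q → (Fin q → ℝ)) : Dec d × ℝ :=
  (evalPoint P A lam gam k (run P A lam gam v k).1 (run P A lam gam v k).2 (drawsAt v k) i,
    (run P A lam gam v k).2)

theorem measurable_callState (hP : P.Standing) (hA : A.Admissible) (k : ℕ) (i : PointIdx d) :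
    Measurable (callState P A lam gam k i) :=
  (measurable_evalPoint hP hA (measurable_run hP hA k).fst (measurable_run hP hA k).snd
    (measurable_drawsAt k) k i).prodMk (measurable_run hP hA k).snd

/-- The state in which a call takes place does not involve the draws of this call: the
interpolation points are determined by the past iterations, the candidate by these and the
estimates at the interpolation points. -/
theorem dependsOn_callState (k : ℕ) (i : PointIdx d) :
    DependsOn (callState P A lam gam k i) {a : SampleIdx d q | a.1 = k ∧ a.2.1 = i}ᶜ := by
  intro v v' h
  have h1 : run P A lam gam v k = run P A lam gam v' k :=
    dependsOn_run k fun a (ha : a.1 < k) => h a fun h' => ha.ne h'.1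
  rcases i with _ | i
  · have h2 : ∀ j, drawsAt v k (some j) = drawsAt v' k (some j) := fun j =>
      funext fun m => funext fun s => funext fun r => h _ fun h' => Option.some_ne_none j h'.2
    simp only [callState, evalPoint, modelCoeff, h1, h2]
  · simp only [callState, evalPoint, h1]

variable {Ω : Type*} [MeasurableSpace Ω] {Pr : Measure Ω} [IsProbabilityMeasure Pr]
  {V : SampleIdx d q → Ω → (Fin q → ℝ)}

theorem measure_callState_le (hP : P.Standing) (hA : A.Admissible)
    (hV_meas : ∀ a, Measurable (V a)) (hV_indep : iIndepFun V Pr) (k : ℕ) (i : PointIdx d)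
    {B : Dec d × ℝ → (ℕ → Draws q) → Prop}
    (hB : MeasurableSet {p : (Dec d × ℝ) × (SampleIdx d q → (Fin q → ℝ)) |
      B p.1 (drawsAt p.2 k i)}) {c : ℝ≥0∞}
    (hc : ∀ z, Pr {ω | B z (drawsAt (fun a => V a ω) k i)} ≤ c) :
    Pr {ω | B (callState P A lam gam k i fun a => V a ω) (drawsAt (fun a => V a ω) k i)} ≤ c := by
  refine measure_subst_le (B := fun z v => B z (drawsAt v k i)) hV_meas hV_indep
    disjoint_compl_left (measurable_callState hP hA k i) (dependsOn_callState k i) hB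
    (fun z v v' h => ?_) hc
  have : drawsAt v k i = drawsAt v' k i :=
    funext fun m => funext fun s => funext fun r => h _ ⟨rfl, rfl⟩
  exact congrArg (B z) this

theorem measurable_minStrata (gam ℓ : ℝ) : Measurable (minStrata q A gam ℓ) := by
  have h : Measurable fun Δ => (floorSize A gam ℓ Δ / A.nbar) ^ ((q : ℝ)⁻¹) := by
    unfold floorSize
    fun_prop
  exact (measurable_of_countable (max 1)).comp (Nat.measurable_ceil.comp h)

section MeasurableCalls

variable (hP : P.Standing) (k : ℕ) (i : PointIdx d)

include hP

theorem measurable_meanStratumVar_call (m : ℕ) :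
    Measurable fun p : (Dec d × ℝ) × (SampleIdx d q → (Fin q → ℝ)) =>
      meanStratumVar P A p.1.1 m (drawsAt p.2 k i m) :=
  measurable_meanStratumVar hP measurable_fst.fst ((measurable_pi_apply m).comp
    ((measurable_pi_apply i).comp ((measurable_drawsAt k).comp measurable_snd))) m

theorem measurableSet_goodCall (ℓ : ℝ) (J : ℕ) {t : ℝ → ℝ} (ht : Measurable t) :
    MeasurableSet {p : (Dec d × ℝ) × (SampleIdx d q → (Fin q → ℝ)) |
      GoodCall P A gam ℓ J (t p.1.2) p.1.1 p.1.2 (drawsAt p.2 k i)} := by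
  have hm : Measurable fun p : (Dec d × ℝ) × (SampleIdx d q → (Fin q → ℝ)) =>
    minStrata q A gam ℓ p.1.2 := (measurable_minStrata gam ℓ).comp measurable_fst.snd
  have hlow : ∀ m, MeasurableSet {p : (Dec d × ℝ) × (SampleIdx d q → (Fin q → ℝ)) |
      minStrata q A gam ℓ p.1.2 ≤ m} := fun m => hm (measurableSet_Iic (a := m))
  have hupp : ∀ m, MeasurableSet {p : (Dec d × ℝ) × (SampleIdx d q → (Fin q → ℝ)) |
      m ≤ minStrata q A gam ℓ p.1.2 + J} := fun m =>
    ((measurable_of_countable (· + J)).comp hm) (measurableSet_Ici (a := m))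
  have hint : Measurable fun p : (Dec d × ℝ) × (SampleIdx d q → (Fin q → ℝ)) =>
      ∫ u, P.oracle p.1.1 u ∂cubeUniform q := by
    have h : StronglyMeasurable fun θ => ∫ u, P.oracle θ u ∂cubeUniform q :=
      hP.measurable_oracle.stronglyMeasurable.integral_prod_right
    exact h.measurable.comp measurable_fst.fst
  refine MeasurableSet.inter (measurableSet_setOfPred.2 (Measurable.exists fun m => ?_))
    (measurableSet_setOfPred.2 (Measurable.forall fun m => ?_))
  · exact (measurableSet_setOfPred.1 (hlow m)).and ((measurableSet_setOfPred.1 (hupp m)).and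
      (measurableSet_setOfPred.1 (measurableSet_le (measurable_meanStratumVar_call hP k i m)
        measurable_const)))
  · refine (measurableSet_setOfPred.1 (hlow m)).imp ((measurableSet_setOfPred.1 (hupp m)).imp
      (measurableSet_setOfPred.1 (measurableSet_le ?_ (ht.comp measurable_fst.snd))))
    exact continuous_abs.measurable.comp ((measurable_stratifiedEstimate hP measurable_fst.fst
      ((measurable_pi_apply m).comp ((measurable_pi_apply i).comp
        ((measurable_drawsAt k).comp measurable_snd))) m).sub hint)

end MeasurableCalls

/-- If the failure probabilities are summable, then by the Borel-Cantelli lemma almost surely all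
calls from some iteration on are successful. -/
theorem ae_eventually_goodCall (hP : P.Standing) (hA : A.Admissible)
    (hV_meas : ∀ a, Measurable (V a)) (hV_indep : iIndepFun V Pr) (J : ℕ) {t : ℝ → ℝ}
    (ht : Measurable t) {S : ℕ → Set ℝ} (hS : ∀ k, MeasurableSet (S k)) {b : ℕ → ℝ}
    (hb0 : ∀ k, 0 ≤ b k) (hb : Summable b)
    (hbad : ∀ k i, ∀ θ ∈ P.Θ, ∀ Δ ∈ S k, Pr {ω | ¬ GoodCall P A gam (lam k) J (t Δ) θ Δ
      (drawsAt (fun a => V a ω) k i)} ≤ ENNReal.ofReal (b k)) :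
    ∀ᵐ ω ∂Pr, ∃ K, ∀ k ≥ K, ∀ i,
      (callState P A lam gam k i fun a => V a ω).1 ∈ P.Θ →
      (run P A lam gam (fun a => V a ω) k).2 ∈ S k →
      GoodCall P A gam (lam k) J (t (run P A lam gam (fun a => V a ω) k).2)
        (callState P A lam gam k i fun a => V a ω).1 (run P A lam gam (fun a => V a ω) k).2
        (drawsAt (fun a => V a ω) k i) := by
  set B : ℕ → Dec d × ℝ → (ℕ → Draws q) → Prop := fun k z w =>
    (z.1 ∈ P.Θ ∧ z.2 ∈ S k) ∧ ¬ GoodCall P A gam (lam k) J (t z.2) z.1 z.2 w with hB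
  have hprob : ∀ i k, Pr {ω | B k (callState P A lam gam k i fun a => V a ω)
      (drawsAt (fun a => V a ω) k i)} ≤ ENNReal.ofReal (b k) := by
    intro i k
    refine measure_callState_le hP hA hV_meas hV_indep k i ?_ fun z => ?_
    · exact ((measurable_fst.fst hP.measurableSet_Θ).inter (measurable_fst.snd (hS k))).inter
        (measurableSet_goodCall hP k i (lam k) J ht).compl
    · by_cases hz : z.1 ∈ P.Θ ∧ z.2 ∈ S k
      · exact (measure_mono fun ω hω => hω.2).trans (hbad k i z.1 hz.1 z.2 hz.2)
      · have : {ω | B k z (drawsAt (fun a => V a ω) k i)} = ∅ :=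
          eq_empty_of_forall_notMem fun ω hω => hz hω.1
        rw [this, measure_empty]
        exact zero_le
  have hae : ∀ᵐ ω ∂Pr, ∀ i, ∀ᶠ k in Filter.atTop, ω ∉ {ω | B k
      (callState P A lam gam k i fun a => V a ω) (drawsAt (fun a => V a ω) k i)} := by
    refine ae_all_iff.2 fun i => ae_eventually_notMem ?_
    refine ne_top_of_le_ne_top ?_ (ENNReal.tsum_le_tsum (hprob i))
    rw [← ENNReal.ofReal_tsum_of_nonneg hb0 hb]
    exact ENNReal.ofReal_ne_top
  filter_upwards [hae] with ω hω
  obtain ⟨K, hK⟩ := Filter.eventually_atTop.1 (Filter.eventually_all.2 hω)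
  refine ⟨K, fun k hk i h1 h2 => ?_⟩
  by_contra hcon
  exact hK k hk i ⟨⟨h1, h2⟩, hcon⟩

/-- Almost surely, all sample sizes are finite. -/
theorem ae_runSampleSize_ne_top (hq : 1 ≤ q) (hP : P.Standing) (hA : A.Admissible)
    (hV_meas : ∀ a, Measurable (V a)) (hV_law : ∀ a, Pr.map (V a) = cubeUniform q)
    (hV_indep : iIndepFun V Pr) (hlam : ∀ k, 1 ≤ lam k) {p : ℝ} (hp : 0 < p)
    (hdec : P.VarianceDecay p) :
    ∀ᵐ ω ∂Pr, ∀ k i, (callState P A lam gam k i fun a => V a ω).1 ∈ P.Θ →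
      runSampleSize P A lam gam (fun a => V a ω) k i ≠ ⊤ := by
  refine ae_all_iff.2 fun k => ae_all_iff.2 fun i => ?_
  set B : Dec d × ℝ → (ℕ → Draws q) → Prop := fun z w =>
    z.1 ∈ P.Θ ∧ ∀ m, minStrata q A gam (lam k) z.2 ≤ m →
      A.σminSq < meanStratumVar P A z.1 m (w m) with hB
  have hnull : Pr {ω | B (callState P A lam gam k i fun a => V a ω)
      (drawsAt (fun a => V a ω) k i)} = 0 := by
    refine le_antisymm (measure_callState_le hP hA hV_meas hV_indep k i ?_ fun z => ?_) zero_le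
    · refine (measurable_fst.fst hP.measurableSet_Θ).inter
        (measurableSet_setOfPred.2 (Measurable.forall fun m => ?_))
      refine Measurable.imp (measurableSet_setOfPred.1 ?_) (measurableSet_setOfPred.1
        (measurableSet_lt measurable_const (measurable_meanStratumVar_call hP k i m)))
      exact ((measurable_minStrata gam (lam k)).comp measurable_fst.snd)
        (measurableSet_Iic (a := m))
    · by_cases hz : z.1 ∈ P.Θ
      · refine le_trans (measure_mono fun ω hω => ?_) (measure_never_passes_eq_zero hP hA hV_meas
          hV_law hp hdec hz k i (minStrata q A gam (lam k) z.2)).le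
        exact hω.2
      · have : {ω | B z (drawsAt (fun a => V a ω) k i)} = ∅ :=
          eq_empty_of_forall_notMem fun ω hω => hz hω.1
        rw [this, measure_empty]
  filter_upwards [measure_eq_zero_iff_ae_notMem.1 hnull] with ω hω hmem
  have hex : ∃ m, minStrata q A gam (lam k) (run P A lam gam (fun a => V a ω) k).2 ≤ m ∧
      meanStratumVar P A (callState P A lam gam k i fun a => V a ω).1 m
        (drawsAt (fun a => V a ω) k i m) ≤ A.σminSq := by
    by_contra! hcon
    exact hω ⟨hmem, hcon⟩
  obtain ⟨m, hm, hv⟩ := hex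
  obtain ⟨n, -, -, hn⟩ := exists_strataPerAxis_eq hq hA (hlam k)
    (run_radius_pos hA (fun a => V a ω) k) hm hv
  have : runSampleSize P A lam gam (fun a => V a ω) k i =
      (A.nbar : ℕ∞) * strataPerAxis P A lam gam k (callState P A lam gam k i fun a => V a ω).1
        (run P A lam gam (fun a => V a ω) k).2 (drawsAt (fun a => V a ω) k i) ^ q := rfl
  rw [this, hn]
  exact_mod_cast ENat.natCast_ne_top (A.nbar * n ^ q)

end Path

/-! ### Sample complexity -/

section Complexity

variable {d q : ℕ} {P : Problem d q} {A : Params d} {gam : ℝ}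

theorem powSeq_eq {s : ℝ} {k : ℕ} (hk : 1 ≤ k) : powSeq s k = (k : ℝ) ^ s := by
  rw [powSeq, max_eq_right (by exact_mod_cast hk)]

theorem one_le_powSeq {s : ℝ} (hs : 0 ≤ s) (k : ℕ) : 1 ≤ powSeq s k :=
  Real.one_le_rpow (le_max_left _ _) hs

/-- In a successful call the estimate is accurate, and the sample size is of the order of its
deterministic lower bound. -/
theorem GoodCall.bounds (hq : 1 ≤ q) (hP : P.Standing) (hA : A.Admissible) {lam : ℕ → ℝ} {k : ℕ}
    (hlam : 1 ≤ lam k) (hgam : 0 ≤ gam) {D Δ : ℝ} (hΔ : 0 < Δ) (hΔD : Δ ≤ D) {θ : Dec d}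
    (hθ : θ ∈ P.Θ) {w : ℕ → Draws q} {J : ℕ} {t : ℝ}
    (h : GoodCall P A gam (lam k) J t θ Δ w) :
    |adaptiveEstimate P A lam gam k θ Δ w - P.f θ| ≤ t ∧
      (sampleSize P A lam gam k θ Δ w : ℝ≥0∞) ≤ ENNReal.ofReal
        (A.nbar * ((J : ℝ) + 2) ^ q * (D ^ (2 * gam) + A.σminSq / A.κas ^ 2) * lam k *
          Δ ^ (-(2 * gam))) := by
  obtain ⟨⟨m, hm1, hm2, hv⟩, herr⟩ := h
  obtain ⟨n, hn1, hn2, hn⟩ := exists_strataPerAxis_eq hq hA hlam hΔ hm1 hv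
  constructor
  · have h1 := herr n hn1 (hn2.trans hm2)
    rw [hP.integral_oracle hθ] at h1
    simpa only [adaptiveEstimate, hn, ENat.toNat_natCast] using h1
  · have h1 : (sampleSize P A lam gam k θ Δ w : ℝ≥0∞) =
        ENNReal.ofReal ((A.nbar : ℝ) * (n : ℝ) ^ q) := by
      rw [sampleSize, hn]
      have : ((A.nbar : ℝ) * (n : ℝ) ^ q) = ((A.nbar * n ^ q : ℕ) : ℝ) := by push_cast; ring
      rw [this, ENNReal.ofReal_natCast]
      push_cast
      rfl
    rw [h1]
    refine ENNReal.ofReal_le_ofReal ((sample_size_window_le hq hA hlam (hn2.trans hm2)).trans ?_)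
    have h2 := floorSize_le hA hlam hΔ hΔD hgam
    calc _ ≤ A.nbar * ((J : ℝ) + 2) ^ q *
          ((D ^ (2 * gam) + A.σminSq / A.κas ^ 2) * lam k * Δ ^ (-(2 * gam))) := by gcongr
      _ = _ := by ring

variable {Ω : Type*} [MeasurableSpace Ω] {Pr : Measure Ω} [IsProbabilityMeasure Pr]
  {V : SampleIdx d q → Ω → (Fin q → ℝ)}

/-- Since the conditions on `s` leave some room, they survive a decay exponent `p` slightly smaller
than `p₀` and a slack `τ` in the accuracy. Here `r` is the dimension `q`, and `(r + p) / r` is the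
exponent with which the mean squared error of an estimate decays in the sample size. -/
theorem exists_slack {p₀ s r : ℝ} (hr : 0 < r) (hp₀ : 0 < p₀) (hgam : 0 < gam)
    (hs : r < s * (r + p₀)) (hgam2 : 2 * r ≤ gam * (r + p₀)) (hs0 : 0 < s) :
    ∃ τ p : ℝ, 0 < τ ∧ τ ≤ 1 / 2 ∧ 4 * gam * τ ≤ 1 + s ∧ 0 < p ∧ p < p₀ ∧
      1 < s * ((r + p) / r) - 4 * τ ∧ 4 - 2 * τ ≤ 2 * gam * ((r + p) / r) := by
  set e := s * (r + p₀) / r - 1 with he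
  have he0 : 0 < e := by rw [he, sub_pos, one_lt_div hr]; exact hs
  set τ := min (1 / 2) (min ((1 + s) / (4 * gam)) (e / 16)) with hτ
  have hτ0 : 0 < τ := lt_min (by norm_num) (lt_min (by positivity) (by positivity))
  have hτ1 : τ ≤ (1 + s) / (4 * gam) := (min_le_right _ _).trans (min_le_left _ _)
  have hτ2 : τ ≤ e / 16 := (min_le_right _ _).trans (min_le_right _ _)
  set x := min (p₀ / (2 * r)) (min (τ / gam) (e / (4 * s))) with hx
  have hx0 : 0 < x := lt_min (by positivity) (lt_min (by positivity) (by positivity))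
  have hx1 : x ≤ p₀ / (2 * r) := min_le_left _ _
  have hx2 : x ≤ τ / gam := (min_le_right _ _).trans (min_le_left _ _)
  have hx3 : x ≤ e / (4 * s) := (min_le_right _ _).trans (min_le_right _ _)
  rw [le_div_iff₀ (by positivity)] at hτ1 hx1 hx2 hx3
  have hdiv : (r + (p₀ - r * x)) / r = (r + p₀) / r - x := by field_simp; ring
  refine ⟨τ, p₀ - r * x, hτ0, min_le_left _ _, by linarith, by nlinarith, by nlinarith, ?_, ?_⟩
  · rw [hdiv, mul_sub, ← mul_div_assoc]
    have : s * (r + p₀) / r = e + 1 := by rw [he]; ring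
    rw [this]
    linarith
  · rw [hdiv]
    have : 2 ≤ gam * ((r + p₀) / r) := by
      rw [← mul_div_assoc, le_div_iff₀ hr]; exact hgam2
    nlinarith

/-- If the variance within the strata decays with any exponent smaller than `p₀`, then the
complexity bound holds for all sampling exponents `s > q / (q + p₀)` and
`γ ≥ 2 q / (q + p₀)`. -/
theorem sampleComplexity_of_varianceDecay (hq : 1 ≤ q) (hP : P.Standing) (hA : A.Admissible)
    (hV_meas : ∀ a, Measurable (V a)) (hV_law : ∀ a, Pr.map (V a) = cubeUniform q)
    (hV_indep : iIndepFun V Pr) {p₀ : ℝ} (hp₀ : 0 < p₀)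
    (hdec : ∀ p, 0 < p → p < p₀ → P.VarianceDecay p) {s : ℝ}
    (hs : q < s * (q + p₀)) (hgam : 2 * q ≤ gam * (q + p₀)) :
    SampleComplexity P A (powSeq s) gam Pr V (2 * s + 2 + 2 * gam) := by
  have hq0 : (0 : ℝ) < q := by exact_mod_cast hq
  have hs0 : 0 < s := pos_of_mul_pos_left (hq0.trans hs) (by positivity)
  have hgam0 : 0 < gam := pos_of_mul_pos_left (lt_of_lt_of_le (by positivity) hgam)
    (by positivity : (0 : ℝ) ≤ q + p₀)
  obtain ⟨τ, p, hτ0, hτ1, hτ2, hp0, hpp, hsa, hga⟩ := exists_slack hq0 hp₀ hgam0 hs hgam hs0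
  have hdecp := hdec p hp0 hpp
  have hlam : ∀ k, 1 ≤ powSeq s k := one_le_powSeq hs0.le
  set a : ℝ := (q + p) / q with ha
  set D : ℝ := max A.Δ₀ A.Δmax with hD
  have hD0 : 0 < D := lt_max_of_lt_left hA.Δ₀_pos
  obtain ⟨L, hL⟩ := hP.f_gradient_lipschitz
  obtain ⟨c, hcτ, c₀, hc₀, hstep⟩ := exists_stepOK (P := P) (lam := powSeq s) (gam := gam) hA
    (L := L) L.2 hτ0 hτ1
  -- so many late stratifications make the failure probability of the stopping rule `O(k ^ (-2))`
  set J : ℕ := ⌈2 / (s * (p / q))⌉₊ with hJ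
  have hJ2 : 2 ≤ s * (p / q * (J + 1)) := by
    have h1 : 2 / (s * (p / q)) ≤ J := Nat.le_ceil _
    rw [div_le_iff₀ (by positivity)] at h1
    have : 0 < s * (p / q) := by positivity
    nlinarith
  obtain ⟨K, hK0, hK⟩ := measure_not_goodCall_le (gam := gam) hq hP hA hV_meas hV_law hV_indep hp0
    hdecp J
  set y : ℝ := 2 * gam * a - 4 + 2 * τ with hy
  have hy0 : 0 ≤ y := by linarith
  have hell : ∀ (k : ℕ), 1 ≤ k → ∀ x : ℝ, powSeq s k ^ (-x) = (k : ℝ) ^ (-(s * x)) := by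
    intro k hk x
    rw [powSeq_eq hk, ← Real.rpow_mul (by positivity), mul_neg]
  have hell2 : ∀ (k : ℕ), 1 ≤ k →
      powSeq s k ^ (-(p / q * ((J : ℝ) + 1))) ≤ (k : ℝ) ^ (-2 : ℝ) := by
    intro k hk
    rw [hell k hk]
    exact Real.rpow_le_rpow_of_exponent_le (by exact_mod_cast hk) (by linarith)
  have hsum : ∀ M r : ℝ, 1 < r → Summable fun k : ℕ =>
      K * ((k : ℝ) ^ (-2 : ℝ) + (k : ℝ) ^ (-r) * M) := fun M r hr =>
    ((Real.summable_nat_rpow.2 (by norm_num)).add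
      ((Real.summable_nat_rpow.2 (by linarith)).mul_right M)).mul_left K
  -- accuracy `Δ ^ (2 - τ)` in all iterations
  have hgood1 := ae_eventually_goodCall (lam := powSeq s) (gam := gam) (V := V) (Pr := Pr) hP hA
    hV_meas hV_indep J (t := fun Δ => Δ ^ (2 - τ)) (by fun_prop)
    (S := fun k => {Δ | 1 ≤ k ∧ 0 < Δ ∧ Δ ≤ D})
    (fun k => (MeasurableSet.const _).inter (measurableSet_Ioi.inter measurableSet_Iic))
    (b := fun k => K * ((k : ℝ) ^ (-2 : ℝ) + (k : ℝ) ^ (-(s * a)) * D ^ y))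
    (fun k => by positivity) (hsum _ _ (by linarith)) (by
      rintro k i θ hθ Δ ⟨hk, hΔ, hΔD⟩
      refine (hK k i (powSeq s k) Δ (Δ ^ (2 - τ)) θ hθ (hlam k) hΔ
        (Real.rpow_pos_of_pos hΔ _)).trans (ENNReal.ofReal_le_ofReal ?_)
      have h1 : Δ ^ (2 * gam * a) / (Δ ^ (2 - τ)) ^ 2 = Δ ^ y := by
        rw [← Real.rpow_natCast, ← Real.rpow_mul hΔ.le, ← Real.rpow_sub hΔ, hy]
        congr 1; push_cast; ring
      rw [mul_div_assoc, h1, hell k hk a]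
      gcongr
      exact hell2 k hk)
  -- accuracy `c₀ Δ ^ 2` in the iterations with `Δ ≥ 1 / k ^ 2`
  have hgood2 := ae_eventually_goodCall (lam := powSeq s) (gam := gam) (V := V) (Pr := Pr) hP hA
    hV_meas hV_indep J (t := fun Δ => c₀ * Δ ^ 2) (by fun_prop)
    (S := fun k => {Δ | 1 ≤ k ∧ 0 < Δ ∧ Δ ≤ D ∧ 1 / (k : ℝ) ^ 2 ≤ Δ})
    (fun k => (MeasurableSet.const _).inter (measurableSet_Ioi.inter
      (measurableSet_Iic.inter measurableSet_Ici)))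
    (b := fun k => K * ((k : ℝ) ^ (-2 : ℝ) + (k : ℝ) ^ (-(s * a - 4 * τ)) * (D ^ y / c₀ ^ 2)))
    (fun k => by positivity) (hsum _ _ hsa) (by
      rintro k i θ hθ Δ ⟨hk, hΔ, hΔD, hkΔ⟩
      refine (hK k i (powSeq s k) Δ (c₀ * Δ ^ 2) θ hθ (hlam k) hΔ (by positivity)).trans
        (ENNReal.ofReal_le_ofReal ?_)
      have hkr : (0 : ℝ) < k := by exact_mod_cast hk
      have h1 : Δ ^ (2 * gam * a) / (c₀ * Δ ^ 2) ^ 2 = Δ ^ (-(2 * τ)) * (Δ ^ y / c₀ ^ 2) := by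
        have h4 : Δ ^ (2 * gam * a) = Δ ^ (-(2 * τ)) * Δ ^ y * (Δ ^ 2) ^ 2 := by
          rw [← pow_mul, ← Real.rpow_natCast Δ (2 * 2), ← Real.rpow_add hΔ, ← Real.rpow_add hΔ, hy]
          congr 1; push_cast; ring
        rw [h4]
        field_simp
      have h2 : Δ ^ (-(2 * τ)) ≤ (k : ℝ) ^ (4 * τ) := by
        calc Δ ^ (-(2 * τ)) ≤ (1 / (k : ℝ) ^ 2) ^ (-(2 * τ)) :=
              Real.rpow_le_rpow_of_nonpos (by positivity) hkΔ (by linarith)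
          _ = (k : ℝ) ^ (4 * τ) := by
              rw [one_div, ← Real.rpow_natCast, ← Real.rpow_neg hkr.le, ← Real.rpow_mul hkr.le]
              congr 1; push_cast; ring
      have h3 : (k : ℝ) ^ (-(s * a - 4 * τ)) = (k : ℝ) ^ (-(s * a)) * (k : ℝ) ^ (4 * τ) := by
        rw [← Real.rpow_add hkr]; congr 1; ring
      rw [mul_div_assoc, h1, hell k hk a, h3, mul_assoc]
      gcongr
      exact hell2 k hk)
  have hfin := ae_runSampleSize_ne_top (lam := powSeq s) (gam := gam) (V := V) (Pr := Pr) hq hP hA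
    hV_meas hV_law hV_indep hlam hp0 hdecp
  filter_upwards [hgood1, hgood2, hfin] with ω ⟨K₁, h1⟩ ⟨K₂, h2⟩ hfin hballs
  set v : SampleIdx d q → (Fin q → ℝ) := fun a => V a ω with hv
  have hΔ0 : ∀ k, 0 < (run P A (powSeq s) gam v k).2 := run_radius_pos hA v
  have hΔD : ∀ k, (run P A (powSeq s) gam v k).2 ≤ D := run_radius_le hA v
  have hΘ : ∀ k i, (callState P A (powSeq s) gam k i v).1 ∈ P.Θ := fun k i =>
    hballs k (evalPoint_mem_closedBall hA (hΔ0 k) _ i)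
  have hcenter : ∀ k, (run P A (powSeq s) gam v k).1 ∈ P.Θ := fun k =>
    hballs k (Metric.mem_closedBall_self (hΔ0 k).le)
  obtain ⟨φmin, hφmin⟩ := hP.f_bddBelow
  set K₃ : ℕ := max 1 (max K₁ K₂) with hK₃
  have hK₃1 : 1 ≤ K₃ := le_max_left _ _
  have hK₃K₁ : K₁ ≤ K₃ := (le_max_left _ _).trans (le_max_right _ _)
  have hK₃K₂ : K₂ ≤ K₃ := (le_max_right _ _).trans (le_max_right _ _)
  set M : ℝ := A.nbar * ((J : ℝ) + 2) ^ q * (D ^ (2 * gam) + A.σminSq / A.κas ^ 2) with hM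
  have hM0 : 0 < M := by
    have := hA.two_le_nbar
    have := hA.σminSq_pos
    have := hA.κas_pos
    positivity
  have hb1 : ∀ k ≥ K₃, ∀ i, _ := fun k hk i =>
    (h1 k (hK₃K₁.trans hk) i (hΘ k i) ⟨hK₃1.trans hk, hΔ0 k, hΔD k⟩).bounds hq hP hA (hlam k)
      hgam0.le (hΔ0 k) (hΔD k) (hΘ k i)
  have hstepOK : ∀ k, K₃ ≤ k → StepOK c (fun k => (run P A (powSeq s) gam v k).2)
      (fun k => P.f (run P A (powSeq s) gam v k).1)
      (fun k => ‖gradient P.f (run P A (powSeq s) gam v k).1‖) k := by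
    intro k hk
    refine hstep v k _ _ _ rfl rfl (fun x hx => hP.f_differentiable x (hballs k hx))
      (fun x hx => ?_) (fun i => (hb1 k hk i).1) (fun hkΔ i => ?_)
    · simpa only [dist_eq_norm] using hL.dist_le_mul x (hballs k hx) _ (hcenter k)
    · exact ((h2 k (hK₃K₂.trans hk) i (hΘ k i)
        ⟨hK₃1.trans hk, hΔ0 k, hΔD k, hkΔ⟩).bounds hq hP hA (hlam k) hgam0.le (hΔ0 k) (hΔD k)
        (hΘ k i)).1
  obtain ⟨C, hC, ε₀, hε₀, hmain⟩ := exists_sum_evaluations_le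
    (N := fun k => ∑ i : PointIdx d, (runSampleSize P A (powSeq s) gam v k i : ℝ≥0∞))
    (C₄ := Fintype.card (PointIdx d) * M) (s := s) (γ := gam) hK₃1 hΔ0
    (fun k => hφmin (mem_image_of_mem _ (hcenter k))) hstepOK (by positivity) hs0.le hgam0
    (by rw [hcτ]; exact hτ2)
    (fun k hk => by
      calc _ ≤ ∑ i : PointIdx d, ENNReal.ofReal
            (M * powSeq s k * (run P A (powSeq s) gam v k).2 ^ (-(2 * gam))) :=
            Finset.sum_le_sum fun i _ => (hb1 k hk i).2
        _ = _ := by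
            rw [Finset.sum_const, Finset.card_univ, nsmul_eq_mul, powSeq_eq (hK₃1.trans hk),
              ← ENNReal.ofReal_natCast, ← ENNReal.ofReal_mul (by positivity)]
            congr 1; ring)
    (fun k => ENNReal.sum_ne_top.2 fun i _ => by simpa using hfin k i (hΘ k i))
  refine ⟨C, hC, ε₀, hε₀, fun ε hε hεε₀ => ?_⟩
  refine (le_of_eq ?_).trans (hmain ε hε hεε₀ (hittingTime P A (powSeq s) gam v ε) ?_)
  · simp only [oracleCalls]
  · intro n hn k hk
    by_contra! hcon
    have h3 : (n : ℕ∞) ≤ k := hn.trans (iInf₂_le k hcon)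
    exact absurd (by exact_mod_cast h3 : n ≤ k) (not_le.2 hk)

end Complexity

end Sastro

end

theorem mainTheorem1 {Ω : Type*} [MeasurableSpace Ω] (Pr : Measure Ω) [IsProbabilityMeasure Pr]
    (d q : ℕ) (hq : 1 ≤ q)
    (P : Sastro.Problem d q) (hP : P.Standing)
    (A : Sastro.Params d) (hA : A.Admissible)
    (V : Sastro.SampleIdx d q → Ω → (Fin q → ℝ))
    (hV_meas : ∀ a, Measurable (V a))
    (hV_law : ∀ a, Pr.map (V a) = Sastro.cubeUniform q)
    (hV_indep : iIndepFun V Pr)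
    (δ ϱ : ℝ) (hδ : 0 < δ) (hϱ : 0 < ϱ) :
    -- bounded gradient of the inverse map
    (P.BoundedGradient →
      Sastro.SampleComplexity P A
        (Sastro.powSeq ((1 + δ) * q / (q + 2))) (2 * q / (q + 2)) Pr V
        ((8 * q + 4 + 2 * q * δ) / (q + 2))) ∧
    -- sub-exponential margins, polynomial oracle
    (P.IndepMargins → ∀ (κ : Fin q → ℝ) (a : Fin q → ℕ), (∀ i, 0 < κ i) →
      P.SubExponential κ → P.PolynomialGrowth a →
      Sastro.SampleComplexity P A
        (Sastro.powSeq ((1 + δ) * q / (q + 1))) ((4 + ϱ) * q / (2 * (q + 1))) Pr V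
        ((8 * q + 2 + (2 * δ + ϱ) * q) / (q + 1))) ∧
    -- sub-exponential margins, exponential oracle
    (P.IndepMargins → ∀ (κ b : Fin q → ℝ) (κmin bmax : ℝ), (∀ i, 0 < κ i) →
      IsLeast (Set.range κ) κmin → IsGreatest (Set.range b) bmax → 0 ≤ bmax → 2 * bmax < κmin →
      P.SubExponential κ → P.ExponentialGrowth b →
      Sastro.SampleComplexity P A
        (Sastro.powSeq ((1 + δ) * q * κmin / ((q + 1) * κmin - 2 * bmax)))
        (2 * q * κmin / ((q + 1) * κmin - 2 * bmax)) Pr V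
        (((8 * q + 2 * δ * q + 2) * κmin - 4 * bmax) / ((q + 1) * κmin - 2 * bmax))) ∧
    -- sub-Gaussian margins, polynomial oracle
    (P.IndepMargins → ∀ (ξ : Fin q → ℝ) (a : Fin q → ℕ), (∀ i, 0 < ξ i) →
      P.SubGaussian ξ → P.PolynomialGrowth a →
      Sastro.SampleComplexity P A
        (Sastro.powSeq ((1 + δ) * q / (q + 1))) ((4 + ϱ) * q / (2 * (q + 1))) Pr V
        ((8 * q + 2 + (2 * δ + ϱ) * q) / (q + 1))) ∧
    -- sub-Gaussian margins, exponential oracle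
    (P.IndepMargins → ∀ (ξ b : Fin q → ℝ), (∀ i, 0 < ξ i) →
      P.SubGaussian ξ → P.ExponentialGrowth b →
      Sastro.SampleComplexity P A
        (Sastro.powSeq ((1 + δ) * q / (q + 1))) ((4 + ϱ) * q / (2 * (q + 1))) Pr V
        ((8 * q + 2 + (2 * δ + ϱ) * q) / (q + 1))) ∧
    -- the exponents are smaller than `8 + 2δ`
    ((8 * q + 4 + 2 * q * δ) / (q + 2) < 8 + 2 * δ ∧
      (ϱ * q < 6 + 2 * δ → (8 * q + 2 + (2 * δ + ϱ) * q) / (q + 1) < 8 + 2 * δ) ∧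
      ∀ κmin bmax : ℝ, 0 ≤ bmax → 2 * bmax < κmin →
        ((8 * q + 2 * δ * q + 2) * κmin - 4 * bmax) / ((q + 1) * κmin - 2 * bmax) < 8 + 2 * δ) := by
  have hq1 : (1 : ℝ) ≤ q := by exact_mod_cast hq
  have hq0 : (0 : ℝ) < q := by linarith
  have hq2 : (0 : ℝ) < q + 2 := by linarith
  have hq3 : (0 : ℝ) < q + 1 := by linarith
  have hδq : 0 < δ * q := mul_pos hδ hq0
  have hϱq : 0 < ϱ * q := mul_pos hϱ hq0
  -- the three cases in which the variance within the strata decays almost like `m⁻¹`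
  have hone : (∀ p : ℝ, 0 < p → p < 1 → P.VarianceDecay p) →
      Sastro.SampleComplexity P A
        (Sastro.powSeq ((1 + δ) * q / (q + 1))) ((4 + ϱ) * q / (2 * (q + 1))) Pr V
        ((8 * q + 2 + (2 * δ + ϱ) * q) / (q + 1)) := by
    intro hdec
    have h := Sastro.sampleComplexity_of_varianceDecay (s := (1 + δ) * q / (q + 1))
      (gam := (4 + ϱ) * q / (2 * (q + 1))) hq hP hA hV_meas hV_law hV_indep one_pos hdec
      (by rw [div_mul_cancel₀ _ hq3.ne']; linarith)
      (by
        have : (4 + ϱ) * q / (2 * (q + 1)) * (q + 1) = (4 + ϱ) * q / 2 := by field_simp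
        rw [this]; linarith)
    convert h using 1
    field_simp
    ring
  refine ⟨fun hB => ?_, fun hI κ a hκ hS hE => ?_,
    fun hI κ b κmin bmax hκ hmin hmax hb0 hbκ hS hE => ?_, fun hI ξ a hξ hS hE => ?_, fun hI ξ b hξ hS hE => ?_, ?_, fun h => ?_,
    fun κmin bmax hb0 hbκ => ?_⟩
  · have h := Sastro.sampleComplexity_of_varianceDecay (s := (1 + δ) * q / (q + 2))
      (gam := 2 * q / (q + 2)) hq hP hA hV_meas hV_law hV_indep two_pos
      (fun p _ hp => (hB.varianceDecay hP).mono hp.le)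
      (by rw [div_mul_cancel₀ _ hq2.ne']; linarith)
      (by rw [div_mul_cancel₀ _ hq2.ne'])
    convert h using 1
    field_simp
    ring
  · exact hone fun p hp0 hp1 => hI.varianceDecay_of_polynomial hP hq hκ hS hE hp0 hp1
  · have hκ0 : 0 < κmin := by linarith
    have hden : 0 < (q + 1) * κmin - 2 * bmax := by nlinarith
    have hp : (0 : ℝ) < 1 - 2 * bmax / κmin := by rw [sub_pos, div_lt_one hκ0]; exact hbκ
    have hqp : (q : ℝ) + (1 - 2 * bmax / κmin) = ((q + 1) * κmin - 2 * bmax) / κmin := by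
      field_simp; ring
    have h := Sastro.sampleComplexity_of_varianceDecay
      (s := (1 + δ) * q * κmin / ((q + 1) * κmin - 2 * bmax))
      (gam := 2 * q * κmin / ((q + 1) * κmin - 2 * bmax)) hq hP hA hV_meas hV_law hV_indep hp
      (fun p hp0 hp1 => hI.varianceDecay_of_exponential hP hκ0
        (fun i => hmin.2 (Set.mem_range_self i)) hb0 (fun j => hmax.2 (Set.mem_range_self j))
        hS hE hp0 hp1)
      (by
        rw [hqp, div_mul_div_cancel₀ hden.ne', mul_div_cancel_right₀ _ hκ0.ne']
        linarith)
      (by rw [hqp, div_mul_div_cancel₀ hden.ne', mul_div_cancel_right₀ _ hκ0.ne'])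
    convert h using 1
    rw [div_eq_iff hden.ne']
    linear_combination -2 * div_mul_cancel₀ ((1 + δ) * q * κmin) hden.ne' -
      2 * div_mul_cancel₀ (2 * q * κmin) hden.ne'
  · exact hone fun p hp0 hp1 => hI.varianceDecay_of_polynomial hP hq (fun _ => one_pos)
      (hS.subExponential hξ 1) hE hp0 hp1
  · exact hone fun p hp0 hp1 => hI.varianceDecay_of_subGaussian hP hξ hS hE hp0 hp1
  · rw [div_lt_iff₀ hq2]
    linarith
  · rw [div_lt_iff₀ hq3]
    linarith
  · rw [div_lt_iff₀ (by nlinarith)]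
    nlinarith
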